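/- Let $p,q\in\mathbb C$ with $|p|<1$, $q\neq 0$, and write $$\theta(z)=\prod_{j=0}^\infty(1-p^jz)(1-p^{j+1}/z),\qquad (z)_k=\theta(z)\theta(qz)\cdots\theta(q^{k-1}z)\quad(k\ge 0),$$ $(z_1,\dots,z_m)_k=(z_1)_k\cdots(z_m)_k$. For $z=(z_1,\dots,z_n)$ and $x=(x_1,\dots,x_n)$ write $|x|=x_1+\dots+x_n$, $Z=z_1\cdots z_n$ and $$\frac{\Delta(zq^x)}{\Delta(z)}=\prod_{1\le i<j\le n}\frac{q^{x_i}\theta(q^{x_j-x_i}z_j/z_i)}{\theta(z_j/z_i)}.$$ Let $N\ge 0$ be an integer and let $a,b,c,d,e,z_1,\dots,z_n$ be nonzero complex numbers such that $$a^2q^{N+1}=bcde\,z_1^2\cdots z_n^2$$ and such that no theta factor in a denominator below vanishes. Then $$\sum_{\substack{x_1,\dots,x_n\ge 0\\ x_1+\dots+x_n\le N}}\frac{\Delta(zq^x)}{\Delta(z)}\,\frac{\theta(aq^{2|x|})}{\theta(a)}\,\frac{\prod_{1\le i<j\le n}(z_iz_j)_{x_i+x_j}}{\prod_{i=1}^n(e/z_i)_{|x|-x_i}}\,\frac{(a,q^{-N})_{|x|}\prod_{i=1}^n(e/z_i)_{|x|}}{(aq^{N+1})_{|x|}}\,q^{|x|}$$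 $$\times\prod_{i=1}^n\frac{(bz_i,cz_i,dz_i,q^{-N}ez_i/a)_{x_i}}{(aqz_i/e)_{x_i}\prod_{j=1}^n(qz_i/z_j)_{x_i}}\cdot\begin{cases}\dfrac1{(q^{-N}eZ/a,\,aq/bZ,\,aq/cZ,\,aq/dZ)_{|x|}},& n\text{ odd},\\[3mm]\dfrac1{(aq/Z,\,aq/bcZ,\,aq/bdZ,\,aq/cdZ)_{|x|}},& n\text{ even}\end{cases}$$ $$=\frac{(aq,aq/be,aq/ce,aq/de)_N\prod_{i=1}^n(aq/ez_i)_N}{Z^N\prod_{i=1}^n(aqz_i/e)_N}\cdot\begin{cases}\dfrac{e^N}{(aq/bZ,\,aq/cZ,\,aq/dZ,\,aq/eZ)_N},& n\text{ odd},\\[3mm]\dfrac1{(aq/Z,\,aq/beZ,\,aq/ceZ,\,aq/deZ)_N},& n\text{ even}.\end{cases}$$ Here $aq/bZ$ means $aq/(bZ)$, and similarly for the other quotients. -/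

import Mathlib

open Finset

/-- The theta function `θ(z) = ∏_{j ≥ 0} (1 - p^j z) (1 - p^{j+1} / z)` of nome `p`. -/
noncomputable def ellTheta (p z : ℂ) : ℂ :=
  ∏' j : ℕ, (1 - p ^ j * z) * (1 - p ^ (j + 1) / z)

/-- The infinite product defining `ellTheta` converges (unconditionally) for `|p| < 1`. -/
theorem hasProd_ellTheta {p : ℂ} (hp : ‖p‖ < 1) (z : ℂ) :
    HasProd (fun j : ℕ => (1 - p ^ j * z) * (1 - p ^ (j + 1) / z)) (ellTheta p z) := by
  have hg : Summable fun j : ℕ => ‖p‖ ^ j := summable_geometric_of_lt_one (norm_nonneg p) hp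
  have h1 : Multipliable fun j : ℕ => 1 - p ^ j * z := by
    simp only [sub_eq_add_neg]
    refine multipliable_one_add_of_summable ?_
    simpa only [norm_neg, norm_mul, norm_pow] using hg.mul_right ‖z‖
  have h2 : Multipliable fun j : ℕ => 1 - p ^ (j + 1) / z := by
    simp only [sub_eq_add_neg]
    refine multipliable_one_add_of_summable ?_
    simpa only [norm_neg, norm_div, norm_pow] using
      ((summable_nat_add_iff 1).2 hg).div_const ‖z‖
  exact (h1.mul h2).hasProd

/-- The elliptic shifted factorial `(z)_k = θ(z) θ(qz) ⋯ θ(q^{k-1} z)` for `k ≥ 0`. -/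
noncomputable def ellPoch (p q z : ℂ) (k : ℕ) : ℂ :=
  ∏ j ∈ range k, ellTheta p (q ^ j * z)

/-- The quotient
`Δ(z q^x) / Δ(z) = ∏_{i < j} q^{x_i} θ(q^{x_j - x_i} z_j / z_i) / θ(z_j / z_i)`. -/
noncomputable def ellDelta (p q : ℂ) {n : ℕ} (z : Fin n → ℂ) (x : Fin n → ℕ) : ℂ :=
  ∏ i, ∏ j ∈ Ioi i,
    q ^ x i * ellTheta p (q ^ ((x j : ℤ) - (x i : ℤ)) * (z j / z i)) / ellTheta p (z j / z i)

/-- The set of multi-indices `x = (x_1, …, x_n)` of natural numbers with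
`x_1 + ⋯ + x_n ≤ N`. -/
def indexSimplex (n N : ℕ) : Finset (Fin n → ℕ) :=
  (Fintype.piFinset fun _ : Fin n => range (N + 1)).filter fun x => ∑ i, x i ≤ N

theorem mem_indexSimplex {n N : ℕ} {x : Fin n → ℕ} :
    x ∈ indexSimplex n N ↔ ∑ i, x i ≤ N := by
  simp only [indexSimplex, mem_filter, Fintype.mem_piFinset, mem_range, and_iff_right_iff_imp]
  intro h i
  exact Nat.lt_succ_of_le ((single_le_sum (fun j _ => Nat.zero_le (x j)) (mem_univ i)).trans h)

/-- The factor of the summand depending on the parity of `n`; here `Z = z_1 ⋯ z_n` and `k = |x|`.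
It is `1 / (q^{-N} e Z / a, aq / bZ, aq / cZ, aq / dZ)_k` for odd `n` and
`1 / (aq / Z, aq / bcZ, aq / bdZ, aq / cdZ)_k` for even `n`. -/
noncomputable def paritySummandFactor (p q a b c d e Z : ℂ) (n N k : ℕ) : ℂ :=
  if Odd n then
    1 / (ellPoch p q (q ^ (-(N : ℤ)) * e * Z / a) k * ellPoch p q (a * q / (b * Z)) k *
      ellPoch p q (a * q / (c * Z)) k * ellPoch p q (a * q / (d * Z)) k)
  else
    1 / (ellPoch p q (a * q / Z) k * ellPoch p q (a * q / (b * c * Z)) k *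
      ellPoch p q (a * q / (b * d * Z)) k * ellPoch p q (a * q / (c * d * Z)) k)

/-- The summand. Note that `|x| - x_i` is never truncated, as `x_i ≤ |x|`. -/
noncomputable def jacksonSummand (p q a b c d e : ℂ) {n : ℕ} (z : Fin n → ℂ) (N : ℕ)
    (x : Fin n → ℕ) : ℂ :=
  ellDelta p q z x *
  (ellTheta p (a * q ^ (2 * ∑ i, x i)) / ellTheta p a) *
  ((∏ i, ∏ j ∈ Ioi i, ellPoch p q (z i * z j) (x i + x j)) /
    ∏ i, ellPoch p q (e / z i) ((∑ j, x j) - x i)) *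
  ((ellPoch p q a (∑ i, x i) * ellPoch p q (q ^ (-(N : ℤ))) (∑ i, x i) *
      ∏ i, ellPoch p q (e / z i) (∑ j, x j)) /
    ellPoch p q (a * q ^ (N + 1)) (∑ i, x i)) *
  q ^ (∑ i, x i) *
  (∏ i, (ellPoch p q (b * z i) (x i) * ellPoch p q (c * z i) (x i) *
      ellPoch p q (d * z i) (x i) * ellPoch p q (q ^ (-(N : ℤ)) * e * z i / a) (x i)) /
    (ellPoch p q (a * q * z i / e) (x i) * ∏ j, ellPoch p q (q * z i / z j) (x i))) *
  paritySummandFactor p q a b c d e (∏ i, z i) n N (∑ i, x i)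

/-- The factor of the closed form depending on the parity of `n`; here `Z = z_1 ⋯ z_n`.
It is `e^N / (aq / bZ, aq / cZ, aq / dZ, aq / eZ)_N` for odd `n` and
`1 / (aq / Z, aq / beZ, aq / ceZ, aq / deZ)_N` for even `n`. -/
noncomputable def parityValueFactor (p q a b c d e Z : ℂ) (n N : ℕ) : ℂ :=
  if Odd n then
    e ^ N / (ellPoch p q (a * q / (b * Z)) N * ellPoch p q (a * q / (c * Z)) N *
      ellPoch p q (a * q / (d * Z)) N * ellPoch p q (a * q / (e * Z)) N)
  else
    1 / (ellPoch p q (a * q / Z) N * ellPoch p q (a * q / (b * e * Z)) N *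
      ellPoch p q (a * q / (c * e * Z)) N * ellPoch p q (a * q / (d * e * Z)) N)

/-- The closed form of the sum. -/
noncomputable def jacksonValue (p q a b c d e : ℂ) {n : ℕ} (z : Fin n → ℂ) (N : ℕ) : ℂ :=
  (ellPoch p q (a * q) N * ellPoch p q (a * q / (b * e)) N * ellPoch p q (a * q / (c * e)) N *
      ellPoch p q (a * q / (d * e)) N * ∏ i, ellPoch p q (a * q / (e * z i)) N) /
    ((∏ i, z i) ^ N * ∏ i, ellPoch p q (a * q * z i / e) N) *
  parityValueFactor p q a b c d e (∏ i, z i) n N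

/-- No theta factor in a denominator of the summands or of the closed form vanishes. -/
structure JacksonDenominatorsNeZero (p q a b c d e : ℂ) {n : ℕ} (z : Fin n → ℂ) (N : ℕ) :
    Prop where
  delta : ∀ i j : Fin n, i < j → ellTheta p (z j / z i) ≠ 0
  theta_a : ellTheta p a ≠ 0
  e_div : ∀ x ∈ indexSimplex n N, ∀ i, ellPoch p q (e / z i) ((∑ j, x j) - x i) ≠ 0
  aq_pow : ∀ k ≤ N, ellPoch p q (a * q ^ (N + 1)) k ≠ 0
  aq_div_e : ∀ i, ∀ k ≤ N, ellPoch p q (a * q * z i / e) k ≠ 0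
  q_div : ∀ i j, ∀ k ≤ N, ellPoch p q (q * z i / z j) k ≠ 0
  odd_summand : Odd n → ∀ k ≤ N,
    ellPoch p q (q ^ (-(N : ℤ)) * e * (∏ i, z i) / a) k ≠ 0 ∧
    ellPoch p q (a * q / (b * ∏ i, z i)) k ≠ 0 ∧
    ellPoch p q (a * q / (c * ∏ i, z i)) k ≠ 0 ∧
    ellPoch p q (a * q / (d * ∏ i, z i)) k ≠ 0
  even_summand : Even n → ∀ k ≤ N,
    ellPoch p q (a * q / ∏ i, z i) k ≠ 0 ∧
    ellPoch p q (a * q / (b * c * ∏ i, z i)) k ≠ 0 ∧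
    ellPoch p q (a * q / (b * d * ∏ i, z i)) k ≠ 0 ∧
    ellPoch p q (a * q / (c * d * ∏ i, z i)) k ≠ 0
  odd_value : Odd n → ellPoch p q (a * q / (e * ∏ i, z i)) N ≠ 0
  even_value : Even n →
    ellPoch p q (a * q / (b * e * ∏ i, z i)) N ≠ 0 ∧
    ellPoch p q (a * q / (c * e * ∏ i, z i)) N ≠ 0 ∧
    ellPoch p q (a * q / (d * e * ∏ i, z i)) N ≠ 0

/-! The proof is an induction on `N` in which `a q^N` and `e q^N` are held fixed, so that passing
from `N` to `N + 1` divides `a` and `e` by `q`. In these variables the balancing condition no longer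
contains `N`, and the closed form is a product over `j < N` of factors independent of `N`.

Write `θ(e^x)` as `e^{x/2} σ(x)` with `σ` odd. The only facts about `σ` that the induction needs are
oddness, the three-term addition formula and closure of the zeros under differences (`IsSigma`). The
addition formula says that `b ↦ σ(x + b) σ(x + P - b)` moves in a two-dimensional space, so
identities between such functions can be checked at two independent points. This gives two
identities by induction on the number of variables: the partial fraction identity of type `A`
(`sum_prod_div_eq_zero`), and an evaluation of a sum containing `σ(w_k + w_j) / σ(w_k - w_j)`
(`sum_prod_mul_div_eq`), whose value depends on the parity of the number of variables. The two cases
of the theorem come from there.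

Inductive step: the partial fraction identity with nodes `z_i q^{x_i}` and two extra nodes `U`, `V`,
divided by its `V` term, writes 1 as a sum of `n + 1` terms. Insert this into the sum for `N + 1`.
The `l`-th term vanishes when `x_l = 0`, so there `x` may be replaced by `x + e_l`; the `U` term
vanishes when `|x| = N + 1`. What results is a sum over `|x| ≤ N` of the old summand times a
bracket, and the second identity, applied to the `z_i q^{x_i}` together with `V`, shows that the
bracket does not depend on `x`: it is the quotient of consecutive closed forms (`sum_summand_eq`).

The exponential factors separating `θ` from `σ` cancel by the balancing condition. The induction
needs more nonvanishing than the theorem assumes; this is removed by continuity along `a ↦ a t`, `e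
↦ e t^2`, which preserves the balancing and is generic for all but countably many `t`. -/

/-! ### Analytic properties of the theta function: continuity, quasi-periodicity, zeros. -/

/-- The Taylor coefficients of `∏_{j ≥ 0} (1 - p^j z)`. -/
noncomputable def eulerCoeff (p : ℂ) : ℕ → ℂ
  | 0 => 1
  | n + 1 => -(p ^ n * eulerCoeff p n) / (1 - p ^ (n + 1))

/-- The entire function `∏_{j ≥ 0} (1 - p^j z)`, as a power series. -/
noncomputable def eulerSeries (p z : ℂ) : ℂ := ∑' n, eulerCoeff p n * z ^ n

theorem one_sub_pow_succ_ne_zero {p : ℂ} (hp : ‖p‖ < 1) (n : ℕ) : 1 - p ^ (n + 1) ≠ 0 := by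
  intro h
  have h1 : ‖p ^ (n + 1)‖ = 1 := by rw [← sub_eq_zero.1 h, norm_one]
  rw [norm_pow] at h1
  exact absurd h1 (pow_lt_one₀ (norm_nonneg p) hp n.succ_ne_zero).ne

theorem eulerCoeff_succ_mul {p : ℂ} (hp : ‖p‖ < 1) (n : ℕ) :
    eulerCoeff p (n + 1) * (1 - p ^ (n + 1)) = -(p ^ n * eulerCoeff p n) := by
  rw [eulerCoeff, div_mul_cancel₀ _ (one_sub_pow_succ_ne_zero hp n)]

theorem summable_norm_eulerCoeff {p : ℂ} (hp : ‖p‖ < 1) (z : ℂ) :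
    Summable fun n => ‖eulerCoeff p n * z ^ n‖ := by
  have hlim : Filter.Tendsto (fun n : ℕ => ‖p‖ ^ n * (‖z‖ / (1 - ‖p‖))) Filter.atTop
      (nhds (0 * (‖z‖ / (1 - ‖p‖)))) :=
    (tendsto_pow_atTop_nhds_zero_of_lt_one (norm_nonneg p) hp).mul_const _
  rw [zero_mul] at hlim
  have hpos : 0 < 1 - ‖p‖ := by linarith
  refine summable_of_ratio_norm_eventually_le (r := 1 / 2) (by norm_num) ?_
  filter_upwards [hlim.eventually_le_const (u := 1 / 2) (by norm_num)] with n hn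
  have h1 : 1 - ‖p‖ ≤ ‖1 - p ^ (n + 1)‖ := by
    have h2 := norm_sub_norm_le (1 : ℂ) (p ^ (n + 1))
    rw [norm_one, norm_pow] at h2
    have h3 : ‖p‖ ^ (n + 1) ≤ ‖p‖ := by
      rw [pow_succ]
      exact mul_le_of_le_one_left (norm_nonneg p) (pow_le_one₀ (norm_nonneg p) hp.le)
    linarith
  have h2 : ‖eulerCoeff p (n + 1) * z ^ (n + 1)‖ =
      ‖p‖ ^ n * (‖z‖ / ‖1 - p ^ (n + 1)‖) * ‖eulerCoeff p n * z ^ n‖ := by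
    rw [eulerCoeff, norm_mul, norm_div, norm_neg, norm_mul, norm_mul, norm_pow, norm_pow, norm_pow,
      pow_succ]
    ring
  rw [norm_norm, norm_norm, h2]
  refine mul_le_mul_of_nonneg_right (le_trans ?_ hn) (norm_nonneg _)
  gcongr

theorem hasSum_eulerSeries {p : ℂ} (hp : ‖p‖ < 1) (z : ℂ) :
    HasSum (fun n => eulerCoeff p n * z ^ n) (eulerSeries p z) :=
  (summable_norm_eulerCoeff hp z).of_norm.hasSum

theorem continuous_eulerSeries {p : ℂ} (hp : ‖p‖ < 1) : Continuous (eulerSeries p) := by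
  rw [continuous_iff_continuousAt]
  intro z
  have h : ContinuousOn (eulerSeries p) (Metric.closedBall 0 (‖z‖ + 1)) := by
    refine continuousOn_tsum (u := fun n => ‖eulerCoeff p n * ((‖z‖ + 1 : ℝ) : ℂ) ^ n‖)
      (fun n => by fun_prop) (summable_norm_eulerCoeff hp _) ?_
    intro n x hx
    rw [mem_closedBall_zero_iff] at hx
    rw [norm_mul, norm_mul, norm_pow, norm_pow, Complex.norm_real, Real.norm_eq_abs,
      abs_of_nonneg (by positivity)]
    gcongr
  exact h.continuousAt (Metric.closedBall_mem_nhds_of_mem (by simp))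

theorem eulerSeries_zero {p : ℂ} : eulerSeries p 0 = 1 := by
  rw [eulerSeries, tsum_eq_single 0]
  · simp [eulerCoeff]
  · intro n hn
    simp [hn]

/-- The recurrence defining the coefficients is this functional equation read off coefficientwise.
Iterating it and letting `p^n z → 0` identifies the series with the infinite product. -/
theorem eulerSeries_eq {p : ℂ} (hp : ‖p‖ < 1) (z : ℂ) :
    eulerSeries p z = (1 - z) * eulerSeries p (p * z) := by
  have h1 := (hasSum_eulerSeries hp z).sub (hasSum_eulerSeries hp (p * z))
  rw [← hasSum_nat_add_iff' 1] at h1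
  have h2 := (hasSum_eulerSeries hp (p * z)).mul_left (-z)
  have h3 : (fun n => eulerCoeff p (n + 1) * z ^ (n + 1) -
      eulerCoeff p (n + 1) * (p * z) ^ (n + 1)) =
      fun n => -z * (eulerCoeff p n * (p * z) ^ n) := by
    funext n
    linear_combination z ^ (n + 1) * eulerCoeff_succ_mul hp n
  rw [h3] at h1
  have h4 := h1.unique h2
  simp only [range_one, sum_singleton, pow_zero, sub_self, sub_zero] at h4
  linear_combination h4

theorem eulerSeries_eq_prod {p : ℂ} (hp : ‖p‖ < 1) (z : ℂ) (n : ℕ) :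
    eulerSeries p z = (∏ j ∈ range n, (1 - p ^ j * z)) * eulerSeries p (p ^ n * z) := by
  induction n with
  | zero => simp
  | succ n ih =>
    rw [ih, eulerSeries_eq hp (p ^ n * z), prod_range_succ, pow_succ']
    ring_nf

theorem tendsto_prod_eulerSeries {p : ℂ} (hp : ‖p‖ < 1) (z : ℂ) :
    Filter.Tendsto (fun n => ∏ j ∈ range n, (1 - p ^ j * z)) Filter.atTop
      (nhds (eulerSeries p z)) := by
  have h0 : Filter.Tendsto (fun n : ℕ => p ^ n * z) Filter.atTop (nhds 0) := by
    simpa using (tendsto_pow_atTop_nhds_zero_of_norm_lt_one hp).mul_const z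
  have h1 : Filter.Tendsto (fun n : ℕ => eulerSeries p (p ^ n * z)) Filter.atTop (nhds 1) := by
    have := ((continuous_eulerSeries hp).tendsto 0).comp h0
    rwa [eulerSeries_zero] at this
  have h2 : Filter.Tendsto (fun n : ℕ => eulerSeries p z / eulerSeries p (p ^ n * z))
      Filter.atTop (nhds (eulerSeries p z)) := by
    have h := (tendsto_const_nhds (x := eulerSeries p z)).div h1 one_ne_zero
    rw [div_one] at h
    exact h
  refine h2.congr' ?_
  filter_upwards [h1.eventually_ne one_ne_zero] with n hn
  rw [eulerSeries_eq_prod hp z n, mul_div_cancel_right₀ _ hn]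

theorem ellTheta_eq_eulerSeries {p : ℂ} (hp : ‖p‖ < 1) (z : ℂ) :
    ellTheta p z = eulerSeries p z * eulerSeries p (p / z) := by
  refine tendsto_nhds_unique (hasProd_ellTheta hp z).tendsto_prod_nat ?_
  refine ((tendsto_prod_eulerSeries hp z).mul (tendsto_prod_eulerSeries hp (p / z))).congr ?_
  intro n
  rw [← prod_mul_distrib]
  refine prod_congr rfl fun j _ => ?_
  rw [pow_succ, mul_div_assoc]

theorem continuousAt_ellTheta {p : ℂ} (hp : ‖p‖ < 1) {z : ℂ} (hz : z ≠ 0) :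
    ContinuousAt (ellTheta p) z := by
  have h : ellTheta p = fun z => eulerSeries p z * eulerSeries p (p / z) :=
    funext (ellTheta_eq_eulerSeries hp)
  rw [h]
  refine (continuous_eulerSeries hp).continuousAt.mul ?_
  exact (continuous_eulerSeries hp).continuousAt.comp (continuousAt_const.div continuousAt_id hz)

theorem ellTheta_mul_left {p : ℂ} (hp : ‖p‖ < 1) (hp0 : p ≠ 0) {z : ℂ} (hz : z ≠ 0) :
    ellTheta p (p * z) * z = -ellTheta p z := by
  rw [ellTheta_eq_eulerSeries hp, ellTheta_eq_eulerSeries hp, eulerSeries_eq hp z,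
    show p / (p * z) = 1 / z by field_simp, eulerSeries_eq hp (1 / z), mul_one_div]
  field_simp
  ring

theorem ellTheta_inv {p : ℂ} (hp : ‖p‖ < 1) {z : ℂ} (hz : z ≠ 0) :
    ellTheta p z⁻¹ * z = -ellTheta p z := by
  rw [ellTheta_eq_eulerSeries hp, ellTheta_eq_eulerSeries hp, eulerSeries_eq hp z,
    eulerSeries_eq hp z⁻¹, div_inv_eq_mul, ← div_eq_mul_inv]
  field_simp
  ring

/-- An absolutely convergent product without a vanishing factor is nonzero, so a zero of `θ` comes
from one factor. Conversely the inversion formula at `z = 1` forces `θ(1) = 0`, and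
quasi-periodicity carries this zero to all powers of `p`. For `p = 0` only the exponent `0` gives a
nonzero `z`. -/
theorem ellTheta_eq_zero_iff {p : ℂ} (hp : ‖p‖ < 1) {z : ℂ} (hz : z ≠ 0) :
    ellTheta p z = 0 ↔ ∃ m : ℤ, z = p ^ m := by
  have hne : ∀ w : ℂ, (∀ j : ℕ, p ^ j * w ≠ 1) → eulerSeries p w ≠ 0 := by
    intro w hw
    have hs : Summable fun j : ℕ => ‖-(p ^ j * w)‖ := by
      simpa only [norm_neg, norm_mul, norm_pow] using
        (summable_geometric_of_lt_one (norm_nonneg p) hp).mul_right ‖w‖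
    have h1 := (multipliable_one_add_of_summable hs).hasProd.tendsto_prod_nat
    have h2 : eulerSeries p w = ∏' j : ℕ, (1 + -(p ^ j * w)) := by
      refine tendsto_nhds_unique (tendsto_prod_eulerSeries hp w) ?_
      simpa only [sub_eq_add_neg] using h1
    rw [h2]
    refine tprod_one_add_ne_zero_of_summable (fun j h => hw j ?_) hs
    linear_combination -h
  constructor
  · intro h
    rw [ellTheta_eq_eulerSeries hp, mul_eq_zero] at h
    rcases h with h | h
    · by_contra hcon
      refine hne z (fun j hj => hcon ⟨-j, ?_⟩) h
      rw [zpow_neg, zpow_natCast]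
      exact eq_inv_of_mul_eq_one_right hj
    · by_contra hcon
      refine hne (p / z) (fun j hj => hcon ⟨(j + 1 : ℕ), ?_⟩) h
      rw [zpow_natCast, pow_succ, ← div_eq_one_iff_eq hz |>.1 ((mul_div_assoc _ _ _).trans hj)]
  · rintro ⟨m, rfl⟩
    have h1 : ellTheta p 1 = 0 := by
      have := ellTheta_inv hp (one_ne_zero (α := ℂ))
      rw [inv_one, mul_one] at this
      exact self_eq_neg.1 this
    rcases eq_or_ne p 0 with rfl | hp0
    · rcases eq_or_ne m 0 with rfl | hm
      · simpa using h1
      · exact absurd (zero_zpow m hm) hz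
    · induction m with
      | zero => simpa using h1
      | succ k ih =>
        have hk := ih (zpow_ne_zero _ hp0)
        have := ellTheta_mul_left hp hp0 (zpow_ne_zero (k : ℤ) hp0)
        rw [hk, neg_zero, mul_eq_zero, or_iff_left (zpow_ne_zero _ hp0)] at this
        rwa [zpow_add_one₀ hp0, mul_comm]
      | pred k ih =>
        have hk := ih (zpow_ne_zero _ hp0)
        have := ellTheta_mul_left hp hp0 (zpow_ne_zero (-(k : ℤ) - 1) hp0)
        rw [← zpow_one_add₀ hp0, add_sub_cancel, hk, zero_mul] at this
        exact neg_eq_zero.1 this.symm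

theorem countable_ellTheta_zeros {p : ℂ} (hp : ‖p‖ < 1) :
    {z : ℂ | z ≠ 0 ∧ ellTheta p z = 0}.Countable := by
  refine (Set.countable_range fun m : ℤ => p ^ m).mono ?_
  rintro z ⟨hz, h⟩
  obtain ⟨m, rfl⟩ := (ellTheta_eq_zero_iff hp hz).1 h
  exact ⟨m, rfl⟩

/-- The nonzero zeros form a multiplicative group; this becomes `IsSigma.sub_eq_zero`. -/
theorem ellTheta_div_eq_zero {p : ℂ} (hp : ‖p‖ < 1) {x y : ℂ} (hx : x ≠ 0) (hy : y ≠ 0)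
    (h1 : ellTheta p x = 0) (h2 : ellTheta p y = 0) : ellTheta p (x / y) = 0 := by
  obtain ⟨m, rfl⟩ := (ellTheta_eq_zero_iff hp hx).1 h1
  obtain ⟨l, rfl⟩ := (ellTheta_eq_zero_iff hp hy).1 h2
  refine (ellTheta_eq_zero_iff hp (div_ne_zero hx hy)).2 ?_
  rcases eq_or_ne p 0 with rfl | hp0
  · rcases eq_or_ne m 0 with rfl | hm
    · rcases eq_or_ne l 0 with rfl | hl
      · exact ⟨0, by simp⟩
      · exact absurd (zero_zpow l hl) hy
    · exact absurd (zero_zpow m hm) hx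
  · exact ⟨m - l, (zpow_sub₀ hp0 m l).symm⟩

/-! ### Laurent expansion of theta, and the rank two structure of `θ(xy) θ(x/y)`. -/

/-- The Taylor coefficients of `∏_{j ≥ 0} (1 - p^j z)`, extended by zero to negative indices. -/
noncomputable def eulerCoeffInt (p : ℂ) (n : ℤ) : ℂ := if 0 ≤ n then eulerCoeff p n.toNat else 0

/-- Extension by zero is compatible with the recurrence at `n = -1` because `1 - p^0 = 0`. Hence
bilateral sums can be shifted without boundary terms. -/
theorem eulerCoeffInt_succ_mul {p : ℂ} (hp : ‖p‖ < 1) (n : ℤ) :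
    eulerCoeffInt p (n + 1) * (1 - p ^ (n + 1)) = -(p ^ n * eulerCoeffInt p n) := by
  rcases lt_trichotomy n (-1) with h | rfl | h
  · simp [eulerCoeffInt, show ¬ 0 ≤ n + 1 by omega, show ¬ 0 ≤ n by omega]
  · simp [eulerCoeffInt]
  · obtain ⟨k, rfl⟩ := Int.eq_ofNat_of_zero_le (show 0 ≤ n by omega)
    have := eulerCoeff_succ_mul hp k
    simpa [eulerCoeffInt, show (0 : ℤ) ≤ k + 1 by omega, show ((k : ℤ) + 1).toNat = k + 1 by omega,
      ← zpow_natCast] using this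

theorem hasSum_eulerCoeffInt {p : ℂ} (hp : ‖p‖ < 1) (z : ℂ) :
    HasSum (fun n : ℤ => eulerCoeffInt p n * z ^ n) (eulerSeries p z) := by
  rw [← (Nat.cast_injective (R := ℤ)).hasSum_iff]
  · simpa [Function.comp_def, eulerCoeffInt] using hasSum_eulerSeries hp z
  · intro n hn
    have : ¬ 0 ≤ n := fun h => hn ⟨n.toNat, by simp [h]⟩
    simp [eulerCoeffInt, this]

/-- The shear `(m, k) ↦ (m + k, k)` of `ℤ × ℤ`. -/
def intShear : ℤ × ℤ ≃ ℤ × ℤ where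
  toFun x := (x.1 + x.2, x.2)
  invFun x := (x.1 - x.2, x.2)
  left_inv x := by simp
  right_inv x := by simp

theorem HasSum.mul_prod_int {f g : ℤ → ℂ} {a b : ℂ} (hf : HasSum f a) (hg : HasSum g b) :
    HasSum (fun i : ℤ × ℤ => f i.1 * g i.2) (a * b) := by
  have hs : Summable fun i : ℤ × ℤ => f i.1 * g i.2 :=
    summable_mul_of_summable_norm hf.summable.norm hg.summable.norm
  exact hf.mul hg hs

theorem hasSum_eulerCoeffInt_shear {p : ℂ} (hp : ‖p‖ < 1) (x y : ℂ) :
    HasSum (fun i : ℤ × ℤ => eulerCoeffInt p (i.1 + i.2) * x ^ (i.1 + i.2) *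
      (eulerCoeffInt p i.2 * y ^ i.2)) (eulerSeries p x * eulerSeries p y) := by
  have h : HasSum (fun i : ℤ × ℤ => eulerCoeffInt p i.1 * x ^ i.1 *
      (eulerCoeffInt p i.2 * y ^ i.2)) (eulerSeries p x * eulerSeries p y) := by
    have h := (hasSum_eulerCoeffInt hp x).mul_prod_int (hasSum_eulerCoeffInt hp y)
    exact h
  exact (Equiv.hasSum_iff (f := fun i : ℤ × ℤ => eulerCoeffInt p i.1 * x ^ i.1 *
    (eulerCoeffInt p i.2 * y ^ i.2)) intShear).2 h

/-- The Laurent coefficients of the theta function. -/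
noncomputable def thetaCoeff (p : ℂ) (m : ℤ) : ℂ :=
  ∑' k : ℤ, eulerCoeffInt p (m + k) * eulerCoeffInt p k * p ^ k

theorem summable_eulerCoeffInt_mul {p : ℂ} (hp : ‖p‖ < 1) (y : ℂ) (m : ℤ) :
    Summable fun k : ℤ => eulerCoeffInt p (m + k) * eulerCoeffInt p k * y ^ k := by
  refine ((hasSum_eulerCoeffInt_shear hp 1 y).summable.prod_factor m).congr fun k => ?_
  rw [one_zpow]
  ring

theorem hasSum_thetaCoeff {p : ℂ} (hp : ‖p‖ < 1) (hp0 : p ≠ 0) {z : ℂ} (hz : z ≠ 0) :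
    HasSum (fun m : ℤ => thetaCoeff p m * z ^ m) (ellTheta p z) := by
  rw [ellTheta_eq_eulerSeries hp]
  refine (hasSum_eulerCoeffInt_shear hp z (p / z)).prod_fiberwise fun m => ?_
  refine ((summable_eulerCoeffInt_mul hp p m).hasSum.mul_right (z ^ m)).congr_fun ?_
  intro k
  rw [zpow_add₀ hz, div_zpow]
  have := zpow_ne_zero k hz
  field_simp

/-- This is quasi-periodicity on the level of coefficients. Two uses of the Euler recurrence turn
each term for `m + 1` into a shifted term for `m` plus a difference of consecutive terms of the
analogous series with weight `p^{2k}`; that difference sums to zero. -/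
theorem thetaCoeff_succ {p : ℂ} (hp : ‖p‖ < 1) (hp0 : p ≠ 0) (m : ℤ) :
    thetaCoeff p (m + 1) = -(p ^ m * thetaCoeff p m) := by
  have ht := summable_eulerCoeffInt_mul hp p m
  have hu := summable_eulerCoeffInt_mul hp (p * p) m
  have ht' := (Equiv.addRight (1 : ℤ)).hasSum_iff.2 ht.hasSum
  have hu' := (Equiv.addRight (1 : ℤ)).hasSum_iff.2 hu.hasSum
  have h := ((ht'.mul_left (-p ^ m)).add (hu'.mul_left (p ^ m))).sub (hu.hasSum.mul_left (p ^ m))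
  have h2 := (summable_eulerCoeffInt_mul hp p (m + 1)).hasSum
  have h3 := h2.unique (h.congr_fun ?_)
  · rw [thetaCoeff, h3, thetaCoeff]
    ring
  · intro k
    have e1 := eulerCoeffInt_succ_mul hp (m + k)
    have e2 := eulerCoeffInt_succ_mul hp k
    simp only [Function.comp_apply, Equiv.coe_addRight]
    rw [show m + 1 + k = m + k + 1 by ring, show m + (k + 1) = m + k + 1 by ring, mul_zpow,
      mul_zpow, zpow_add_one₀ hp0]
    rw [zpow_add_one₀ hp0, zpow_add₀ hp0] at e1
    rw [zpow_add_one₀ hp0] at e2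
    linear_combination (eulerCoeffInt p k * p ^ k) * e1 + p ^ m * p ^ k * p *
      eulerCoeffInt p (m + k + 1) * e2

/-- The coefficient of `y ^ t` in `θ(xy) θ(x/y)`. -/
noncomputable def thetaMulCoeff (p : ℂ) (t : ℤ) (x : ℂ) : ℂ :=
  ∑' m : ℤ, thetaCoeff p m * thetaCoeff p (m - t) * x ^ (2 * m - t)

/-- The reflected shear `(t, m) ↦ (m, m - t)` of `ℤ × ℤ`. -/
def intShearSub : ℤ × ℤ ≃ ℤ × ℤ where
  toFun x := (x.2, x.2 - x.1)
  invFun x := (x.1 - x.2, x.1)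
  left_inv x := by simp
  right_inv x := by simp

theorem hasSum_thetaMulCoeff {p : ℂ} (hp : ‖p‖ < 1) (hp0 : p ≠ 0) {x y : ℂ} (hx : x ≠ 0)
    (hy : y ≠ 0) :
    HasSum (fun t : ℤ => thetaMulCoeff p t x * y ^ t) (ellTheta p (x * y) * ellTheta p (x / y)) := by
  have key : ∀ {y : ℂ}, y ≠ 0 → HasSum (fun i : ℤ × ℤ => thetaCoeff p i.2 *
      thetaCoeff p (i.2 - i.1) * x ^ (2 * i.2 - i.1) * y ^ i.1)
      (ellTheta p (x * y) * ellTheta p (x / y)) := by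
    intro y hy
    have h1 := hasSum_thetaCoeff hp hp0 (mul_ne_zero hx hy)
    have h2 := hasSum_thetaCoeff hp hp0 (div_ne_zero hx hy)
    have h3 : HasSum (fun i : ℤ × ℤ => thetaCoeff p i.1 * (x * y) ^ i.1 *
        (thetaCoeff p i.2 * (x / y) ^ i.2)) (ellTheta p (x * y) * ellTheta p (x / y)) := by
      have h := h1.mul_prod_int h2
      exact h
    refine ((Equiv.hasSum_iff (f := fun i : ℤ × ℤ => thetaCoeff p i.1 * (x * y) ^ i.1 *
        (thetaCoeff p i.2 * (x / y) ^ i.2)) intShearSub).2 h3).congr_fun fun i => ?_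
    simp only [Function.comp_apply, intShearSub, Equiv.coe_fn_mk]
    rw [mul_zpow, div_zpow, zpow_sub₀ hy, show 2 * i.2 - i.1 = i.2 + (i.2 - i.1) by ring,
      zpow_add₀ hx]
    have := zpow_ne_zero i.2 hy
    have := zpow_ne_zero i.1 hy
    field_simp
  refine (key hy).prod_fiberwise fun t => ?_
  have hs : Summable fun m : ℤ => thetaCoeff p m * thetaCoeff p (m - t) * x ^ (2 * m - t) := by
    refine ((key one_ne_zero).summable.prod_factor t).congr fun m => ?_
    simp
  exact hs.hasSum.mul_right (y ^ t)

/-- Shifting the summation index by one keeps the power of `x` and changes both theta coefficients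
by their one-step recurrence. So as functions of `x` all coefficients of even index are
proportional, and likewise all of odd index. -/
theorem thetaMulCoeff_add_two {p : ℂ} (hp : ‖p‖ < 1) (hp0 : p ≠ 0) (t : ℤ) (x : ℂ) :
    thetaMulCoeff p (t + 2) x = p ^ (t + 1) * thetaMulCoeff p t x := by
  rw [thetaMulCoeff, thetaMulCoeff, ← (Equiv.addRight (1 : ℤ)).tsum_eq, ← tsum_mul_left]
  refine tsum_congr fun m => ?_
  have e1 := thetaCoeff_succ hp hp0 m
  have e2 := thetaCoeff_succ hp hp0 (m - t - 1)
  rw [sub_add_cancel] at e2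
  simp only [Equiv.coe_addRight]
  rw [show m + 1 - (t + 2) = m - t - 1 by ring, show 2 * (m + 1) - (t + 2) = 2 * m - t by ring,
    e1, e2]
  rw [show m = (m - t - 1) + (t + 1) by ring, zpow_add₀ hp0]
  ring_nf

theorem thetaMulCoeff_even {p : ℂ} (hp : ‖p‖ < 1) (hp0 : p ≠ 0) (r j : ℤ) (x : ℂ) :
    thetaMulCoeff p (2 * j + r) x = p ^ (j ^ 2 + r * j) * thetaMulCoeff p r x := by
  induction j with
  | zero => simp
  | succ k ih =>
    rw [show 2 * ((k : ℤ) + 1) + r = (2 * k + r) + 2 by ring, thetaMulCoeff_add_two hp hp0, ih,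
      ← mul_assoc, ← zpow_add₀ hp0]
    ring_nf
  | pred k ih =>
    have h := thetaMulCoeff_add_two hp hp0 (2 * (-(k : ℤ) - 1) + r) x
    rw [show 2 * (-(k : ℤ) - 1) + r + 2 = 2 * -(k : ℤ) + r by ring, ih] at h
    have h2 := zpow_ne_zero (2 * (-(k : ℤ) - 1) + r + 1) hp0
    refine mul_left_cancel₀ h2 ?_
    rw [← h, ← mul_assoc, ← zpow_add₀ hp0]
    ring_nf

theorem tsum_int_even_add_odd {f : ℤ → ℂ} (hf : Summable f) :
    ∑' t, f t = ∑' j : ℤ, f (2 * j) + ∑' j : ℤ, f (2 * j + 1) := by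
  have h1 : Function.Injective fun j : ℤ => 2 * j := fun a b h => by simpa using h
  have h2 : Function.Injective fun j : ℤ => 2 * j + 1 := fun a b h => by simpa using h
  have e1 : ∑' j : ℤ, f (2 * j) = ∑' t, Set.indicator {t : ℤ | Even t} f t := by
    rw [← h1.tsum_eq (f := Set.indicator {t : ℤ | Even t} f)]
    · refine tsum_congr fun j => ?_
      rw [Set.indicator_of_mem (show 2 * j ∈ {t : ℤ | Even t} from even_two_mul j)]
    · intro t ht
      obtain ⟨j, hj⟩ := (show t ∈ {t : ℤ | Even t} from Set.mem_of_indicator_ne_zero ht)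
      exact ⟨j, by simp only; omega⟩
  have e2 : ∑' j : ℤ, f (2 * j + 1) = ∑' t, Set.indicator {t : ℤ | Even t}ᶜ f t := by
    rw [← h2.tsum_eq (f := Set.indicator {t : ℤ | Even t}ᶜ f)]
    · refine tsum_congr fun j => ?_
      rw [Set.indicator_of_mem (show 2 * j + 1 ∈ {t : ℤ | Even t}ᶜ from
        Int.not_even_iff_odd.2 (odd_two_mul_add_one j))]
    · intro t ht
      obtain ⟨j, hj⟩ := Int.not_even_iff_odd.1
        (show t ∈ {t : ℤ | Even t}ᶜ from Set.mem_of_indicator_ne_zero ht)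
      exact ⟨j, by simp only; omega⟩
  rw [e1, e2, ← (hf.indicator _).tsum_add (hf.indicator _)]
  exact tsum_congr fun t => (congrFun (Set.indicator_self_add_compl _ f) t).symm

/-- Separating even and odd powers of `y` leaves one function of `x` for each parity, which is why
two products suffice. The recursion uses negative powers of `p`, so `p = 0`, where `θ(z) = 1 - z`,
is treated directly. -/
theorem exists_ellTheta_mul_eq {p : ℂ} (hp : ‖p‖ < 1) :
    ∃ f g f' g' : ℂ → ℂ, ∀ x y : ℂ, x ≠ 0 → y ≠ 0 →
      ellTheta p (x * y) * ellTheta p (x / y) = f x * g y + f' x * g' y := by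
  rcases eq_or_ne p 0 with rfl | hp0
  · have h0 : ∀ z : ℂ, ellTheta 0 z = 1 - z := by
      intro z
      rw [ellTheta, tprod_eq_mulSingle 0]
      · simp
      · intro j hj
        simp [hj]
    refine ⟨fun x => 1 + x ^ 2, fun _ => 1, fun x => -x, fun y => y + y⁻¹, fun x y hx hy => ?_⟩
    rw [h0, h0]
    field_simp
    ring
  · refine ⟨thetaMulCoeff p 0, fun y => ∑' j : ℤ, p ^ (j ^ 2 + 0 * j) * y ^ (2 * j),
      thetaMulCoeff p 1, fun y => ∑' j : ℤ, p ^ (j ^ 2 + 1 * j) * y ^ (2 * j + 1),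
      fun x y hx hy => ?_⟩
    have h := hasSum_thetaMulCoeff hp hp0 hx hy
    rw [← h.tsum_eq, tsum_int_even_add_odd h.summable, ← tsum_mul_left, ← tsum_mul_left]
    congr 1
    · refine tsum_congr fun j => ?_
      have := thetaMulCoeff_even hp hp0 0 j x
      rw [add_zero] at this
      rw [this]
      ring
    · refine tsum_congr fun j => ?_
      rw [thetaMulCoeff_even hp hp0 1 j x]
      ring

/-! ### The odd sigma function attached to theta and its addition formula. -/

/-- The algebraic properties of a Weierstrass-type sigma function used below: it is odd, satisfies
the three-term addition formula, and its zeros are closed under differences. -/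
structure IsSigma (σ : ℂ → ℂ) : Prop where
  odd : ∀ x, σ (-x) = -σ x
  add_formula : ∀ x y u v, σ (x + y) * σ (x - y) * (σ (u + v) * σ (u - v)) =
    σ (x + u) * σ (x - u) * (σ (y + v) * σ (y - v)) -
      σ (x + v) * σ (x - v) * (σ (y + u) * σ (y - u))
  sub_eq_zero : ∀ x y, σ x = 0 → σ y = 0 → σ (x - y) = 0

/-- The theta function in additive notation, normalized to be odd. -/
noncomputable def thetaSigma (p x : ℂ) : ℂ := Complex.exp (-x / 2) * ellTheta p (Complex.exp x)

theorem ellTheta_exp (p x : ℂ) :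
    ellTheta p (Complex.exp x) = Complex.exp (x / 2) * thetaSigma p x := by
  rw [thetaSigma, ← mul_assoc, ← Complex.exp_add]
  simp [neg_div]

theorem thetaSigma_eq_zero_iff (p x : ℂ) :
    thetaSigma p x = 0 ↔ ellTheta p (Complex.exp x) = 0 := by
  simp [thetaSigma, Complex.exp_ne_zero]

/-- The 4 by 4 matrix of values of `F` has rank at most two, so its determinant vanishes. It is also
antisymmetric, so the determinant is the square of its Pfaffian, which is the expression on the
left. -/
theorem plucker_of_rank_two {F : ℂ → ℂ → ℂ} (hF : ∀ x y, F x y = -F y x) {f g f' g' : ℂ → ℂ}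
    (h : ∀ x y, F x y = f x * g y + f' x * g' y) (x y u v : ℂ) :
    F x y * F u v - F x u * F y v + F x v * F y u = 0 := by
  have h0 : ∀ x, F x x = 0 := fun x => self_eq_neg.1 (hF x x)
  have hdet : (!![F x x, F x y, F x u, F x v; F y x, F y y, F y u, F y v;
      F u x, F u y, F u u, F u v; F v x, F v y, F v u, F v v] : Matrix (Fin 4) (Fin 4) ℂ).det
      = 0 := by
    simp only [h, Matrix.det_succ_row_zero, Fin.sum_univ_succ]
    simp [Fin.succAbove]
    ring
  rw [h0, h0, h0, h0, hF y x, hF u x, hF v x, hF u y, hF v y, hF v u] at hdet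
  have : (F x y * F u v - F x u * F y v + F x v * F y u) ^ 2 = 0 := by
    rw [← hdet]
    simp [Matrix.det_succ_row_zero, Fin.sum_univ_succ, Fin.succAbove]
    ring
  exact pow_eq_zero_iff two_ne_zero |>.1 this

theorem isSigma_thetaSigma {p : ℂ} (hp : ‖p‖ < 1) : IsSigma (thetaSigma p) := by
  have hodd : ∀ x, thetaSigma p (-x) = -thetaSigma p x := by
    intro x
    have h := ellTheta_inv hp (Complex.exp_ne_zero x)
    rw [thetaSigma, thetaSigma, Complex.exp_neg x, neg_neg, ← mul_neg, ← h,
      show Complex.exp (x / 2) = Complex.exp (-x / 2) * Complex.exp x by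
        rw [← Complex.exp_add]; ring_nf]
    ring
  refine ⟨hodd, ?_, ?_⟩
  · obtain ⟨f, g, f', g', hfg⟩ := exists_ellTheta_mul_eq hp
    intro x y u v
    have key := plucker_of_rank_two (F := fun x y => thetaSigma p (x + y) * thetaSigma p (x - y))
      -- The normalizing factors at `x + y` and `x - y` multiply to `exp (-x)`, free of `y`, so they
      -- are absorbed into the functions of `x` and the rank stays two.
      (f := fun x => Complex.exp (-x) * f (Complex.exp x)) (g := fun y => g (Complex.exp y))
      (f' := fun x => Complex.exp (-x) * f' (Complex.exp x)) (g' := fun y => g' (Complex.exp y))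
      (fun x y => by
        rw [← neg_sub x y, hodd, add_comm y x]
        ring)
      (fun x y => by
        have h := hfg _ _ (Complex.exp_ne_zero x) (Complex.exp_ne_zero y)
        rw [← Complex.exp_add, ← Complex.exp_sub] at h
        simp only [thetaSigma]
        rw [show Complex.exp (-x) = Complex.exp (-(x + y) / 2) * Complex.exp (-(x - y) / 2) by
          rw [← Complex.exp_add]; ring_nf]
        linear_combination Complex.exp (-(x + y) / 2) * Complex.exp (-(x - y) / 2) * h)
      x y u v
    linear_combination key
  · intro x y hx hy
    rw [thetaSigma_eq_zero_iff] at *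
    rw [Complex.exp_sub]
    exact ellTheta_div_eq_zero hp (Complex.exp_ne_zero x) (Complex.exp_ne_zero y) hx hy

/-! ### Two summation identities for sigma functions, by two-point interpolation. -/

namespace IsSigma

variable {σ : ℂ → ℂ}

theorem zero (hσ : IsSigma σ) : σ 0 = 0 := by
  have := hσ.odd 0
  rw [neg_zero] at this
  exact self_eq_neg.1 this

theorem sub_comm (hσ : IsSigma σ) (x y : ℂ) : σ (x - y) = -σ (y - x) := by
  rw [← hσ.odd, neg_sub]

/-- The addition formula recentred at `P / 2`. It interpolates `b ↦ σ (x + b) * σ (x + (P - b))`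
from the values at `u` and `v`; the weights do not involve `x`, so the formula may be summed over
different `x`. -/
theorem interpolation (hσ : IsSigma σ) (P x b u v : ℂ) :
    σ (x + b) * σ (x + (P - b)) * (σ (u + v - P) * σ (u - v)) =
      σ (x + u) * σ (x + (P - u)) * (σ (b + v - P) * σ (b - v)) -
        σ (x + v) * σ (x + (P - v)) * (σ (b + u - P) * σ (b - u)) := by
  have h := hσ.add_formula (x + P / 2) (b - P / 2) (u - P / 2) (v - P / 2)
  have e1 : ∀ x y : ℂ, x + P / 2 + (y - P / 2) = x + y := fun x y => by ring
  have e2 : ∀ x y : ℂ, x + P / 2 - (y - P / 2) = x + (P - y) := fun x y => by ring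
  have e3 : ∀ x y : ℂ, x - P / 2 + (y - P / 2) = x + y - P := fun x y => by ring
  have e4 : ∀ x y : ℂ, x - P / 2 - (y - P / 2) = x - y := fun x y => by ring
  simpa only [e1, e2, e3, e4] using h

theorem interpolation_sub (hσ : IsSigma σ) (P x b u v : ℂ) :
    σ (x - b) * σ (x - (P - b)) * (σ (u + v - P) * σ (u - v)) =
      σ (x - u) * σ (x - (P - u)) * (σ (b + v - P) * σ (b - v)) -
        σ (x - v) * σ (x - (P - v)) * (σ (b + u - P) * σ (b - u)) := by
  have h := hσ.interpolation (-P) x (-b) (-u) (-v)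
  have e1 : ∀ y : ℂ, x + (-P - -y) = x - (P - y) := fun y => by ring
  have e2 : ∀ y z : ℂ, σ (-y + -z - -P) * σ (-y - -z) = σ (y + z - P) * σ (y - z) := by
    intro y z
    rw [← neg_mul_neg, ← hσ.odd, ← hσ.odd]
    ring_nf
  simp only [e1, e2] at h
  simpa only [← sub_eq_add_neg] using h

/-- For the interpolation weight to be nonzero, a node `x` must be paired with a suitable second
node. At most one of two candidates fails, since the difference of the two arguments is not a zero
of `σ`; hence three variables are enough. -/
theorem ne_zero_or_ne_zero (hσ : IsSigma σ) {x y z : ℂ} (P : ℂ) (h : σ (y - z) ≠ 0) :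
    σ (x + y + P) ≠ 0 ∨ σ (x + z + P) ≠ 0 := by
  by_contra hcon
  push Not at hcon
  refine h ?_
  rw [show y - z = x + y + P - (x + z + P) by ring]
  exact hσ.sub_eq_zero _ _ hcon.1 hcon.2

/-- The partial fraction identity of type `A`. -/
theorem sum_prod_div_eq_zero {ι κ : Type*} [DecidableEq ι] [DecidableEq κ] (hσ : IsSigma σ)
    (n : ℕ) (s : Finset ι) (t : Finset κ) (hs : #s = n) (ht : #t = n) (a : ι → ℂ) (b : κ → ℂ)
    (hab : ∑ i ∈ s, a i = ∑ j ∈ t, b j)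
    (hne : ∀ i ∈ s, ∀ j ∈ s, i ≠ j → σ (a i - a j) ≠ 0) :
    ∑ k ∈ s, (∏ j ∈ t, σ (a k - b j)) / ∏ j ∈ s.erase k, σ (a k - a j) = 0 := by
  induction n generalizing s t b with
  | zero =>
    rw [card_eq_zero] at hs
    simp [hs]
  | succ n ih =>
    rcases Nat.lt_or_ge n 2 with hn | hn
    · interval_cases n
      · obtain ⟨i, rfl⟩ := card_eq_one.1 hs
        obtain ⟨j, rfl⟩ := card_eq_one.1 ht
        simp only [sum_singleton] at hab
        simp [hab, hσ.zero]
      · obtain ⟨i, j, hij, rfl⟩ := card_eq_two.1 hs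
        obtain ⟨k, l, hkl, rfl⟩ := card_eq_two.1 ht
        rw [sum_pair hij, sum_pair hkl] at hab
        rw [sum_pair hij, prod_pair hkl, prod_pair hkl, erase_insert (by simpa using hij),
          pair_comm, erase_insert (by simpa using hij.symm), prod_singleton, prod_singleton,
          show a j - b k = b l - a i by linear_combination hab,
          show a j - b l = b k - a i by linear_combination hab,
          hσ.sub_comm (b l), hσ.sub_comm (b k), hσ.sub_comm (a j)]
        have := hne i (by simp) j (by simp) hij
        field_simp
        ring
    -- Keep `P = b m + b l` fixed and regard the sum as a function of `b m`. By interpolation it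
    -- vanishes once it vanishes at two independent nodes `b m = a u`.
    · obtain ⟨i, hi, j, hj, r, hr, hij, hir, hjr⟩ := two_lt_card.1 (show 2 < #s by omega)
      obtain ⟨m, hm, l, hl, hml⟩ := one_lt_card.1 (show 1 < #t by omega)
      set P := b m + b l with hP
      set G : ℂ → ℂ := fun x => ∏ j ∈ (t.erase m).erase l, σ (x - b j) with hG
      have hlm : l ∈ t.erase m := mem_erase.2 ⟨hml.symm, hl⟩
      have node : ∀ u ∈ s, ∑ k ∈ s, (σ (a k - a u) * σ (a k - (P - a u)) * G (a k)) /
          ∏ j ∈ s.erase k, σ (a k - a j) = 0 := by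
        intro u hu
        -- At `b m = a u` the term `k = u` is zero, and elsewhere `σ (a k - a u)` cancels a
        -- denominator. The identity with `a u` and `b m` removed remains, where `b l` has become `P
        -- - a u`.
        have h := ih (s.erase u) (t.erase m) (by rw [card_erase_of_mem hu, hs]; rfl)
          (by rw [card_erase_of_mem hm, ht]; rfl) (Function.update b l (P - a u)) ?_
          (fun i hi j hj => hne i (mem_of_mem_erase hi) j (mem_of_mem_erase hj))
        · rw [← add_sum_erase _ _ hu, sub_self, hσ.zero, zero_mul, zero_mul, zero_div, zero_add,
            ← h]
          refine sum_congr rfl fun k hk => ?_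
          have hku := ne_of_mem_erase hk
          have hks := mem_of_mem_erase hk
          rw [← mul_prod_erase _ _ hlm, Function.update_self,
            ← mul_prod_erase (s.erase k) (fun j => σ (a k - a j)) (mem_erase.2 ⟨hku.symm, hu⟩),
            erase_right_comm, mul_assoc, mul_div_mul_left _ _ (hne k hks u hu hku)]
          congr 2
          refine prod_congr rfl fun j hj => ?_
          rw [Function.update_of_ne (ne_of_mem_erase hj)]
        · rw [← add_sum_erase _ _ hlm, Function.update_self,
            sum_congr rfl (g := b) fun j hj => by
              rw [Function.update_of_ne (ne_of_mem_erase hj)]]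
          rw [← add_sum_erase _ _ hu, ← add_sum_erase _ _ hm, ← add_sum_erase _ _ hlm] at hab
          linear_combination hab
      have main : ∀ u ∈ s, ∀ v ∈ s, σ (a u + a v - P) ≠ 0 → σ (a u - a v) ≠ 0 →
          ∑ k ∈ s, (∏ j ∈ t, σ (a k - b j)) / ∏ j ∈ s.erase k, σ (a k - a j) = 0 := by
        intro u hu v hv h1 h2
        refine (mul_eq_zero_iff_right (mul_ne_zero h1 h2)).1 ?_
        have e := congrArg₂ (fun x y => x * (σ (b m + a v - P) * σ (b m - a v)) -
          y * (σ (b m + a u - P) * σ (b m - a u))) (node u hu) (node v hv)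
        simp only [zero_mul, sub_zero] at e
        rw [← e, sum_mul, sum_mul, sum_mul, ← sum_sub_distrib]
        refine sum_congr rfl fun k _ => ?_
        have h := hσ.interpolation_sub P (a k) (b m) (a u) (a v)
        rw [show P - b m = b l by rw [hP]; ring] at h
        rw [← mul_prod_erase _ _ hm, ← mul_prod_erase _ _ hlm]
        simp only [hG]
        linear_combination (∏ j ∈ (t.erase m).erase l, σ (a k - b j)) /
          (∏ j ∈ s.erase k, σ (a k - a j)) * h
      rcases hσ.ne_zero_or_ne_zero (x := a i) (-P) (hne j hj r hr hjr) with h | h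
      · exact main i hi j hj h (hne i hi j hj hij)
      · exact main i hi r hr h (hne i hi r hr hir)

/-- The closed form in the identity `sum_prod_mul_div_eq`. -/
noncomputable def parityProd (σ : ℂ → ℂ) (n : ℕ) (W x₁ x₂ x₃ x₄ : ℂ) : ℂ :=
  if Odd n then σ (W + x₁) * σ (W + x₂) * σ (W + x₃) * σ (W + x₄)
  else σ W * σ (W + x₁ + x₂) * σ (W + x₁ + x₃) * σ (W + x₁ + x₄)

/-- Removing the variable `u` changes the parity and replaces the argument `-u` by `u`. This is the
recursion that produces the two forms of the closed expression. -/
theorem parityProd_succ (n : ℕ) (W u x₂ x₃ x₄ : ℂ) :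
    parityProd σ (n + 1) (W + u) (-u) x₂ x₃ x₄ = parityProd σ n W u x₂ x₃ x₄ := by
  rcases Nat.even_or_odd n with h | h
  · rw [parityProd, parityProd, if_pos h.add_one, if_neg (Nat.not_odd_iff_even.2 h),
      add_neg_cancel_right]
  · rw [parityProd, parityProd, if_neg (Nat.not_odd_iff_even.2 h.add_one), if_pos h,
      add_neg_cancel_right]

/-- With `x₁ + x₂` fixed, the closed form lies in the same two-dimensional interpolation space as
the sum. For even `n` this is seen after the constraint rewrites `W + x₃ + x₂` as `-(W + x₁ + x₄)`.
-/
theorem parityProd_interpolation (hσ : IsSigma σ) (n : ℕ) {W x₁ x₂ x₃ x₄ : ℂ}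
    (hx : x₁ + x₂ + x₃ + x₄ + 2 * W = 0) (u v : ℂ) :
    parityProd σ n W x₁ x₂ x₃ x₄ * (σ (u + v - (x₁ + x₂)) * σ (u - v)) =
      parityProd σ n W u (x₁ + x₂ - u) x₃ x₄ * (σ (x₁ + v - (x₁ + x₂)) * σ (x₁ - v)) -
      parityProd σ n W v (x₁ + x₂ - v) x₃ x₄ * (σ (x₁ + u - (x₁ + x₂)) * σ (x₁ - u)) := by
  unfold parityProd
  split_ifs
  · have h := hσ.interpolation (x₁ + x₂) W x₁ u v
    rw [add_sub_cancel_left] at h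
    linear_combination σ (W + x₃) * σ (W + x₄) * h
  · have h := hσ.interpolation (x₁ + x₂) (W + x₃) x₁ u v
    have e : ∀ b, σ (W + x₃ + (x₁ + x₂ - b)) = -σ (W + b + x₄) := by
      intro b
      rw [← hσ.odd]
      congr 1
      linear_combination hx
    rw [e, e, e, add_right_comm W x₃, add_right_comm W x₃, add_right_comm W x₃] at h
    rw [add_assoc W u, add_assoc W v, add_sub_cancel, add_sub_cancel, add_assoc W x₁ x₂]
    linear_combination -σ W * σ (W + (x₁ + x₂)) * h

/-- The summation formula `∑_k ∏_{j ≠ k} σ(w_k + w_j) / σ(w_k - w_j) ∏_i σ(w_k + x_i)`. -/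
theorem sum_prod_mul_div_eq {ι : Type*} [DecidableEq ι] (hσ : IsSigma σ) (n : ℕ) (s : Finset ι)
    (hs : #s = n) (w : ι → ℂ) (x₁ x₂ x₃ x₄ : ℂ)
    (hx : x₁ + x₂ + x₃ + x₄ + 2 * ∑ i ∈ s, w i = 0)
    (hne : ∀ i ∈ s, ∀ j ∈ s, i ≠ j → σ (w i - w j) ≠ 0) :
    ∑ k ∈ s, (∏ j ∈ s.erase k, σ (w k + w j) / σ (w k - w j)) *
      (σ (w k + x₁) * σ (w k + x₂) * σ (w k + x₃) * σ (w k + x₄)) =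
      parityProd σ n (∑ i ∈ s, w i) x₁ x₂ x₃ x₄ := by
  induction n generalizing s x₁ x₂ x₃ x₄ with
  | zero =>
    rw [card_eq_zero] at hs
    simp [hs, parityProd, hσ.zero]
  | succ n ih =>
    rcases Nat.lt_or_ge n 2 with hn | hn
    · interval_cases n
      · obtain ⟨i, rfl⟩ := card_eq_one.1 hs
        simp [parityProd]
      · obtain ⟨i, j, hij, rfl⟩ := card_eq_two.1 hs
        have h := hne i (by simp) j (by simp) hij
        rw [sum_pair hij] at hx
        rw [sum_pair hij, sum_pair hij, erase_insert (by simpa using hij), pair_comm,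
          erase_insert (by simpa using hij.symm), prod_singleton, prod_singleton,
          hσ.sub_comm (w j), parityProd, if_neg (by decide), add_comm (w j)]
        -- For two variables the identity is the addition formula itself: half sums and half
        -- differences make the factors `w i + x` appear directly, and the constraint turns the
        -- others into `-(w j + x)`.
        have h2 := hσ.add_formula (w i + (x₁ + x₂) / 2) (w i + (x₃ + x₄) / 2)
          ((x₁ - x₂) / 2) ((x₃ - x₄) / 2)
        rw [show w i + (x₁ + x₂) / 2 + (w i + (x₃ + x₄) / 2) = w i - w j by
            linear_combination hx / 2,
          show w i + (x₁ + x₂) / 2 - (w i + (x₃ + x₄) / 2) = w i + w j + x₁ + x₂ by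
            linear_combination -hx / 2,
          show (x₁ - x₂) / 2 + (x₃ - x₄) / 2 = w i + w j + x₁ + x₃ by linear_combination -hx / 2,
          show (x₁ - x₂) / 2 - (x₃ - x₄) / 2 = w i + w j + x₁ + x₄ by linear_combination -hx / 2,
          show w i + (x₁ + x₂) / 2 + (x₁ - x₂) / 2 = w i + x₁ by ring,
          show w i + (x₁ + x₂) / 2 - (x₁ - x₂) / 2 = w i + x₂ by ring,
          show w i + (x₃ + x₄) / 2 + (x₃ - x₄) / 2 = w i + x₃ by ring,
          show w i + (x₃ + x₄) / 2 - (x₃ - x₄) / 2 = w i + x₄ by ring,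
          show w i + (x₁ + x₂) / 2 + (x₃ - x₄) / 2 = -(w j + x₄) by linear_combination hx / 2,
          show w i + (x₁ + x₂) / 2 - (x₃ - x₄) / 2 = -(w j + x₃) by linear_combination hx / 2,
          show w i + (x₃ + x₄) / 2 + (x₁ - x₂) / 2 = -(w j + x₂) by linear_combination hx / 2,
          show w i + (x₃ + x₄) / 2 - (x₁ - x₂) / 2 = -(w j + x₁) by linear_combination hx / 2]
          at h2
        simp only [hσ.odd] at h2
        field_simp
        linear_combination -σ (w i + w j) * h2
    · obtain ⟨i, hi, j, hj, r, hr, hij, hir, hjr⟩ := two_lt_card.1 (show 2 < #s by omega)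
      -- At `x₁ = -w u` the term `k = u` vanishes and `σ (w k - w u)` cancels a denominator. The
      -- surviving numerator `σ (w k + w u)` plays the role of `σ (w k + x₁)` with `x₁ = w u` in the
      -- identity for one variable fewer.
      have node : ∀ u ∈ s, ∑ k ∈ s, (∏ j ∈ s.erase k, σ (w k + w j) / σ (w k - w j)) *
          (σ (w k + -w u) * σ (w k + (x₁ + x₂ - -w u)) * σ (w k + x₃) * σ (w k + x₄)) =
          parityProd σ (n + 1) (∑ i ∈ s, w i) (-w u) (x₁ + x₂ - -w u) x₃ x₄ := by
        intro u hu
        have h := ih (s.erase u) (by rw [card_erase_of_mem hu, hs]; rfl) (w u)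
          (x₁ + x₂ - -w u) x₃ x₄ (by
            rw [← add_sum_erase _ _ hu] at hx
            linear_combination hx)
          (fun i hi j hj => hne i (mem_of_mem_erase hi) j (mem_of_mem_erase hj))
        rw [← sum_erase_add s w hu, parityProd_succ, ← h, ← add_sum_erase _ _ hu,
          add_neg_cancel, hσ.zero, zero_mul, zero_mul, zero_mul, mul_zero, zero_add]
        refine sum_congr rfl fun k hk => ?_
        have hku := ne_of_mem_erase hk
        have hks := mem_of_mem_erase hk
        rw [← mul_prod_erase (s.erase k) _ (mem_erase.2 ⟨hku.symm, hu⟩), erase_right_comm,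
          ← sub_eq_add_neg]
        have := hne k hks u hu hku
        field_simp
      have main : ∀ u ∈ s, ∀ v ∈ s, σ (w u + w v + (x₁ + x₂)) ≠ 0 → σ (w u - w v) ≠ 0 →
          ∑ k ∈ s, (∏ j ∈ s.erase k, σ (w k + w j) / σ (w k - w j)) *
            (σ (w k + x₁) * σ (w k + x₂) * σ (w k + x₃) * σ (w k + x₄)) =
            parityProd σ (n + 1) (∑ i ∈ s, w i) x₁ x₂ x₃ x₄ := by
        intro u hu v hv h1 h2
        have h1' : σ (-w u + -w v - (x₁ + x₂)) ≠ 0 := by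
          rw [show -w u + -w v - (x₁ + x₂) = -(w u + w v + (x₁ + x₂)) by ring, hσ.odd]
          exact neg_ne_zero.2 h1
        have h2' : σ (-w u - -w v) ≠ 0 := by
          rw [show -w u - -w v = -(w u - w v) by ring, hσ.odd]
          exact neg_ne_zero.2 h2
        refine mul_right_cancel₀ (mul_ne_zero h1' h2') ?_
        rw [hσ.parityProd_interpolation (n + 1) hx (-w u) (-w v), ← node u hu, ← node v hv,
          sum_mul, sum_mul, sum_mul, ← sum_sub_distrib]
        refine sum_congr rfl fun k _ => ?_
        have h := hσ.interpolation (x₁ + x₂) (w k) x₁ (-w u) (-w v)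
        rw [add_sub_cancel_left] at h
        linear_combination (∏ j ∈ s.erase k, σ (w k + w j) / σ (w k - w j)) *
          (σ (w k + x₃) * σ (w k + x₄)) * h
      rcases hσ.ne_zero_or_ne_zero (x := w i) (x₁ + x₂) (hne j hj r hr hjr) with h | h
      · exact main i hi j hj h (hne i hi j hj hij)
      · exact main i hi r hr h (hne i hi r hr hir)

end IsSigma

/-! ### The two identities with distinguished extra variables. -/

theorem univ_erase_inl {A B : Type*} [Fintype A] [Fintype B] [DecidableEq A] [DecidableEq B]
    (l : A) : (univ : Finset (A ⊕ B)).erase (Sum.inl l) = (univ.erase l).disjSum univ := by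
  ext (x | x) <;> simp

theorem univ_erase_inr {A B : Type*} [Fintype A] [Fintype B] [DecidableEq A] [DecidableEq B]
    (l : B) : (univ : Finset (A ⊕ B)).erase (Sum.inr l) = univ.disjSum (univ.erase l) := by
  ext (x | x) <;> simp

namespace IsSigma

variable {σ : ℂ → ℂ}

theorem ne_zero_comm (hσ : IsSigma σ) {x y : ℂ} (h : σ (x - y) ≠ 0) : σ (y - x) ≠ 0 := by
  rw [hσ.sub_comm]
  exact neg_ne_zero.2 h

/-- The partial fraction identity with two distinguished poles `u` and `v`. -/
theorem sum_prod_div_add_add_eq_zero (hσ : IsSigma σ) {n : ℕ} (a b : Fin n → ℂ) (u v s t : ℂ)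
    (hab : ∑ i, a i + (u + v) = ∑ i, b i + (s + t))
    (hne : ∀ i j, i ≠ j → σ (a i - a j) ≠ 0) (hu : ∀ i, σ (u - a i) ≠ 0)
    (hv : ∀ i, σ (v - a i) ≠ 0) (huv : σ (u - v) ≠ 0) :
    ∑ l, (∏ j, σ (a l - b j)) * (σ (a l - s) * σ (a l - t)) /
        ((∏ j ∈ univ.erase l, σ (a l - a j)) * (σ (a l - u) * σ (a l - v))) +
      ((∏ j, σ (u - b j)) * (σ (u - s) * σ (u - t)) / ((∏ j, σ (u - a j)) * σ (u - v)) +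
        (∏ j, σ (v - b j)) * (σ (v - s) * σ (v - t)) / ((∏ j, σ (v - a j)) * σ (v - u))) = 0 := by
  have h := hσ.sum_prod_div_eq_zero (n + 2) (univ : Finset (Fin n ⊕ Fin 2))
    (univ : Finset (Fin n ⊕ Fin 2)) (by simp) (by simp) (Sum.elim a ![u, v])
    (Sum.elim b ![s, t]) (by simpa using hab) (by
      rintro (i | i) - (j | j) - hij
      · exact hne i j fun h => hij (congrArg _ h)
      · fin_cases j
        · exact hσ.ne_zero_comm (hu i)
        · exact hσ.ne_zero_comm (hv i)
      · fin_cases i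
        · exact hu j
        · exact hv j
      · fin_cases i <;> fin_cases j
        · exact absurd rfl hij
        · exact huv
        · exact hσ.ne_zero_comm huv
        · exact absurd rfl hij)
  rw [Fintype.sum_sum_type, Fin.sum_univ_two] at h
  simp only [univ_erase_inl, univ_erase_inr, prod_disjSum, Fintype.prod_sum_type,
    Fin.prod_univ_two, Sum.elim_inl, Sum.elim_inr, Matrix.cons_val_zero, Matrix.cons_val_one,
    show (univ : Finset (Fin 2)).erase 0 = {1} by decide,
    show (univ : Finset (Fin 2)).erase 1 = {0} by decide, prod_singleton] at h
  exact h

/-- The identity `sum_prod_mul_div_eq` with a distinguished variable `u`. -/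
theorem sum_prod_mul_div_add_eq (hσ : IsSigma σ) {n : ℕ} (w : Fin n → ℂ) (u x₁ x₂ x₃ x₄ : ℂ)
    (hx : x₁ + x₂ + x₃ + x₄ + 2 * (∑ i, w i + u) = 0)
    (hne : ∀ i j, i ≠ j → σ (w i - w j) ≠ 0) (hu : ∀ i, σ (u - w i) ≠ 0) :
    ∑ l, (∏ j ∈ univ.erase l, σ (w l + w j) / σ (w l - w j)) * (σ (w l + u) / σ (w l - u)) *
        (σ (w l + x₁) * σ (w l + x₂) * σ (w l + x₃) * σ (w l + x₄)) +
      (∏ j, σ (u + w j) / σ (u - w j)) *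
        (σ (u + x₁) * σ (u + x₂) * σ (u + x₃) * σ (u + x₄)) =
      parityProd σ (n + 1) (∑ i, w i + u) x₁ x₂ x₃ x₄ := by
  have h := hσ.sum_prod_mul_div_eq (n + 1) (univ : Finset (Fin n ⊕ Fin 1)) (by simp)
    (Sum.elim w ![u]) x₁ x₂ x₃ x₄ (by simpa using hx) (by
      rintro (i | i) - (j | j) - hij
      · exact hne i j fun h => hij (congrArg _ h)
      · fin_cases j
        exact hσ.ne_zero_comm (hu i)
      · fin_cases i
        exact hu j
      · exact absurd (congrArg _ (Subsingleton.elim i j)) hij)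
  simp only [univ_erase_inl, univ_erase_inr, prod_disjSum, Fintype.sum_sum_type,
    Fin.prod_univ_one, Fin.sum_univ_one, Sum.elim_inl, Sum.elim_inr, Matrix.cons_val_zero,
    show (univ : Finset (Fin 1)).erase 0 = ∅ by decide, prod_empty, mul_one] at h
  exact h

end IsSigma

/-! ### Shifted factorials, products over pairs, and sums over the simplex. -/

/-- The shifted factorial in additive notation. -/
def sigmaPoch (σ : ℂ → ℂ) (h u : ℂ) (k : ℕ) : ℂ := ∏ j ∈ range k, σ (u + j * h)

theorem sigmaPoch_succ (σ : ℂ → ℂ) (h u : ℂ) (k : ℕ) :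
    sigmaPoch σ h u (k + 1) = sigmaPoch σ h u k * σ (u + k * h) := prod_range_succ _ _

theorem sigmaPoch_succ' (σ : ℂ → ℂ) (h u : ℂ) (k : ℕ) :
    sigmaPoch σ h (u - h) (k + 1) = σ (u - h) * sigmaPoch σ h u k := by
  rw [sigmaPoch, prod_range_succ', mul_comm]
  congr 1
  · simp
  · refine prod_congr rfl fun j _ => ?_
    congr 1
    push_cast
    ring

/-- Two ways of splitting off an end factor. It governs every factor whose base moves by `-h` when
`N` grows while its length stays the same. -/
theorem sigmaPoch_sub_mul (σ : ℂ → ℂ) (h u : ℂ) (k : ℕ) :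
    sigmaPoch σ h (u - h) k * σ (u - h + k * h) = σ (u - h) * sigmaPoch σ h u k := by
  rw [← sigmaPoch_succ, sigmaPoch_succ']

/-- Raising `x_l` by one changes only the pairs containing `l`; on either side of `l` the change is
the same function `R` of the other index. -/
theorem prod_Ioi_eq_mul {n : ℕ} (l : Fin n) {F G : Fin n → Fin n → ℂ} {R : Fin n → ℂ}
    (h : ∀ i j, i < j → F i j = G i j * ((if i = l then R j else 1) * if j = l then R i else 1)) :
    ∏ i, ∏ j ∈ Ioi i, F i j = (∏ i, ∏ j ∈ Ioi i, G i j) * ∏ j ∈ univ.erase l, R j := by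
  have h1 : ∏ i, ∏ j ∈ Ioi i, F i j = ∏ i, ((∏ j ∈ Ioi i, G i j) *
      ((∏ j ∈ Ioi i, if i = l then R j else 1) * ∏ j ∈ Ioi i, if j = l then R i else 1)) := by
    refine prod_congr rfl fun i _ => ?_
    rw [← prod_mul_distrib, ← prod_mul_distrib]
    exact prod_congr rfl fun j hj => h i j (mem_Ioi.1 hj)
  rw [h1, prod_mul_distrib, prod_mul_distrib]
  congr 1
  have h2 : ∏ i, ∏ j ∈ Ioi i, (if i = l then R j else 1) = ∏ j ∈ Ioi l, R j := by
    rw [prod_eq_single l]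
    · simp
    · intro i _ hi
      simp [hi]
    · simp
  have h3 : ∏ i, ∏ j ∈ Ioi i, (if j = l then R i else 1) = ∏ i ∈ Iio l, R i := by
    simp only [prod_ite_eq', mem_Ioi]
    rw [← prod_filter]
    congr 1
    ext i
    simp
  rw [h2, h3, ← prod_union]
  · congr 1
    ext i
    simp [lt_or_lt_iff_ne, ne_comm]
  · rw [disjoint_left]
    intro i hi hi'
    exact lt_asymm (mem_Ioi.1 hi) (mem_Iio.1 hi')

theorem sum_indexSimplex_succ {n N : ℕ} (l : Fin n) (f : (Fin n → ℕ) → ℂ)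
    (hf : ∀ x, x l = 0 → f x = 0) :
    ∑ x ∈ indexSimplex n (N + 1), f x = ∑ x ∈ indexSimplex n N, f (x + Pi.single l 1) := by
  symm
  refine sum_of_injOn (fun x => x + Pi.single l 1) (fun x _ y _ h => add_right_cancel h) ?_ ?_
    fun _ _ => rfl
  · intro x hx
    rw [mem_coe, mem_indexSimplex] at *
    simpa [sum_add_distrib] using hx
  · intro x hx hx'
    refine hf x (by_contra fun h0 => hx' ⟨x - Pi.single l 1, ?_, ?_⟩)
    · have : x - Pi.single l 1 + Pi.single l 1 = x := by
        refine tsub_add_cancel_of_le fun i => ?_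
        rcases eq_or_ne i l with rfl | hi
        · simpa using Nat.one_le_iff_ne_zero.2 h0
        · simp [hi]
      rw [mem_coe, mem_indexSimplex] at *
      rw [← this] at hx
      simpa [sum_add_distrib] using hx
    · refine tsub_add_cancel_of_le fun i => ?_
      rcases eq_or_ne i l with rfl | hi
      · simpa using Nat.one_le_iff_ne_zero.2 h0
      · simp [hi]

theorem sum_indexSimplex_succ_of_eq_zero {n N : ℕ} (f : (Fin n → ℕ) → ℂ)
    (hf : ∀ x, ∑ i, x i = N + 1 → f x = 0) :
    ∑ x ∈ indexSimplex n (N + 1), f x = ∑ x ∈ indexSimplex n N, f x := by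
  symm
  refine sum_subset (fun x hx => ?_) fun x hx hx' => hf x ?_
  · rw [mem_indexSimplex] at *
    omega
  · rw [mem_indexSimplex] at *
    omega

/-! ### The summand in additive notation and the partition of unity. -/

/-- The parameters of the summation formula in additive notation, so that `q = exp h`,
`a q^N = exp α`, `e q^N = exp ε` and so on. The parity dependent factors have arguments `r`. -/
structure JacksonParams (n : ℕ) where
  (h α ε b c d : ℂ)
  z : Fin n → ℂ
  r : Fin 4 → ℂ

namespace JacksonParams

variable {n : ℕ}

/-- The shifted variables `z_i q^{x_i}` in additive notation. -/
def shift (A : JacksonParams n) (x : Fin n → ℕ) (i : Fin n) : ℂ := A.z i + x i * A.h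

/-- The first distinguished pole. -/
def poleU (A : JacksonParams n) (N k : ℕ) : ℂ := A.ε + (k - N) * A.h

/-- The second distinguished pole. -/
def poleV (A : JacksonParams n) (N : ℕ) : ℂ := A.ε - A.α - N * A.h

/-- The first distinguished zero. -/
def zeroS (A : JacksonParams n) (N k : ℕ) : ℂ := A.ε + 2 * (k - N) * A.h

/-- The second distinguished zero. -/
def zeroT (A : JacksonParams n) : ℂ := A.ε - A.α

variable (σ : ℂ → ℂ)

/-- The factor `Δ(zq^x) / Δ(z)`. -/
noncomputable def delta (A : JacksonParams n) (x : Fin n → ℕ) : ℂ :=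
  ∏ i, ∏ j ∈ Ioi i, σ (A.z j - A.z i + ((x j : ℂ) - x i) * A.h) / σ (A.z j - A.z i)

/-- The factor `∏_{i < j} (z_i z_j)_{x_i + x_j}`. -/
noncomputable def pairs (A : JacksonParams n) (x : Fin n → ℕ) : ℂ :=
  ∏ i, ∏ j ∈ Ioi i, sigmaPoch σ A.h (A.z i + A.z j) (x i + x j)

/-- The factor `∏_i (e / z_i)_{|x| - x_i}`. -/
noncomputable def epsSub (A : JacksonParams n) (N : ℕ) (x : Fin n → ℕ) : ℂ :=
  ∏ i, sigmaPoch σ A.h (A.ε - N * A.h - A.z i) (∑ j, x j - x i)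

/-- The factor `∏_i (e / z_i)_{|x|}`. -/
noncomputable def eps (A : JacksonParams n) (N k : ℕ) : ℂ :=
  ∏ i, sigmaPoch σ A.h (A.ε - N * A.h - A.z i) k

/-- The factor `∏_i (b z_i, c z_i, d z_i)_{x_i}`. -/
noncomputable def numer (A : JacksonParams n) (x : Fin n → ℕ) : ℂ :=
  ∏ i, sigmaPoch σ A.h (A.b + A.z i) (x i) * sigmaPoch σ A.h (A.c + A.z i) (x i) *
    sigmaPoch σ A.h (A.d + A.z i) (x i)

/-- The factor `∏_i (q^{-N} e z_i / a)_{x_i}`. -/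
noncomputable def numerPole (A : JacksonParams n) (N : ℕ) (x : Fin n → ℕ) : ℂ :=
  ∏ i, sigmaPoch σ A.h (A.ε - A.α + A.z i - N * A.h) (x i)

/-- The factor `∏_i (a q z_i / e)_{x_i}`. -/
noncomputable def denomPole (A : JacksonParams n) (x : Fin n → ℕ) : ℂ :=
  ∏ i, sigmaPoch σ A.h (A.α - A.ε + A.h + A.z i) (x i)

/-- The factor `∏_{i,j} (q z_i / z_j)_{x_i}`. -/
noncomputable def denom (A : JacksonParams n) (x : Fin n → ℕ) : ℂ :=
  ∏ i, ∏ j, sigmaPoch σ A.h (A.h + A.z i - A.z j) (x i)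

/-- The parity dependent factor. -/
noncomputable def parityDenom (A : JacksonParams n) (N k : ℕ) : ℂ :=
  ∏ i, sigmaPoch σ A.h (A.r i - N * A.h) k

/-- The summand in additive notation. -/
noncomputable def summand (A : JacksonParams n) (N : ℕ) (x : Fin n → ℕ) : ℂ :=
  A.delta σ x * (σ (A.α - N * A.h + 2 * (∑ i, x i : ℕ) * A.h) / σ (A.α - N * A.h)) *
    (A.pairs σ x / A.epsSub σ N x) *
    (sigmaPoch σ A.h (A.α - N * A.h) (∑ i, x i) * sigmaPoch σ A.h (-(N * A.h)) (∑ i, x i) *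
      A.eps σ N (∑ i, x i) / sigmaPoch σ A.h (A.α + A.h) (∑ i, x i)) *
    (A.numer σ x * A.numerPole σ N x / (A.denomPole σ x * A.denom σ x)) /
    A.parityDenom σ N (∑ i, x i)

/-- The quotient of the closed forms for `N + 1` and `N`. -/
noncomputable def valueRatio (A : JacksonParams n) (N : ℕ) : ℂ :=
  σ (A.α - N * A.h) * (∏ i, σ (A.poleV (N + 1) + A.z i) / σ (A.poleV (N + 1) - A.z i)) *
    (σ (A.poleV (N + 1) + A.b) * σ (A.poleV (N + 1) + A.c) * σ (A.poleV (N + 1) + A.d)) /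
    ∏ i, σ (A.r i - (N + 1) * A.h)

/-- Genericity of the parameters for sums over `|x| ≤ M`. -/
structure Generic (A : JacksonParams n) (M : ℕ) : Prop where
  sub : ∀ i j, i ≠ j → ∀ l : ℤ, |l| ≤ M → σ (A.z i - A.z j + l * A.h) ≠ 0
  nat : ∀ l : ℕ, 1 ≤ l → l ≤ M → σ (l * A.h) ≠ 0
  alpha : ∀ l : ℤ, σ (A.α + l * A.h) ≠ 0
  eps_sub : ∀ i, ∀ l : ℤ, σ (A.ε - A.z i + l * A.h) ≠ 0
  pole_sub : ∀ i, ∀ l : ℤ, σ (A.ε - A.α - A.z i + l * A.h) ≠ 0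
  pole_add : ∀ i, ∀ l : ℤ, σ (A.ε - A.α + A.z i + l * A.h) ≠ 0
  parity : ∀ i, ∀ l : ℤ, σ (A.r i + l * A.h) ≠ 0

/-- The balancing condition, and the relation between it and the parity dependent arguments. -/
structure Balanced (A : JacksonParams n) : Prop where
  sum_eq : 2 * A.α + A.h = A.b + A.c + A.d + A.ε + 2 * ∑ i, A.z i
  parityProd_eq : ∀ N k : ℕ, IsSigma.parityProd σ (n + 1)
    (∑ i, A.z i + k * A.h + A.poleV (N + 1)) (A.h - A.zeroS (N + 1) (k + 1)) A.b A.c A.d =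
      -∏ i, σ (A.r i + ((k : ℂ) - N - 1) * A.h)

variable {σ} {A : JacksonParams n} {M : ℕ}

theorem Generic.alpha_ne (hA : A.Generic σ M) {u : ℂ} (l : ℤ) (hu : u = A.α + l * A.h) :
    σ u ≠ 0 := hu ▸ hA.alpha l

theorem Generic.shift_sub (hA : A.Generic σ M) {x : Fin n → ℕ} (hx : ∑ i, x i ≤ M) {i j : Fin n}
    (hij : i ≠ j) : σ (A.shift x i - A.shift x j) ≠ 0 := by
  have hi : x i ≤ ∑ i, x i := single_le_sum (fun j _ => Nat.zero_le (x j)) (mem_univ i)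
  have hj : x j ≤ ∑ i, x i := single_le_sum (fun j _ => Nat.zero_le (x j)) (mem_univ j)
  have := hA.sub i j hij ((x i : ℤ) - x j) (by rw [abs_le]; omega)
  convert this using 2
  simp only [shift]
  push_cast
  ring

theorem Generic.poleU_sub (hA : A.Generic σ M) (x : Fin n → ℕ) (N k : ℕ) (i : Fin n) :
    σ (A.poleU N k - A.shift x i) ≠ 0 := by
  convert hA.eps_sub i ((k : ℤ) - N - x i) using 2
  simp only [shift, poleU]
  push_cast
  ring

theorem Generic.poleV_sub (hA : A.Generic σ M) (x : Fin n → ℕ) (N : ℕ) (i : Fin n) :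
    σ (A.poleV N - A.shift x i) ≠ 0 := by
  convert hA.pole_sub i (-(N : ℤ) - x i) using 2
  simp only [shift, poleV]
  push_cast
  ring

theorem Generic.poleV_add (hA : A.Generic σ M) (x : Fin n → ℕ) (N : ℕ) (i : Fin n) :
    σ (A.poleV N + A.shift x i) ≠ 0 := by
  convert hA.pole_add i (-(N : ℤ) + x i) using 2
  simp only [shift, poleV]
  push_cast
  ring

theorem shift_zero : A.shift 0 = A.z := by
  funext i
  simp [shift]

theorem sum_shift (x : Fin n → ℕ) :
    ∑ i, A.shift x i = ∑ i, A.z i + (∑ i, x i : ℕ) * A.h := by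
  simp only [shift]
  rw [sum_add_distrib, ← sum_mul]
  push_cast
  rfl

theorem shift_add_single_self (x : Fin n → ℕ) (l : Fin n) :
    A.shift (x + Pi.single l 1) l = A.shift x l + A.h := by
  simp only [shift, Pi.add_apply, Pi.single_eq_same]
  push_cast
  ring

theorem shift_add_single_of_ne (x : Fin n → ℕ) {l j : Fin n} (hj : j ≠ l) :
    A.shift (x + Pi.single l 1) j = A.shift x j := by
  simp [shift, hj]

theorem sum_add_single (x : Fin n → ℕ) (l : Fin n) :
    ∑ i, (x + Pi.single l 1 : Fin n → ℕ) i = ∑ i, x i + 1 := by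
  simp [sum_add_distrib]

variable (σ A)

/-- The residue-type term at a variable in the partial fraction identity. -/
noncomputable def fracTerm (N : ℕ) (x : Fin n → ℕ) (l : Fin n) : ℂ :=
  (∏ j, σ (A.shift x l - A.z j)) * (σ (A.shift x l - A.zeroS N (∑ i, x i)) *
    σ (A.shift x l - A.zeroT)) /
    ((∏ j ∈ univ.erase l, σ (A.shift x l - A.shift x j)) *
      (σ (A.shift x l - A.poleU N (∑ i, x i)) * σ (A.shift x l - A.poleV N)))

/-- The term at the pole `poleU` in the partial fraction identity. -/
noncomputable def fracTermU (N : ℕ) (x : Fin n → ℕ) : ℂ :=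
  (∏ j, σ (A.poleU N (∑ i, x i) - A.z j)) *
    (σ (A.poleU N (∑ i, x i) - A.zeroS N (∑ i, x i)) * σ (A.poleU N (∑ i, x i) - A.zeroT)) /
    ((∏ j, σ (A.poleU N (∑ i, x i) - A.shift x j)) * σ (A.poleU N (∑ i, x i) - A.poleV N))

/-- The term at the pole `poleV` in the partial fraction identity. -/
noncomputable def fracTermV (N : ℕ) (x : Fin n → ℕ) : ℂ :=
  (∏ j, σ (A.poleV N - A.z j)) * (σ (A.poleV N - A.zeroS N (∑ i, x i)) *
    σ (A.poleV N - A.zeroT)) /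
    ((∏ j, σ (A.poleV N - A.shift x j)) * σ (A.poleV N - A.poleU N (∑ i, x i)))

variable {σ A}

/-- `N ≥ 1` matters: for `N = 0` the pole `poleV` meets the zero `zeroT`. -/
theorem fracTermV_ne_zero (hσ : IsSigma σ) (hA : A.Generic σ M) {N : ℕ} (hN : N ≤ M)
    (hN0 : 1 ≤ N) (x : Fin n → ℕ) : A.fracTermV σ N x ≠ 0 := by
  refine div_ne_zero (mul_ne_zero (prod_ne_zero_iff.2 fun j _ => ?_) (mul_ne_zero ?_ ?_))
    (mul_ne_zero (prod_ne_zero_iff.2 fun j _ => hA.poleV_sub x N j) ?_)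
  · have := hA.poleV_sub 0 N j
    rwa [shift_zero] at this
  · refine hσ.ne_zero_comm (hA.alpha_ne (2 * (∑ i, x i : ℕ) - N) ?_)
    simp only [zeroS, poleV]
    push_cast
    ring
  · refine hσ.ne_zero_comm ?_
    convert hA.nat N hN0 hN using 2
    simp only [zeroT, poleV]
    ring
  · refine hσ.ne_zero_comm (hA.alpha_ne (∑ i, x i : ℕ) ?_)
    simp only [poleU, poleV]
    push_cast
    ring

/-- Partial fractions with nodes `z_i + x_i h`, `poleU`, `poleV` and zeros `z_i`, `zeroS`, `zeroT`,
divided by the `poleV` term. The zeros are chosen so that the node sums agree, the `l`-th term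
vanishes at `x l = 0`, and the `poleU` term vanishes at `|x| = N`. -/
theorem sum_fracTerm (hσ : IsSigma σ) (hA : A.Generic σ M) {N : ℕ} (hN : N ≤ M)
    (hN0 : 1 ≤ N) {x : Fin n → ℕ} (hx : ∑ i, x i ≤ N) :
    ∑ l, A.fracTerm σ N x l / -A.fracTermV σ N x + A.fracTermU σ N x / -A.fracTermV σ N x = 1 := by
  have h := hσ.sum_prod_div_add_add_eq_zero (A.shift x) A.z (A.poleU N (∑ i, x i)) (A.poleV N)
    (A.zeroS N (∑ i, x i)) A.zeroT (by
      rw [sum_shift]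
      simp only [poleU, poleV, zeroS, zeroT]
      ring)
    (fun i j hij => hA.shift_sub (hx.trans hN) hij) (hA.poleU_sub x N _) (hA.poleV_sub x N) (by
      refine hA.alpha_ne (∑ i, x i : ℕ) ?_
      simp only [poleU, poleV]
      push_cast
      ring)
  have h0 := fracTermV_ne_zero hσ hA hN hN0 x
  rw [← sum_div, ← add_div, div_eq_one_iff_eq (neg_ne_zero.2 h0), eq_neg_iff_add_eq_zero,
    add_assoc]
  exact h

theorem fracTerm_eq_zero (hσ : IsSigma σ) {N : ℕ} {x : Fin n → ℕ} {l : Fin n} (hl : x l = 0) :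
    A.fracTerm σ N x l = 0 := by
  have : ∏ j, σ (A.shift x l - A.z j) = 0 := by
    refine prod_eq_zero (mem_univ l) ?_
    simp [shift, hl, hσ.zero]
  rw [fracTerm, this, zero_mul, zero_div]

theorem fracTermU_eq_zero (hσ : IsSigma σ) {N : ℕ} {x : Fin n → ℕ} (hx : ∑ i, x i = N) :
    A.fracTermU σ N x = 0 := by
  have : σ (A.poleU N (∑ i, x i) - A.zeroS N (∑ i, x i)) = 0 := by
    simp [poleU, zeroS, hx, hσ.zero]
  rw [fracTermU, this, zero_mul, mul_zero, zero_div]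

end JacksonParams

/-! ### Change of each factor of the summand under `N ↦ N + 1` and `x ↦ x + e_l`. -/

namespace JacksonParams

variable {n : ℕ} {σ : ℂ → ℂ} {A : JacksonParams n} {M : ℕ}

theorem poleU_succ_succ (A : JacksonParams n) (N k : ℕ) :
    A.poleU (N + 1) (k + 1) = A.poleU (N + 1) k + A.h := by
  simp only [poleU]
  push_cast
  ring

theorem le_sum (x : Fin n → ℕ) (i : Fin n) : x i ≤ ∑ j, x j :=
  single_le_sum (fun j _ => Nat.zero_le (x j)) (mem_univ i)

theorem prod_eq_mul_of_eq {l : Fin n} {F G : Fin n → ℂ} {s : ℂ} (hl : F l = G l * s)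
    (h : ∀ i, i ≠ l → F i = G i) : ∏ i, F i = (∏ i, G i) * s := by
  rw [← mul_prod_erase _ _ (mem_univ l), ← mul_prod_erase univ G (mem_univ l), hl,
    prod_congr rfl fun i hi => h i (ne_of_mem_erase hi)]
  ring

theorem delta_add_single (hσ : IsSigma σ) (hA : A.Generic σ M) {x : Fin n → ℕ}
    (hx : ∑ i, x i ≤ M) (l : Fin n) :
    A.delta σ (x + Pi.single l 1) = A.delta σ x *
      ∏ j ∈ univ.erase l, σ (A.shift x l + A.h - A.shift x j) / σ (A.shift x l - A.shift x j) := by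
  refine prod_Ioi_eq_mul l fun i j hij => ?_
  have e : ∀ y : Fin n → ℕ, A.z j - A.z i + ((y j : ℂ) - y i) * A.h = A.shift y j - A.shift y i :=
    fun y => by simp only [shift]; ring
  rw [e, e]
  rcases eq_or_ne i l with rfl | hi
  · rw [if_pos rfl, if_neg hij.ne', mul_one, shift_add_single_self,
      shift_add_single_of_ne _ hij.ne', hσ.sub_comm (A.shift x j), hσ.sub_comm (A.shift x j)]
    have := hA.shift_sub hx hij.ne
    field_simp
  · rcases eq_or_ne j l with rfl | hj
    · rw [if_neg hi, if_pos rfl, one_mul, shift_add_single_self, shift_add_single_of_ne _ hi]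
      have := hA.shift_sub hx hi.symm
      field_simp
    · rw [if_neg hi, if_neg hj, shift_add_single_of_ne _ hi, shift_add_single_of_ne _ hj]
      ring

theorem pairs_add_single (x : Fin n → ℕ) (l : Fin n) :
    A.pairs σ (x + Pi.single l 1) = A.pairs σ x *
      ∏ j ∈ univ.erase l, σ (A.shift x l + A.shift x j) := by
  refine prod_Ioi_eq_mul l fun i j hij => ?_
  have e : ∀ i j, σ (A.shift x i + A.shift x j) = σ (A.z i + A.z j + (x i + x j : ℕ) * A.h) := by
    intro i j
    congr 1
    simp only [shift]
    push_cast
    ring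
  rcases eq_or_ne i l with rfl | hi
  · rw [if_pos rfl, if_neg hij.ne', mul_one, e, ← sigmaPoch_succ]
    simp [hij.ne', add_right_comm]
  · rcases eq_or_ne j l with rfl | hj
    · rw [if_neg hi, if_pos rfl, one_mul, add_comm (A.shift x j), e, ← sigmaPoch_succ]
      simp [hi, add_assoc]
    · simp [hi, hj]

/-- Each base moves by `-h`. For `i = l` the length `|x| - x l` is unchanged, which costs the extra
factor on the left; for `i ≠ l` the length grows by one and only a new initial factor appears. -/
theorem epsSub_succ_add_single (N : ℕ) (x : Fin n → ℕ) (l : Fin n) :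
    A.epsSub σ (N + 1) (x + Pi.single l 1) * σ (A.poleU (N + 1) (∑ i, x i) - A.shift x l) =
      A.epsSub σ N x * ∏ i, σ (A.ε - (N + 1) * A.h - A.z i) := by
  have key : A.epsSub σ N x * ∏ i, σ (A.ε - (N + 1) * A.h - A.z i) =
      ∏ i, sigmaPoch σ A.h (A.ε - N * A.h - A.z i) (∑ j, x j - x i) *
        σ (A.ε - (N + 1) * A.h - A.z i) := prod_mul_distrib.symm
  rw [key]
  symm
  have e : ∀ i, A.ε - (N + 1) * A.h - A.z i = A.ε - N * A.h - A.z i - A.h := fun i => by ring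
  refine prod_eq_mul_of_eq (l := l) ?_ fun i hi => ?_
  · rw [sum_add_single, Pi.add_apply, Pi.single_eq_same, Nat.add_sub_add_right, e, mul_comm,
      ← sigmaPoch_sub_mul]
    push_cast
    rw [e]
    congr 2
    rw [Nat.cast_sub (le_sum x l)]
    simp only [poleU, shift]
    push_cast
    ring
  · rw [sum_add_single, Pi.add_apply, Pi.single_eq_of_ne hi, add_zero,
      Nat.sub_add_comm (le_sum x i), e, mul_comm]
    push_cast
    rw [e, ← sigmaPoch_succ']

theorem epsSub_succ (N : ℕ) (x : Fin n → ℕ) :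
    A.epsSub σ (N + 1) x * ∏ i, σ (A.poleU (N + 1) (∑ i, x i) - A.shift x i) =
      A.epsSub σ N x * ∏ i, σ (A.ε - (N + 1) * A.h - A.z i) := by
  simp only [epsSub]
  rw [← prod_mul_distrib, ← prod_mul_distrib]
  refine prod_congr rfl fun i _ => ?_
  have e : A.ε - (N + 1) * A.h - A.z i = A.ε - N * A.h - A.z i - A.h := by ring
  push_cast
  rw [e, mul_comm (sigmaPoch _ _ _ _) (σ (_ - A.h)), ← sigmaPoch_sub_mul]
  congr 2
  rw [Nat.cast_sub (le_sum x i)]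
  simp only [poleU, shift]
  push_cast
  ring

theorem eps_succ_succ (N k : ℕ) :
    A.eps σ (N + 1) (k + 1) = A.eps σ N k * ∏ i, σ (A.ε - (N + 1) * A.h - A.z i) := by
  simp only [eps]
  rw [← prod_mul_distrib]
  refine prod_congr rfl fun i _ => ?_
  have e : A.ε - (N + 1) * A.h - A.z i = A.ε - N * A.h - A.z i - A.h := by ring
  push_cast
  rw [e, sigmaPoch_succ', mul_comm]

theorem eps_succ (N k : ℕ) :
    A.eps σ (N + 1) k * ∏ i, σ (A.poleU (N + 1) k - A.z i) =
      A.eps σ N k * ∏ i, σ (A.ε - (N + 1) * A.h - A.z i) := by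
  simp only [eps]
  rw [← prod_mul_distrib, ← prod_mul_distrib]
  refine prod_congr rfl fun i _ => ?_
  have e : A.ε - (N + 1) * A.h - A.z i = A.ε - N * A.h - A.z i - A.h := by ring
  push_cast
  rw [e, mul_comm (sigmaPoch _ _ _ _) (σ (_ - A.h)), ← sigmaPoch_sub_mul]
  congr 2
  simp only [poleU]
  push_cast
  ring

theorem numer_add_single (x : Fin n → ℕ) (l : Fin n) :
    A.numer σ (x + Pi.single l 1) = A.numer σ x *
      (σ (A.shift x l + A.b) * σ (A.shift x l + A.c) * σ (A.shift x l + A.d)) := by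
  refine prod_eq_mul_of_eq (l := l) ?_ fun i hi => by simp [hi]
  have e : ∀ b, σ (A.shift x l + b) = σ (b + A.z l + x l * A.h) := by
    intro b
    congr 1
    simp only [shift]
    ring
  rw [Pi.add_apply, Pi.single_eq_same, sigmaPoch_succ, sigmaPoch_succ, sigmaPoch_succ, e, e, e]
  ring

theorem numerPole_succ (N : ℕ) (x : Fin n → ℕ) :
    A.numerPole σ (N + 1) x * ∏ i, σ (A.poleV (N + 1) + A.shift x i) =
      A.numerPole σ N x * ∏ i, σ (A.poleV (N + 1) + A.z i) := by
  simp only [numerPole]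
  rw [← prod_mul_distrib, ← prod_mul_distrib]
  refine prod_congr rfl fun i _ => ?_
  have e : A.poleV (N + 1) + A.z i = A.ε - A.α + A.z i - N * A.h - A.h := by
    simp only [poleV]
    push_cast
    ring
  rw [e, mul_comm (sigmaPoch _ _ _ _) (σ (_ - A.h)), ← sigmaPoch_sub_mul]
  congr 2
  · push_cast
    ring
  · simp only [poleV, shift]
    push_cast
    ring

theorem numerPole_succ_add_single (N : ℕ) (x : Fin n → ℕ) (l : Fin n) :
    A.numerPole σ (N + 1) (x + Pi.single l 1) *
        ∏ j ∈ univ.erase l, σ (A.poleV (N + 1) + A.shift x j) =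
      A.numerPole σ N x * ∏ i, σ (A.poleV (N + 1) + A.z i) := by
  have e : ∀ i, A.ε - A.α + A.z i - (N + 1 : ℕ) * A.h = A.ε - A.α + A.z i - N * A.h - A.h := by
    intro i
    push_cast
    ring
  have e' : ∀ i, A.poleV (N + 1) + A.z i = A.ε - A.α + A.z i - N * A.h - A.h := by
    intro i
    simp only [poleV]
    push_cast
    ring
  simp only [numerPole]
  rw [← prod_mul_distrib, ← mul_prod_erase _ _ (mem_univ l),
    ← mul_prod_erase univ (fun i => _ * _) (mem_univ l), mul_assoc, ← prod_mul_distrib]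
  congr 1
  · rw [Pi.add_apply, Pi.single_eq_same, e, e', sigmaPoch_succ', mul_comm]
  · refine prod_congr rfl fun i hi => ?_
    rw [Pi.add_apply, Pi.single_eq_of_ne (ne_of_mem_erase hi), add_zero, e, e',
      mul_comm (sigmaPoch _ _ (_ - _ * _) _) (σ (_ - A.h)), ← sigmaPoch_sub_mul]
    congr 2
    simp only [poleV, shift]
    push_cast
    ring

theorem denomPole_add_single (x : Fin n → ℕ) (l : Fin n) :
    A.denomPole σ (x + Pi.single l 1) = A.denomPole σ x *
      σ (A.shift x l + A.h - A.zeroT) := by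
  refine prod_eq_mul_of_eq (l := l) ?_ fun i hi => by simp [hi]
  rw [Pi.add_apply, Pi.single_eq_same, sigmaPoch_succ]
  congr 2
  simp only [shift, zeroT]
  ring

theorem denom_add_single (x : Fin n → ℕ) (l : Fin n) :
    A.denom σ (x + Pi.single l 1) = A.denom σ x *
      ∏ j, σ (A.shift x l + A.h - A.z j) := by
  refine prod_eq_mul_of_eq (l := l) ?_ fun i hi => by simp [hi]
  rw [← prod_mul_distrib]
  refine prod_congr rfl fun j _ => ?_
  rw [Pi.add_apply, Pi.single_eq_same, sigmaPoch_succ]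
  congr 2
  simp only [shift]
  ring

theorem parityDenom_succ_succ (N k : ℕ) :
    A.parityDenom σ (N + 1) (k + 1) = A.parityDenom σ N k * ∏ i, σ (A.r i - (N + 1) * A.h) := by
  simp only [parityDenom]
  rw [← prod_mul_distrib]
  refine prod_congr rfl fun i _ => ?_
  have e : A.r i - (N + 1) * A.h = A.r i - N * A.h - A.h := by ring
  push_cast
  rw [e, sigmaPoch_succ', mul_comm]

theorem parityDenom_succ (N k : ℕ) :
    A.parityDenom σ (N + 1) k * ∏ i, σ (A.r i + ((k : ℂ) - N - 1) * A.h) =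
      A.parityDenom σ N k * ∏ i, σ (A.r i - (N + 1) * A.h) := by
  simp only [parityDenom]
  rw [← prod_mul_distrib, ← prod_mul_distrib]
  refine prod_congr rfl fun i _ => ?_
  have e : A.r i - (N + 1) * A.h = A.r i - N * A.h - A.h := by ring
  push_cast
  rw [e, mul_comm (sigmaPoch _ _ _ _) (σ (_ - A.h)), ← sigmaPoch_sub_mul]
  congr 2
  ring

end JacksonParams

/-! ### The inductive step and the summation formula for generic parameters. -/

namespace JacksonParams

variable {n : ℕ} (σ : ℂ → ℂ) (A : JacksonParams n)

/-- The common factor of the one-step ratios of the summands. -/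
noncomputable def stepFactor (N : ℕ) (x : Fin n → ℕ) : ℂ :=
  σ (A.α - N * A.h) / σ (A.α - N * A.h + 2 * (∑ i, x i : ℕ) * A.h) *
    ((∏ i, σ (A.poleV (N + 1) - A.shift x i)) * (∏ i, σ (A.poleV (N + 1) + A.z i)) /
      ((∏ i, σ (A.poleV (N + 1) - A.z i)) * ∏ i, σ (A.poleV (N + 1) + A.shift x i))) /
    ∏ i, σ (A.r i - (N + 1) * A.h)

/-- The product of four factors in the one-step ratios of the summands. -/
noncomputable def stepQuad (N k : ℕ) (u : ℂ) : ℂ :=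
  σ (u + (A.h - A.zeroS (N + 1) (k + 1))) * σ (u + A.b) * σ (u + A.c) * σ (u + A.d)

variable {σ A} {M : ℕ}

theorem prod_parity_ne_zero (hA : A.Generic σ M) (N : ℕ) :
    ∏ i, σ (A.r i - (N + 1) * A.h) ≠ 0 := by
  refine prod_ne_zero_iff.2 fun i _ => ?_
  convert hA.parity i (-(N : ℤ) - 1) using 2
  push_cast
  ring

theorem prod_eps_ne_zero (hA : A.Generic σ M) (N : ℕ) :
    ∏ i, σ (A.ε - (N + 1) * A.h - A.z i) ≠ 0 := by
  refine prod_ne_zero_iff.2 fun i _ => ?_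
  convert hA.eps_sub i (-(N : ℤ) - 1) using 2
  push_cast
  ring

theorem prod_poleV_sub_ne_zero (hA : A.Generic σ M) (N : ℕ) (x : Fin n → ℕ) :
    ∏ i, σ (A.poleV N - A.shift x i) ≠ 0 :=
  prod_ne_zero_iff.2 fun i _ => hA.poleV_sub x N i

theorem prod_poleV_add_ne_zero (hA : A.Generic σ M) (N : ℕ) (x : Fin n → ℕ) :
    ∏ i, σ (A.poleV N + A.shift x i) ≠ 0 :=
  prod_ne_zero_iff.2 fun i _ => hA.poleV_add x N i

/-- Up to sign, the right-hand side is the `poleV` term of the second summation identity. Its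
dependence on `x` cancels against that of `stepFactor`, leaving a quantity that can be taken out of
the sum over `x`. -/
theorem valueRatio_eq (hσ : IsSigma σ) (hA : A.Generic σ M) (N : ℕ) (x : Fin n → ℕ) :
    A.valueRatio σ N = -(A.stepFactor σ N x * ((∏ j, σ (A.poleV (N + 1) + A.shift x j) /
      σ (A.poleV (N + 1) - A.shift x j)) *
        A.stepQuad σ N (∑ i, x i) (A.poleV (N + 1)))) := by
  have h1 := prod_poleV_sub_ne_zero hA (N + 1) x
  have h2 := prod_poleV_add_ne_zero hA (N + 1) x
  have h3 := prod_poleV_sub_ne_zero hA (N + 1) 0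
  rw [shift_zero] at h3
  have h4 := prod_parity_ne_zero hA N
  have h5 : σ (A.α - N * A.h + 2 * (∑ i, x i : ℕ) * A.h) ≠ 0 := by
    refine hA.alpha_ne (2 * (∑ i, x i : ℕ) - N) ?_
    push_cast
    ring
  have h6 : σ (A.poleV (N + 1) + (A.h - A.zeroS (N + 1) (∑ i, x i + 1))) =
      -σ (A.α - N * A.h + 2 * (∑ i, x i : ℕ) * A.h) := by
    rw [← hσ.odd]
    congr 1
    simp only [poleV, zeroS]
    push_cast
    ring
  rw [valueRatio, stepFactor, stepQuad, prod_div_distrib, prod_div_distrib, h6]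
  generalize ∏ i, σ (A.poleV (N + 1) - A.shift x i) = p₁,
    ∏ i, σ (A.poleV (N + 1) + A.shift x i) = p₂, ∏ i, σ (A.poleV (N + 1) - A.z i) = p₃,
    ∏ i, σ (A.r i - (N + 1) * A.h) = p₄,
    σ (A.α - N * A.h + 2 * (∑ i, x i : ℕ) * A.h) = p₅ at *
  field_simp

theorem fracTermU_mul_summand (hσ : IsSigma σ) (hA : A.Generic σ M) {N : ℕ} (hN : N + 1 ≤ M)
    {x : Fin n → ℕ} (hx : ∑ i, x i ≤ N) :
    A.fracTermU σ (N + 1) x / -A.fracTermV σ (N + 1) x * A.summand σ (N + 1) x =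
      A.summand σ N x * (A.stepFactor σ N x *
        ∏ i, σ (A.r i + ((∑ i, x i : ℕ) - N - 1 : ℂ) * A.h)) := by
  obtain ⟨k, hk⟩ : ∃ k, k = ∑ i, x i := ⟨_, rfl⟩
  rw [fracTermU, fracTermV, summand, summand, stepFactor, ← hk]
  rw [← hk] at hx
  have v1 := prod_poleV_sub_ne_zero hA (N + 1) x
  have v2 := prod_poleV_add_ne_zero hA (N + 1) x
  have v3 := prod_poleV_sub_ne_zero hA (N + 1) 0
  rw [shift_zero] at v3
  have v4 := prod_parity_ne_zero hA N
  have v5 := prod_eps_ne_zero hA N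
  have v6 : ∏ i, σ (A.poleU (N + 1) k - A.shift x i) ≠ 0 :=
    prod_ne_zero_iff.2 fun i _ => hA.poleU_sub x _ _ i
  have v7 : ∏ i, σ (A.poleU (N + 1) k - A.z i) ≠ 0 := by
    refine prod_ne_zero_iff.2 fun i _ => ?_
    have := hA.poleU_sub 0 (N + 1) k i
    rwa [shift_zero] at this
  have v8 : ∏ i, σ (A.r i + ((k : ℂ) - N - 1) * A.h) ≠ 0 := by
    refine prod_ne_zero_iff.2 fun i _ => ?_
    convert hA.parity i ((k : ℤ) - N - 1) using 2
    push_cast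
    ring
  have a0 : σ (A.α - N * A.h) ≠ 0 := hA.alpha_ne (-N) (by push_cast; ring)
  have a1 : σ (A.α - N * A.h - A.h) ≠ 0 := hA.alpha_ne (-N - 1) (by push_cast; ring)
  have a2 : σ (A.α - N * A.h + 2 * (k : ℂ) * A.h) ≠ 0 :=
    hA.alpha_ne (2 * k - N) (by push_cast; ring)
  have a3 : σ (A.α - (N + 1 : ℕ) * A.h + 2 * (k : ℂ) * A.h) ≠ 0 :=
    hA.alpha_ne (2 * k - N - 1) (by push_cast; ring)
  have a5 : σ (A.α - N * A.h - A.h + k * A.h) ≠ 0 := hA.alpha_ne (k - N - 1) (by push_cast; ring)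
  have a6 : σ (A.α + k * A.h) ≠ 0 := hA.alpha_ne k (by push_cast; ring)
  have b1 : σ (((N + 1 : ℕ) : ℂ) * A.h) ≠ 0 := hA.nat (N + 1) (by omega) hN
  have b2 : σ (((N + 1 - k : ℕ) : ℂ) * A.h) ≠ 0 := hA.nat (N + 1 - k) (by omega) (by omega)
  have e1 : σ (A.poleU (N + 1) k - A.zeroS (N + 1) k) = σ (((N + 1 - k : ℕ) : ℂ) * A.h) := by
    congr 1
    rw [Nat.cast_sub (by omega)]
    simp only [poleU, zeroS]
    push_cast
    ring
  have e2 : σ (A.poleU (N + 1) k - A.zeroT) = σ (A.α - N * A.h - A.h + k * A.h) := by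
    congr 1
    simp only [poleU, zeroT]
    push_cast
    ring
  have e3 : σ (A.poleU (N + 1) k - A.poleV (N + 1)) = σ (A.α + k * A.h) := by
    congr 1
    simp only [poleU, poleV]
    push_cast
    ring
  have e4 : σ (A.poleV (N + 1) - A.poleU (N + 1) k) = -σ (A.α + k * A.h) := by
    rw [hσ.sub_comm, e3]
  have e5 : σ (A.poleV (N + 1) - A.zeroS (N + 1) k) =
      -σ (A.α - (N + 1 : ℕ) * A.h + 2 * (k : ℂ) * A.h) := by
    rw [← hσ.odd]
    congr 1
    simp only [poleV, zeroS]
    push_cast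
    ring
  have e6 : σ (A.poleV (N + 1) - A.zeroT) = -σ (((N + 1 : ℕ) : ℂ) * A.h) := by
    rw [← hσ.odd]
    congr 1
    simp only [poleV, zeroT]
    ring
  have e7 : A.α - (N + 1 : ℕ) * A.h = A.α - N * A.h - A.h := by
    push_cast
    ring
  have f1 := eq_div_of_mul_eq v6 (hk ▸ A.epsSub_succ (σ := σ) N x)
  have f2 := eq_div_of_mul_eq v7 (A.eps_succ (σ := σ) N k)
  have f3 := eq_div_of_mul_eq v2 (A.numerPole_succ (σ := σ) N x)
  have f4 := eq_div_of_mul_eq v8 (A.parityDenom_succ (σ := σ) N k)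
  have f5 := eq_div_of_mul_eq a5 (sigmaPoch_sub_mul σ A.h (A.α - N * A.h) k)
  have f6 : sigmaPoch σ A.h (-((N + 1 : ℕ) * A.h)) k =
      σ (((N + 1 : ℕ) : ℂ) * A.h) * sigmaPoch σ A.h (-(N * A.h)) k /
        σ (((N + 1 - k : ℕ) : ℂ) * A.h) := by
    have h := sigmaPoch_sub_mul σ A.h (-(N * A.h)) k
    rw [show -(N * A.h) - A.h + k * A.h = -(((N + 1 - k : ℕ) : ℂ) * A.h) by
        rw [Nat.cast_sub (by omega)]; push_cast; ring,
      show -(N * A.h) - A.h = -(((N + 1 : ℕ) : ℂ) * A.h) by push_cast; ring,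
      hσ.odd, hσ.odd] at h
    refine eq_div_of_mul_eq b2 ?_
    linear_combination -h
  rw [e1, e2, e3, e4, e5, e6, f1, f2, f3, f4, f6, e7, f5]
  rw [e7] at a3
  clear f1 f2 f3 f4 f5 f6 e1 e2 e3 e4 e5 e6 e7
  generalize ∏ i, σ (A.poleV (N + 1) - A.shift x i) = p₁,
    ∏ i, σ (A.poleV (N + 1) + A.shift x i) = p₂, ∏ i, σ (A.poleV (N + 1) - A.z i) = p₃,
    ∏ i, σ (A.r i - (N + 1) * A.h) = p₄, ∏ i, σ (A.ε - (N + 1) * A.h - A.z i) = p₅,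
    ∏ i, σ (A.poleU (N + 1) k - A.shift x i) = p₆, ∏ i, σ (A.poleU (N + 1) k - A.z i) = p₇,
    ∏ i, σ (A.r i + ((k : ℂ) - N - 1) * A.h) = p₈, ∏ i, σ (A.poleV (N + 1) + A.z i) = p₉,
    σ (A.α - N * A.h) = q₀,
    σ (A.α - N * A.h - A.h) = q₁, σ (A.α - N * A.h + 2 * (k : ℂ) * A.h) = q₂,
    σ (A.α - N * A.h - A.h + 2 * (k : ℂ) * A.h) = q₃, σ (A.α - N * A.h - A.h + k * A.h) = q₅,
    σ (A.α + k * A.h) = q₆, σ (((N + 1 : ℕ) : ℂ) * A.h) = q₇,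
    σ (((N + 1 - k : ℕ) : ℂ) * A.h) = q₈ at *
  -- The ratio is split into products over the index `i` (`hp`) and single sigma values (`hq`). Only
  -- these are cancelled; the factors common to both sides remain as atoms and need no nonvanishing.
  have hp : p₇ / p₆ / (p₃ / p₁) * (p₆ / p₅) * (p₅ / p₇) * (p₉ / p₂) * (p₈ / p₄) =
      p₁ * p₉ / (p₃ * p₂) / p₄ * p₈ := by field_simp
  have hq : q₈ * q₅ / q₆ / (q₃ * q₇ / q₆) * (q₃ / q₁ * (q₁ / q₅) * (q₇ / q₈)) =
      q₂ / q₀ * (q₀ / q₂) := by field_simp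
  have hG := congrArg₂ (fun y y' => A.delta σ x * A.pairs σ x / A.epsSub σ N x *
    (sigmaPoch σ A.h (A.α - N * A.h) k * sigmaPoch σ A.h (-(N * A.h)) k * A.eps σ N k /
      sigmaPoch σ A.h (A.α + A.h) k) * (A.numer σ x * A.numerPole σ N x /
      (A.denomPole σ x * A.denom σ x)) / A.parityDenom σ N k * (y * y')) hp hq
  refine Eq.trans ?_ (hG.trans ?_)
  · simp only [div_eq_mul_inv, mul_inv, inv_inv, inv_neg]
    ring
  · ring

/-- After the shift the partial fraction weight replaces the factors `σ (A.shift x l + A.h - A.shift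
x j)` coming from `delta` and removes the new factors of `denom`. What depends on `l` is then
exactly the `l`-th term of the second summation identity with extra variable `poleV`. -/
theorem fracTerm_mul_summand (hσ : IsSigma σ) (hA : A.Generic σ M) {N : ℕ} (hN : N + 1 ≤ M)
    {x : Fin n → ℕ} (hx : ∑ i, x i ≤ N) (l : Fin n) :
    A.fracTerm σ (N + 1) (x + Pi.single l 1) l / -A.fracTermV σ (N + 1) (x + Pi.single l 1) *
        A.summand σ (N + 1) (x + Pi.single l 1) =
      A.summand σ N x * (A.stepFactor σ N x *
        ((∏ j ∈ univ.erase l, σ (A.shift x l + A.shift x j) / σ (A.shift x l - A.shift x j)) *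
          (σ (A.shift x l + A.poleV (N + 1)) / σ (A.shift x l - A.poleV (N + 1))) *
          A.stepQuad σ N (∑ i, x i) (A.shift x l))) := by
  obtain ⟨k, hk⟩ : ∃ k, k = ∑ i, x i := ⟨_, rfl⟩
  rw [fracTerm, fracTermV, summand, summand, stepFactor, stepQuad, sum_add_single, ← hk]
  rw [← hk] at hx
  have w1 : ∀ j ∈ univ.erase l, A.shift (x + Pi.single l 1) j = A.shift x j :=
    fun j hj => shift_add_single_of_ne x (ne_of_mem_erase hj)
  have w2 : ∏ j ∈ univ.erase l, σ (A.shift (x + Pi.single l 1) l -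
      A.shift (x + Pi.single l 1) j) =
      ∏ j ∈ univ.erase l, σ (A.shift x l + A.h - A.shift x j) :=
    prod_congr rfl fun j hj => by rw [w1 j hj, shift_add_single_self]
  have w3 : ∏ j, σ (A.poleV (N + 1) - A.shift (x + Pi.single l 1) j) =
      σ (A.poleV (N + 1) - (A.shift x l + A.h)) *
        ∏ j ∈ univ.erase l, σ (A.poleV (N + 1) - A.shift x j) := by
    rw [← mul_prod_erase _ _ (mem_univ l), shift_add_single_self]
    congr 1
    exact prod_congr rfl fun j hj => by rw [w1 j hj]
  rw [w2, w3, shift_add_single_self, ← mul_prod_erase univ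
    (fun i => σ (A.poleV (N + 1) - A.shift x i)) (mem_univ l), ← mul_prod_erase univ
    (fun i => σ (A.poleV (N + 1) + A.shift x i)) (mem_univ l), prod_div_distrib]
  have v1 : ∏ j ∈ univ.erase l, σ (A.poleV (N + 1) - A.shift x j) ≠ 0 :=
    prod_ne_zero_iff.2 fun j _ => hA.poleV_sub x _ j
  have v2 : ∏ j ∈ univ.erase l, σ (A.poleV (N + 1) + A.shift x j) ≠ 0 :=
    prod_ne_zero_iff.2 fun j _ => hA.poleV_add x _ j
  have v3 := prod_poleV_sub_ne_zero hA (N + 1) 0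
  rw [shift_zero] at v3
  have v4 := prod_parity_ne_zero hA N
  have v5 := prod_eps_ne_zero hA N
  have v6 : ∏ j, σ (A.shift x l + A.h - A.z j) ≠ 0 := by
    refine prod_ne_zero_iff.2 fun j _ => ?_
    have hxl := le_sum x l
    rcases eq_or_ne l j with rfl | hj
    · convert hA.nat (x l + 1) (by omega) (by omega) using 2
      simp only [shift]
      push_cast
      ring
    · convert hA.sub l j hj (x l + 1) (by rw [abs_le]; omega) using 2
      simp only [shift]
      push_cast
      ring
  have v7 : ∏ j ∈ univ.erase l, σ (A.shift x l + A.h - A.shift x j) ≠ 0 := by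
    refine prod_ne_zero_iff.2 fun j hj => ?_
    have hxl := le_sum x l
    have hxj := le_sum x j
    convert hA.sub l j (ne_of_mem_erase hj).symm (x l + 1 - x j) (by rw [abs_le]; omega) using 2
    simp only [shift]
    push_cast
    ring
  have a0 : σ (A.α - N * A.h) ≠ 0 := hA.alpha_ne (-N) (by push_cast; ring)
  have a1 : σ (A.α - N * A.h - A.h) ≠ 0 := hA.alpha_ne (-N - 1) (by push_cast; ring)
  have a2 : σ (A.α - N * A.h + 2 * (k : ℂ) * A.h) ≠ 0 :=
    hA.alpha_ne (2 * k - N) (by push_cast; ring)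
  have a3 : σ (A.α - N * A.h + (2 * k + 1) * A.h) ≠ 0 :=
    hA.alpha_ne (2 * k - N + 1) (by push_cast; ring)
  have a4 : σ (A.α + A.h + k * A.h) ≠ 0 := hA.alpha_ne (k + 1) (by push_cast; ring)
  have b1 : σ (((N + 1 : ℕ) : ℂ) * A.h) ≠ 0 := hA.nat (N + 1) (by omega) hN
  have s1 : σ (A.poleU (N + 1) k - A.shift x l) ≠ 0 := hA.poleU_sub x _ _ l
  have s2 : σ (A.poleV (N + 1) - A.shift x l) ≠ 0 := hA.poleV_sub x _ l
  have s3 : σ (A.poleV (N + 1) + A.shift x l) ≠ 0 := hA.poleV_add x _ l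
  have s4 : σ (A.poleV (N + 1) - (A.shift x l + A.h)) ≠ 0 := by
    have := hA.poleV_sub (x + Pi.single l 1) (N + 1) l
    rwa [shift_add_single_self] at this
  have s5 : σ (A.shift x l + A.h - A.zeroT) ≠ 0 := by
    refine hσ.ne_zero_comm ?_
    convert hA.pole_sub l (-(x l : ℤ) - 1) using 2
    simp only [shift, zeroT]
    push_cast
    ring
  have e1 : σ (A.shift x l + A.h - A.poleU (N + 1) (k + 1)) =
      -σ (A.poleU (N + 1) k - A.shift x l) := by
    rw [poleU_succ_succ, add_sub_add_right_eq_sub, hσ.sub_comm]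
  have e2 : σ (A.shift x l + (A.h - A.zeroS (N + 1) (k + 1))) =
      σ (A.shift x l + A.h - A.zeroS (N + 1) (k + 1)) := by
    rw [add_sub_assoc]
  have e3 : σ (A.poleV (N + 1) - A.poleU (N + 1) (k + 1)) = -σ (A.α + A.h + k * A.h) := by
    rw [← hσ.odd]
    congr 1
    simp only [poleU, poleV]
    push_cast
    ring
  have e4 : σ (A.poleV (N + 1) - A.zeroS (N + 1) (k + 1)) =
      -σ (A.α - N * A.h + (2 * k + 1) * A.h) := by
    rw [← hσ.odd]
    congr 1
    simp only [poleV, zeroS]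
    push_cast
    ring
  have e5 : σ (A.α - N * A.h - A.h + 2 * (k + 1 : ℕ) * A.h) =
      σ (A.α - N * A.h + (2 * k + 1) * A.h) := by
    congr 1
    push_cast
    ring
  have e6 : σ (A.poleV (N + 1) - A.zeroT) = -σ (((N + 1 : ℕ) : ℂ) * A.h) := by
    rw [← hσ.odd]
    congr 1
    simp only [poleV, zeroT]
    ring
  have e7 : A.α - (N + 1 : ℕ) * A.h = A.α - N * A.h - A.h := by
    push_cast
    ring
  have f1 := eq_div_of_mul_eq s1 (hk ▸ A.epsSub_succ_add_single (σ := σ) N x l)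
  have f3 := eq_div_of_mul_eq v2 (A.numerPole_succ_add_single (σ := σ) N x l)
  have f6 : sigmaPoch σ A.h (-((N + 1 : ℕ) * A.h)) (k + 1) =
      -σ (((N + 1 : ℕ) : ℂ) * A.h) * sigmaPoch σ A.h (-(N * A.h)) k := by
    have h := sigmaPoch_succ' σ A.h (-(N * A.h)) k
    rw [show -(N * A.h) - A.h = -(((N + 1 : ℕ) : ℂ) * A.h) by push_cast; ring, hσ.odd] at h
    exact h
  rw [delta_add_single hσ hA (by omega), pairs_add_single, numer_add_single, denomPole_add_single,
    denom_add_single, f1, f3, eps_succ_succ, parityDenom_succ_succ, f6, e7, sigmaPoch_succ',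
    sigmaPoch_succ _ _ (A.α + A.h), e1, e2, e3, e4, e5, e6, prod_div_distrib,
    hσ.sub_comm (A.shift x l + A.h) (A.poleV (N + 1)), hσ.sub_comm (A.shift x l) (A.poleV (N + 1)),
    add_comm (A.shift x l) (A.poleV (N + 1))]
  clear f1 f3 f6 e1 e2 e3 e4 e5 e6 e7 w1 w2 w3
  generalize ∏ j ∈ univ.erase l, σ (A.poleV (N + 1) - A.shift x j) = p₁,
    ∏ j ∈ univ.erase l, σ (A.poleV (N + 1) + A.shift x j) = p₂,
    ∏ i, σ (A.poleV (N + 1) - A.z i) = p₃,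
    ∏ i, σ (A.r i - (N + 1) * A.h) = p₄, ∏ i, σ (A.ε - (N + 1) * A.h - A.z i) = p₅,
    ∏ j, σ (A.shift x l + A.h - A.z j) = p₆,
    ∏ j ∈ univ.erase l, σ (A.shift x l + A.h - A.shift x j) = p₇,
    ∏ i, σ (A.poleV (N + 1) + A.z i) = p₉,
    ∏ j ∈ univ.erase l, σ (A.shift x l + A.shift x j) = p₁₀,
    ∏ j ∈ univ.erase l, σ (A.shift x l - A.shift x j) = p₁₁,
    σ (A.α - N * A.h) = q₀,
    σ (A.α - N * A.h - A.h) = q₁, σ (A.α - N * A.h + 2 * (k : ℂ) * A.h) = q₂,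
    σ (A.α - N * A.h + (2 * k + 1) * A.h) = q₃, σ (A.α + A.h + k * A.h) = q₄,
    σ (((N + 1 : ℕ) : ℂ) * A.h) = q₇, σ (A.poleU (N + 1) k - A.shift x l) = t₁,
    σ (A.poleV (N + 1) - A.shift x l) = t₂, σ (A.poleV (N + 1) + A.shift x l) = t₃,
    σ (A.poleV (N + 1) - (A.shift x l + A.h)) = t₄, σ (A.shift x l + A.h - A.zeroT) = t₅,
    σ (A.shift x l + A.h - A.zeroS (N + 1) (k + 1)) = t₆ at *
  have hp : p₆ / p₇ / (p₃ / p₁) * (p₇ / p₁₁) * (p₁₀ / p₅ * p₅) * (p₉ / p₂ / p₆) / p₄ =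
      p₁ * p₉ / (p₃ * p₂) / p₄ * (p₁₀ / p₁₁) := by field_simp
  have hq : t₆ * t₅ / (t₁ * t₄) / (q₃ * q₇ / (t₄ * q₄)) * (q₃ / q₁ * (t₁ * q₁ * -q₇) / q₄ / t₅) =
      q₂ / q₀ * (q₀ / q₂) * (t₂ / t₃ * (t₃ / -t₂) * t₆) := by field_simp
  have hG := congrArg₂ (fun y y' => A.delta σ x * A.pairs σ x / A.epsSub σ N x *
    (sigmaPoch σ A.h (A.α - N * A.h) k * sigmaPoch σ A.h (-(N * A.h)) k * A.eps σ N k /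
      sigmaPoch σ A.h (A.α + A.h) k) * (A.numer σ x * A.numerPole σ N x /
      (A.denomPole σ x * A.denom σ x)) / A.parityDenom σ N k *
    (σ (A.shift x l + A.b) * σ (A.shift x l + A.c) * σ (A.shift x l + A.d)) * (y * y')) hp hq
  refine Eq.trans ?_ (hG.trans ?_)
  · simp only [div_eq_mul_inv, mul_inv, inv_inv, inv_neg]
    ring
  · simp only [div_eq_mul_inv, mul_inv, inv_neg]
    ring

/-- The summation formula for generic parameters, in additive notation. -/
theorem sum_summand_eq (hσ : IsSigma σ) (hA : A.Generic σ M) (hA' : A.Balanced σ) {N : ℕ}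
    (hN : N ≤ M) :
    ∑ x ∈ indexSimplex n N, A.summand σ N x = ∏ j ∈ range N, A.valueRatio σ j := by
  induction N with
  | zero =>
    have h0 : indexSimplex n 0 = {0} := by
      ext x
      simp [mem_indexSimplex, funext_iff]
    have hα : σ A.α ≠ 0 := hA.alpha_ne 0 (by simp)
    have hd : A.delta σ 0 = 1 := by
      refine prod_eq_one fun i _ => prod_eq_one fun j hj => ?_
      have := hA.sub j i (mem_Ioi.1 hj).ne' 0 (by simp)
      simp only [Int.cast_zero, zero_mul, add_zero] at this
      simp [this]
    simp [h0, summand, hd, hα, pairs, epsSub, eps, numer, numerPole, denomPole, denom,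
      parityDenom, sigmaPoch]
  | succ N ih =>
    -- Insert the partition of unity into the sum for `N + 1`.
    have h1 : ∑ x ∈ indexSimplex n (N + 1), A.summand σ (N + 1) x =
        ∑ l, ∑ x ∈ indexSimplex n (N + 1), A.fracTerm σ (N + 1) x l / -A.fracTermV σ (N + 1) x *
          A.summand σ (N + 1) x + ∑ x ∈ indexSimplex n (N + 1),
          A.fracTermU σ (N + 1) x / -A.fracTermV σ (N + 1) x * A.summand σ (N + 1) x := by
      rw [sum_comm, ← sum_add_distrib]
      refine sum_congr rfl fun x hx => ?_
      rw [← sum_mul, ← add_mul, sum_fracTerm hσ hA hN (by omega) (mem_indexSimplex.1 hx), one_mul]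
    -- The vanishing on the faces `|x| = N + 1` and `x l = 0` brings every piece to a sum over `|x|
    -- ≤ N`.
    rw [h1, sum_indexSimplex_succ_of_eq_zero _ fun x hx => by
      rw [fracTermU_eq_zero hσ hx, zero_div, zero_mul]]
    rw [sum_congr rfl fun l _ => sum_indexSimplex_succ l _ fun x hx => by
      rw [fracTerm_eq_zero hσ hx, zero_div, zero_mul]]
    rw [sum_comm, ← sum_add_distrib, prod_range_succ, ← ih (by omega), sum_mul]
    refine sum_congr rfl fun x hx => ?_
    rw [mem_indexSimplex] at hx
    rw [sum_congr rfl fun l _ => fracTerm_mul_summand hσ hA hN hx l,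
      fracTermU_mul_summand hσ hA hN hx, ← mul_sum, ← mul_sum, ← mul_add, ← mul_add,
      valueRatio_eq hσ hA N x]
    -- The `n` shifted terms and the `poleV` term add up to `parityProd` for `n + 1` variables,
    -- which by `Balanced` is minus the product in the `poleU` term. Hence the shifted terms and the
    -- `poleU` term together equal minus the `poleV` term, that is, `valueRatio` after
    -- multiplication by `stepFactor`.
    have h2 := hσ.sum_prod_mul_div_add_eq (A.shift x) (A.poleV (N + 1))
      (A.h - A.zeroS (N + 1) (∑ i, x i + 1)) A.b A.c A.d (by
        rw [sum_shift]
        simp only [poleV, zeroS]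
        push_cast
        linear_combination -hA'.sum_eq) (fun i j hij => hA.shift_sub (by omega) hij)
      (hA.poleV_sub x (N + 1))
    rw [sum_shift, hA'.parityProd_eq] at h2
    simp only [stepQuad]
    linear_combination A.summand σ N x * A.stepFactor σ N x * h2

end JacksonParams

/-! ### The parity dependent arguments and the balancing condition. -/

namespace JacksonParams

variable {n : ℕ}

/-- The arguments of the parity dependent factors; here `ζ = z_1 + ⋯ + z_n`. -/
def parityArgs (n : ℕ) (h α ε b c d ζ : ℂ) : Fin 4 → ℂ :=
  if Odd n then ![ε + ζ - α, α + h - b - ζ, α + h - c - ζ, α + h - d - ζ]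
  else ![α + h - ζ, α + h - c - d - ζ, α + h - b - d - ζ, α + h - b - c - ζ]

/-- The relations between the parameters of the summation formula. -/
structure Compatible (A : JacksonParams n) : Prop where
  sum_eq : 2 * A.α + A.h = A.b + A.c + A.d + A.ε + 2 * ∑ i, A.z i
  r_eq : A.r = parityArgs n A.h A.α A.ε A.b A.c A.d (∑ i, A.z i)

variable {A : JacksonParams n}

/-- `parityProd` is taken with `n + 1` variables, so its odd case belongs to even `n`. Matching the
four arguments reverses one sign for even `n` and three for odd `n`, so the total sign is -1 in both
cases. -/
theorem Compatible.balanced {σ : ℂ → ℂ} (hσ : IsSigma σ) (hA : A.Compatible) : A.Balanced σ := by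
  refine ⟨hA.sum_eq, fun N k => ?_⟩
  have hs := hA.sum_eq
  rw [hA.r_eq, Fin.prod_univ_four, IsSigma.parityProd, parityArgs]
  rcases Nat.even_or_odd n with h | h
  · rw [if_pos h.add_one, if_neg (Nat.not_odd_iff_even.2 h)]
    simp only [Matrix.cons_val]
    have e0 : ∑ i, A.z i + k * A.h + A.poleV (N + 1) + (A.h - A.zeroS (N + 1) (k + 1)) =
        -(A.α + A.h - ∑ i, A.z i + ((k : ℂ) - N - 1) * A.h) := by
      simp only [poleV, zeroS]
      push_cast
      ring
    have e1 : ∑ i, A.z i + k * A.h + A.poleV (N + 1) + A.b =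
        A.α + A.h - A.c - A.d - ∑ i, A.z i + ((k : ℂ) - N - 1) * A.h := by
      simp only [poleV]
      push_cast
      linear_combination -hs
    have e2 : ∑ i, A.z i + k * A.h + A.poleV (N + 1) + A.c =
        A.α + A.h - A.b - A.d - ∑ i, A.z i + ((k : ℂ) - N - 1) * A.h := by
      simp only [poleV]
      push_cast
      linear_combination -hs
    have e3 : ∑ i, A.z i + k * A.h + A.poleV (N + 1) + A.d =
        A.α + A.h - A.b - A.c - ∑ i, A.z i + ((k : ℂ) - N - 1) * A.h := by
      simp only [poleV]
      push_cast
      linear_combination -hs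
    rw [e0, e1, e2, e3, hσ.odd]
    ring
  · rw [if_neg (Nat.not_odd_iff_even.2 h.add_one), if_pos h]
    simp only [Matrix.cons_val]
    have e0 : ∑ i, A.z i + k * A.h + A.poleV (N + 1) =
        A.ε + ∑ i, A.z i - A.α + ((k : ℂ) - N - 1) * A.h := by
      simp only [poleV]
      push_cast
      ring
    have e1 : ∀ b, ∑ i, A.z i + k * A.h + A.poleV (N + 1) + (A.h - A.zeroS (N + 1) (k + 1)) + b =
        -(A.α + A.h - b - ∑ i, A.z i + ((k : ℂ) - N - 1) * A.h) := by
      intro b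
      simp only [poleV, zeroS]
      push_cast
      ring
    rw [e1, e1, e1, e0, hσ.odd, hσ.odd, hσ.odd]
    ring

/-- Both parities give the same sum, so the exponential factor of the parity dependent denominator
needs no case distinction. -/
theorem Compatible.sum_r (hA : A.Compatible) : ∑ i, A.r i = 2 * A.h + 2 * A.ε := by
  rw [hA.r_eq, Fin.sum_univ_four, parityArgs]
  split_ifs
  · simp only [Matrix.cons_val]
    linear_combination hA.sum_eq
  · simp only [Matrix.cons_val]
    linear_combination 2 * hA.sum_eq

end JacksonParams

/-! ### From theta to sigma: the exponential factors of the summand. -/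

/-- The logarithm of the quotient of `ellPoch` and `sigmaPoch`. -/
noncomputable def pochExponent (h u k : ℂ) : ℂ := (k * u + h * (k * (k - 1) / 2)) / 2

theorem ellPoch_exp (p h u : ℂ) (k : ℕ) : ellPoch p (Complex.exp h) (Complex.exp u) k =
    Complex.exp (pochExponent h u k) * sigmaPoch (thetaSigma p) h u k := by
  induction k with
  | zero => simp [ellPoch, sigmaPoch, pochExponent]
  | succ k ih =>
    rw [ellPoch, prod_range_succ, ← ellPoch, ih, sigmaPoch_succ, ← Complex.exp_nat_mul,
      ← Complex.exp_add, ellTheta_exp, add_comm (k * h) u, mul_mul_mul_comm, ← Complex.exp_add]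
    congr 2
    simp only [pochExponent]
    push_cast
    ring

theorem prod_exp_mul {ι : Type*} (s : Finset ι) {F f G : ι → ℂ}
    (h : ∀ i ∈ s, F i = Complex.exp (f i) * G i) :
    ∏ i ∈ s, F i = Complex.exp (∑ i ∈ s, f i) * ∏ i ∈ s, G i := by
  rw [Complex.exp_sum, ← prod_mul_distrib]
  exact prod_congr rfl h

theorem two_mul_sum_Ioi {n : ℕ} {f : Fin n → Fin n → ℂ} (hf : ∀ i j, f i j = f j i) :
    2 * ∑ i, ∑ j ∈ Ioi i, f i j = ∑ i, ∑ j, f i j - ∑ i, f i i := by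
  have h1 : ∑ i, ∑ j, f i j =
      ∑ i, ∑ j ∈ Ioi i, f i j + (∑ i, ∑ j ∈ Iio i, f i j + ∑ i, f i i) := by
    rw [← sum_add_distrib, ← sum_add_distrib]
    refine sum_congr rfl fun i _ => ?_
    rw [← sum_erase_add _ _ (mem_univ i), ← add_assoc]
    congr 1
    rw [← sum_union]
    · refine sum_congr ?_ fun _ _ => rfl
      ext j
      simp [lt_or_lt_iff_ne, ne_comm]
    · rw [disjoint_left]
      intro j hj hj'
      exact lt_asymm (mem_Ioi.1 hj) (mem_Iio.1 hj')
  have h2 : ∑ i, ∑ j ∈ Iio i, f i j = ∑ i, ∑ j ∈ Ioi i, f i j := by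
    rw [sum_comm' (t' := univ) (s' := fun j => Ioi j) (by simp)]
    exact sum_congr rfl fun i _ => sum_congr rfl fun j _ => hf j i
  rw [h1, h2]
  ring

/-- Normal form for the exponents: every sum over `i` is expressed through `∑ z_i`, `|x|`, `∑ x_i
z_i` and `∑ x_i^2`, after which exponents can be compared as polynomials. Zero coefficients below
are padding that matches this shape. -/
theorem sum_quadratic {n : ℕ} (x : Fin n → ℕ) (z : Fin n → ℂ) (c₀ c₁ c₂ c₃ c₄ : ℂ) :
    ∑ i, (c₀ + c₁ * z i + c₂ * x i + c₃ * (x i * z i) + c₄ * (x i) ^ 2) =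
      n * c₀ + c₁ * ∑ i, z i + c₂ * (∑ i, x i : ℕ) + c₃ * ∑ i, x i * z i +
        c₄ * ∑ i, (x i : ℂ) ^ 2 := by
  simp only [sum_add_distrib, ← mul_sum]
  simp

namespace JacksonParams

variable {n : ℕ} (A : JacksonParams n) (p : ℂ)

theorem sum_linear (z : Fin n → ℂ) (c₀ c₁ : ℂ) :
    ∑ i, (c₀ + c₁ * z i) = n * c₀ + c₁ * ∑ i, z i := by
  rw [sum_add_distrib, ← mul_sum]
  simp

theorem ellDelta_exp (x : Fin n → ℕ) :
    ellDelta p (Complex.exp A.h) (fun i => Complex.exp (A.z i)) x =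
      Complex.exp ((n - 1) * (∑ i, x i : ℕ) * A.h / 2) * A.delta (thetaSigma p) x := by
  have h1 : ellDelta p (Complex.exp A.h) (fun i => Complex.exp (A.z i)) x =
      Complex.exp (∑ i, ∑ j ∈ Ioi i, (x i + x j) * A.h / 2) * A.delta (thetaSigma p) x := by
    refine prod_exp_mul _ fun i _ => prod_exp_mul _ fun j _ => ?_
    rw [← Complex.exp_sub, ← Complex.exp_int_mul, ← Complex.exp_add, ← Complex.exp_nat_mul,
      ellTheta_exp, ellTheta_exp, show ((((x j : ℤ) - x i : ℤ) : ℂ) * A.h + (A.z j - A.z i)) =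
        A.z j - A.z i + ((x j : ℂ) - x i) * A.h by push_cast; ring, ← mul_assoc,
      ← Complex.exp_add, mul_div_mul_comm, ← Complex.exp_sub]
    congr 2
    ring
  have h2 := two_mul_sum_Ioi (f := fun i j => ((x i : ℂ) + x j) * A.h / 2)
    fun i j => by ring
  have h3 : ∀ i, ∑ j, ((x i : ℂ) + x j) * A.h / 2 =
      n * (x i * A.h / 2) + A.h / 2 * (∑ i, x i : ℕ) := by
    intro i
    rw [sum_congr rfl fun j _ => show ((x i : ℂ) + x j) * A.h / 2 = x i * A.h / 2 + 0 * A.z j +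
      A.h / 2 * x j + 0 * (x j * A.z j) + 0 * (x j : ℂ) ^ 2 by ring, sum_quadratic]
    ring
  rw [h1]
  congr 2
  rw [sum_congr rfl fun i _ => h3 i, sum_congr rfl fun i _ => show n * ((x i : ℂ) * A.h / 2) +
    A.h / 2 * (∑ i, x i : ℕ) = A.h / 2 * (∑ i, x i : ℕ) + 0 * A.z i + (n * A.h / 2) * x i +
    0 * (x i * A.z i) + 0 * (x i : ℂ) ^ 2 by ring, sum_quadratic,
    sum_congr rfl fun i _ => show ((x i : ℂ) + x i) * A.h / 2 = 0 + 0 * A.z i + A.h * x i +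
    0 * (x i * A.z i) + 0 * (x i : ℂ) ^ 2 by ring, sum_quadratic] at h2
  linear_combination h2 / 2

theorem pairs_exp (x : Fin n → ℕ) :
    ∏ i, ∏ j ∈ Ioi i, ellPoch p (Complex.exp A.h) (Complex.exp (A.z i) * Complex.exp (A.z j))
        (x i + x j) =
      Complex.exp (((n - 2) * ∑ i, x i * A.z i + (∑ i, x i : ℕ) * ∑ i, A.z i + A.h / 2 *
        ((n - 2) * ∑ i, (x i : ℂ) ^ 2 + (∑ i, x i : ℕ) ^ 2 - (n - 1) * (∑ i, x i : ℕ))) / 2) *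
        A.pairs (thetaSigma p) x := by
  have h1 : ∏ i, ∏ j ∈ Ioi i, ellPoch p (Complex.exp A.h)
      (Complex.exp (A.z i) * Complex.exp (A.z j)) (x i + x j) =
      Complex.exp (∑ i, ∑ j ∈ Ioi i, pochExponent A.h (A.z i + A.z j) (x i + x j)) *
        A.pairs (thetaSigma p) x := by
    refine prod_exp_mul _ fun i _ => prod_exp_mul _ fun j _ => ?_
    rw [← Complex.exp_add, ellPoch_exp]
    push_cast
    rfl
  have h2 := two_mul_sum_Ioi (f := fun i j => pochExponent A.h (A.z i + A.z j) (x i + x j))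
    fun i j => by rw [add_comm (A.z i), add_comm (x i : ℂ)]
  have h3 : ∀ i, ∑ j, pochExponent A.h (A.z i + A.z j) (x i + x j) =
      n * ((x i * A.z i + A.h / 2 * ((x i : ℂ) ^ 2 - x i)) / 2) + x i / 2 * ∑ i, A.z i +
        (A.z i + A.h / 2 * (2 * x i - 1)) / 2 * (∑ i, x i : ℕ) + 1 / 2 * ∑ i, x i * A.z i +
        A.h / 4 * ∑ i, (x i : ℂ) ^ 2 := by
    intro i
    rw [← sum_quadratic]
    refine sum_congr rfl fun j _ => ?_
    simp only [pochExponent]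
    ring
  have h4 : ∑ i, (n * ((x i * A.z i + A.h / 2 * ((x i : ℂ) ^ 2 - x i)) / 2) +
      x i / 2 * ∑ i, A.z i +
        (A.z i + A.h / 2 * (2 * x i - 1)) / 2 * (∑ i, x i : ℕ) + 1 / 2 * ∑ i, x i * A.z i +
        A.h / 4 * ∑ i, (x i : ℂ) ^ 2) =
      n * (-A.h / 4 * (∑ i, x i : ℕ) + 1 / 2 * ∑ i, x i * A.z i +
        A.h / 4 * ∑ i, (x i : ℂ) ^ 2) + (∑ i, x i : ℕ) / 2 * ∑ i, A.z i +
        (-n * A.h / 4 + (∑ i, A.z i) / 2 + A.h / 2 * (∑ i, x i : ℕ)) * (∑ i, x i : ℕ) +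
        n / 2 * ∑ i, x i * A.z i + n * A.h / 4 * ∑ i, (x i : ℂ) ^ 2 := by
    rw [← sum_quadratic]
    refine sum_congr rfl fun i _ => ?_
    ring
  have h5 : ∑ i, pochExponent A.h (A.z i + A.z i) (x i + x i) =
      n * 0 + 0 * ∑ i, A.z i + (-A.h / 2) * (∑ i, x i : ℕ) + 2 * ∑ i, x i * A.z i +
        A.h * ∑ i, (x i : ℂ) ^ 2 := by
    rw [← sum_quadratic]
    refine sum_congr rfl fun i _ => ?_
    simp only [pochExponent]
    ring
  rw [sum_congr rfl fun i _ => h3 i, h4, h5] at h2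
  rw [h1]
  congr 2
  linear_combination h2 / 2

theorem epsSub_exp (N : ℕ) (x : Fin n → ℕ) :
    ∏ i, ellPoch p (Complex.exp A.h) (Complex.exp (A.ε - N * A.h) / Complex.exp (A.z i))
        (∑ j, x j - x i) =
      Complex.exp (n * (((∑ i, x i : ℕ) * (A.ε - N * A.h) + A.h / 2 *
        ((∑ i, x i : ℕ) ^ 2 - (∑ i, x i : ℕ))) / 2) + -(∑ i, x i : ℕ) / 2 * ∑ i, A.z i +
        (-(A.ε - N * A.h) + A.h / 2 * (1 - 2 * (∑ i, x i : ℕ))) / 2 * (∑ i, x i : ℕ) +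
        1 / 2 * ∑ i, x i * A.z i + A.h / 4 * ∑ i, (x i : ℂ) ^ 2) *
        A.epsSub (thetaSigma p) N x := by
  rw [← sum_quadratic]
  refine prod_exp_mul _ fun i _ => ?_
  rw [← Complex.exp_sub, ellPoch_exp, Nat.cast_sub (le_sum x i)]
  congr 2
  simp only [pochExponent]
  ring

theorem eps_exp (N k : ℕ) :
    ∏ i, ellPoch p (Complex.exp A.h) (Complex.exp (A.ε - N * A.h) / Complex.exp (A.z i)) k =
      Complex.exp (n * ((k * (A.ε - N * A.h) + A.h / 2 * ((k : ℂ) ^ 2 - k)) / 2) +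
        -k / 2 * ∑ i, A.z i) * A.eps (thetaSigma p) N k := by
  rw [← sum_linear]
  refine prod_exp_mul _ fun i _ => ?_
  rw [← Complex.exp_sub, ellPoch_exp]
  congr 2
  simp only [pochExponent]
  ring

theorem numer_mul_numerPole_exp (N : ℕ) (x : Fin n → ℕ) :
    ∏ i, (ellPoch p (Complex.exp A.h) (Complex.exp A.b * Complex.exp (A.z i)) (x i) *
        ellPoch p (Complex.exp A.h) (Complex.exp A.c * Complex.exp (A.z i)) (x i) *
        ellPoch p (Complex.exp A.h) (Complex.exp A.d * Complex.exp (A.z i)) (x i) *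
        ellPoch p (Complex.exp A.h) (Complex.exp A.h ^ (-(N : ℤ)) * Complex.exp (A.ε - N * A.h) *
          Complex.exp (A.z i) / Complex.exp (A.α - N * A.h)) (x i)) =
      Complex.exp (n * 0 + 0 * ∑ i, A.z i + (A.b + A.c + A.d + A.ε - A.α - N * A.h - 2 * A.h) / 2 *
        (∑ i, x i : ℕ) + 2 * ∑ i, x i * A.z i + A.h * ∑ i, (x i : ℂ) ^ 2) *
        (A.numer (thetaSigma p) x * A.numerPole (thetaSigma p) N x) := by
  rw [← sum_quadratic, numer, numerPole, ← prod_mul_distrib]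
  refine prod_exp_mul _ fun i _ => ?_
  rw [← Complex.exp_int_mul, ← Complex.exp_add, ← Complex.exp_add, ← Complex.exp_add,
    ← Complex.exp_add, ← Complex.exp_add, ← Complex.exp_sub,
    show ((-(N : ℤ) : ℤ) : ℂ) * A.h + (A.ε - N * A.h) + A.z i - (A.α - N * A.h) =
      A.ε - A.α + A.z i - N * A.h by push_cast; ring, ellPoch_exp, ellPoch_exp, ellPoch_exp,
    ellPoch_exp]
  rw [show A.b + A.c + A.d + A.ε - A.α - N * A.h - 2 * A.h =
    (A.b - A.h / 2) + (A.c - A.h / 2) + (A.d - A.h / 2) + (A.ε - A.α - N * A.h - A.h / 2) by ring]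
  rw [show (0 : ℂ) + 0 * A.z i + ((A.b - A.h / 2) + (A.c - A.h / 2) + (A.d - A.h / 2) +
      (A.ε - A.α - N * A.h - A.h / 2)) / 2 * x i + 2 * (x i * A.z i) + A.h * (x i : ℂ) ^ 2 =
      pochExponent A.h (A.b + A.z i) (x i) + pochExponent A.h (A.c + A.z i) (x i) +
      pochExponent A.h (A.d + A.z i) (x i) +
      pochExponent A.h (A.ε - A.α + A.z i - N * A.h) (x i) by simp only [pochExponent]; ring,
    Complex.exp_add, Complex.exp_add, Complex.exp_add]
  ring

theorem denomPole_mul_denom_exp (N : ℕ) (x : Fin n → ℕ) :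
    ∏ i, (ellPoch p (Complex.exp A.h) (Complex.exp (A.α - N * A.h) * Complex.exp A.h *
        Complex.exp (A.z i) / Complex.exp (A.ε - N * A.h)) (x i) *
        ∏ j, ellPoch p (Complex.exp A.h) (Complex.exp A.h * Complex.exp (A.z i) /
          Complex.exp (A.z j)) (x i)) =
      Complex.exp (n * 0 + 0 * ∑ i, A.z i + (A.α - A.ε + A.h / 2 + n * A.h / 2 - ∑ i, A.z i) / 2 *
        (∑ i, x i : ℕ) + (n + 1) / 2 * ∑ i, x i * A.z i +
        (n + 1) * A.h / 4 * ∑ i, (x i : ℂ) ^ 2) *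
        (A.denomPole (thetaSigma p) x * A.denom (thetaSigma p) x) := by
  rw [← sum_quadratic, denomPole, denom, ← prod_mul_distrib]
  refine prod_exp_mul _ fun i _ => ?_
  have h1 : ∏ j, ellPoch p (Complex.exp A.h) (Complex.exp A.h * Complex.exp (A.z i) /
      Complex.exp (A.z j)) (x i) = Complex.exp (∑ j, pochExponent A.h (A.h + A.z i - A.z j) (x i)) *
      ∏ j, sigmaPoch (thetaSigma p) A.h (A.h + A.z i - A.z j) (x i) := by
    refine prod_exp_mul _ fun j _ => ?_
    rw [← Complex.exp_add, ← Complex.exp_sub, ellPoch_exp]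
  have h2 : ∑ j, pochExponent A.h (A.h + A.z i - A.z j) (x i) =
      n * ((x i * (A.h + A.z i) + A.h / 2 * ((x i : ℂ) ^ 2 - x i)) / 2) +
        -(x i) / 2 * ∑ i, A.z i := by
    rw [← sum_linear]
    refine sum_congr rfl fun j _ => ?_
    simp only [pochExponent]
    ring
  rw [h1, h2, ← Complex.exp_add, ← Complex.exp_add, ← Complex.exp_sub,
    show A.α - N * A.h + A.h + A.z i - (A.ε - N * A.h) = A.α - A.ε + A.h + A.z i by ring,
    ellPoch_exp, mul_mul_mul_comm, ← Complex.exp_add]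
  congr 2
  simp only [pochExponent]
  ring

theorem paritySummandFactor_exp (hA : A.Compatible) (N k : ℕ) :
    paritySummandFactor p (Complex.exp A.h) (Complex.exp (A.α - N * A.h)) (Complex.exp A.b)
        (Complex.exp A.c) (Complex.exp A.d) (Complex.exp (A.ε - N * A.h))
        (∏ i, Complex.exp (A.z i)) n N k =
      1 / (Complex.exp ((k * (2 * A.h + 2 * A.ε - 4 * N * A.h) + 2 * A.h * ((k : ℂ) ^ 2 - k)) / 2) *
        A.parityDenom (thetaSigma p) N k) := by
  have h1 : ∏ i, (Complex.exp (pochExponent A.h (A.r i - N * A.h) k) *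
      sigmaPoch (thetaSigma p) A.h (A.r i - N * A.h) k) =
      Complex.exp ((k * (2 * A.h + 2 * A.ε - 4 * N * A.h) + 2 * A.h * ((k : ℂ) ^ 2 - k)) / 2) *
        A.parityDenom (thetaSigma p) N k := by
    rw [prod_mul_distrib, ← Complex.exp_sum, parityDenom]
    congr 2
    have := hA.sum_r
    rw [Fin.sum_univ_four] at this ⊢
    simp only [pochExponent]
    linear_combination k / 2 * this
  rw [← h1, Fin.prod_univ_four, paritySummandFactor, hA.r_eq, parityArgs, ← Complex.exp_sum]
  split_ifs
  · have e : ∀ b, Complex.exp (A.α - N * A.h) * Complex.exp A.h /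
        (Complex.exp b * Complex.exp (∑ i, A.z i)) =
        Complex.exp (A.α + A.h - b - ∑ i, A.z i - N * A.h) := by
      intro b
      rw [← Complex.exp_add, ← Complex.exp_add, ← Complex.exp_sub]
      ring_nf
    have e' : Complex.exp A.h ^ (-(N : ℤ)) * Complex.exp (A.ε - N * A.h) *
        Complex.exp (∑ i, A.z i) / Complex.exp (A.α - N * A.h) =
        Complex.exp (A.ε + ∑ i, A.z i - A.α - N * A.h) := by
      rw [← Complex.exp_int_mul, ← Complex.exp_add, ← Complex.exp_add, ← Complex.exp_sub]
      push_cast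
      ring_nf
    simp only [Matrix.cons_val, ← ellPoch_exp, e, e']
  · have e : Complex.exp (A.α - N * A.h) * Complex.exp A.h / Complex.exp (∑ i, A.z i) =
        Complex.exp (A.α + A.h - ∑ i, A.z i - N * A.h) := by
      rw [← Complex.exp_add, ← Complex.exp_sub]
      ring_nf
    have e' : ∀ b c, Complex.exp (A.α - N * A.h) * Complex.exp A.h /
        (Complex.exp b * Complex.exp c * Complex.exp (∑ i, A.z i)) =
        Complex.exp (A.α + A.h - b - c - ∑ i, A.z i - N * A.h) := by
      intro b c
      rw [← Complex.exp_add, ← Complex.exp_add, ← Complex.exp_add, ← Complex.exp_sub]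
      ring_nf
    simp only [Matrix.cons_val, ← ellPoch_exp, e, e']
    ring

theorem mul_exp_collect {X₁ X₂ X₃ X₄ X₅ X₆ X₇ X₈ X₉ X₁₀ X₁₁ X₁₂ X₁₃ : ℂ}
    (h : X₁ + X₂ + X₄ + X₆ + X₇ + X₈ + X₁₀ + X₁₁ - X₃ - X₅ - X₉ - X₁₂ - X₁₃ = 0)
    (g₁ g₂ g₃ g₄ g₅ g₆ g₇ g₈ g₉ g₁₀ g₁₁ g₁₂ : ℂ) :
    Complex.exp X₁ * g₁ * (Complex.exp X₂ * g₂ / (Complex.exp X₃ * g₃)) *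
      (Complex.exp X₄ * g₄ / (Complex.exp X₅ * g₅)) *
      (Complex.exp X₆ * g₆ * (Complex.exp X₇ * g₇) * (Complex.exp X₈ * g₈) /
        (Complex.exp X₉ * g₉)) * Complex.exp X₁₀ *
      (Complex.exp X₁₁ * g₁₀ / (Complex.exp X₁₂ * g₁₁)) * (1 / (Complex.exp X₁₃ * g₁₂)) =
    g₁ * (g₂ / g₃) * (g₄ / g₅) * (g₆ * g₇ * g₈ / g₉) * (g₁₀ / g₁₁) / g₁₂ := by
  have hE : Complex.exp X₁ * Complex.exp X₂ * Complex.exp X₄ * Complex.exp X₆ * Complex.exp X₇ *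
      Complex.exp X₈ * Complex.exp X₁₀ * Complex.exp X₁₁ * Complex.exp (-X₃) *
      Complex.exp (-X₅) * Complex.exp (-X₉) * Complex.exp (-X₁₂) * Complex.exp (-X₁₃) = 1 := by
    simp only [← Complex.exp_add]
    rw [← Complex.exp_zero, ← h]
    congr 1
  simp only [div_eq_mul_inv, mul_inv, ← Complex.exp_neg, one_mul]
  linear_combination g₁ * (g₂ * g₃⁻¹) * (g₄ * g₅⁻¹) * (g₆ * g₇ * g₈ * g₉⁻¹) *
    (g₁₀ * g₁₁⁻¹) * g₁₂⁻¹ * hE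

/-- The terms in `∑ x_i z_i` and `∑ x_i^2` cancel identically among the exponents, and the rest is a
multiple of the balancing relation. -/
theorem jacksonSummand_exp (hA : A.Compatible) (N : ℕ) (x : Fin n → ℕ) :
    jacksonSummand p (Complex.exp A.h) (Complex.exp (A.α - N * A.h)) (Complex.exp A.b)
      (Complex.exp A.c) (Complex.exp A.d) (Complex.exp (A.ε - N * A.h))
      (fun i => Complex.exp (A.z i)) N x = A.summand (thetaSigma p) N x := by
  have e1 : Complex.exp (A.α - N * A.h) * Complex.exp A.h ^ (2 * ∑ i, x i) =
      Complex.exp (A.α - N * A.h + 2 * (∑ i, x i : ℕ) * A.h) := by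
    rw [← Complex.exp_nat_mul, ← Complex.exp_add]
    push_cast
    ring_nf
  have e2 : Complex.exp A.h ^ (-(N : ℤ)) = Complex.exp (-(N * A.h)) := by
    rw [← Complex.exp_int_mul]
    push_cast
    ring_nf
  have e3 : Complex.exp (A.α - N * A.h) * Complex.exp A.h ^ (N + 1) =
      Complex.exp (A.α + A.h) := by
    rw [← Complex.exp_nat_mul, ← Complex.exp_add]
    push_cast
    ring_nf
  have e4 : ellPoch p (Complex.exp A.h) (Complex.exp A.h ^ (-(N : ℤ))) (∑ i, x i) =
      Complex.exp (pochExponent A.h (-(N * A.h)) (∑ i, x i : ℕ)) *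
        sigmaPoch (thetaSigma p) A.h (-(N * A.h)) (∑ i, x i) := by
    rw [e2, ellPoch_exp]
  have hs := hA.sum_eq
  rw [jacksonSummand, ellDelta_exp, pairs_exp, epsSub_exp, eps_exp, prod_div_distrib,
    numer_mul_numerPole_exp, denomPole_mul_denom_exp, paritySummandFactor_exp A p hA, e1, e3, e4,
    ellTheta_exp, ellTheta_exp, ellPoch_exp, ellPoch_exp, ← Complex.exp_nat_mul, summand]
  refine mul_exp_collect ?_ _ _ _ _ _ _ _ _ _ _ _ _
  simp only [pochExponent]
  linear_combination (-((∑ i, x i : ℕ) : ℂ) / 2) * hs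

end JacksonParams

/-! ### The closed form as a product of one-step ratios. -/

/-- With `a q^N` and `e q^N` fixed, the bases of the closed form either move with `N` or do not.
Reading the first kind backwards, and using oddness for the second kind in `ellPoch_exp_neg`, gives
in both cases factors at `u - (j + 1) h`, as needed for a product over `j`. -/
theorem ellPoch_exp_reverse (p h u : ℂ) (N : ℕ) :
    ellPoch p (Complex.exp h) (Complex.exp (u - N * h)) N =
      Complex.exp (pochExponent h (u - N * h) N) *
        ∏ j ∈ range N, thetaSigma p (u - (j + 1) * h) := by
  rw [ellPoch_exp, sigmaPoch, ← prod_range_reflect]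
  congr 1
  refine prod_congr rfl fun j hj => ?_
  rw [Nat.cast_sub (by have := mem_range.1 hj; omega), Nat.cast_sub (by
    have := mem_range.1 hj; omega)]
  congr 1
  push_cast
  ring

theorem ellPoch_exp_neg {p : ℂ} (hp : ‖p‖ < 1) (h u : ℂ) (N : ℕ) :
    ellPoch p (Complex.exp h) (Complex.exp (h - u)) N =
      Complex.exp (pochExponent h (h - u) N) * ((-1) ^ N *
        ∏ j ∈ range N, thetaSigma p (u - (j + 1) * h)) := by
  rw [ellPoch_exp, sigmaPoch]
  congr 1
  conv_rhs => rw [← card_range N]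
  rw [← prod_const, card_range, ← prod_mul_distrib]
  refine prod_congr rfl fun j _ => ?_
  rw [neg_one_mul, ← (isSigma_thetaSigma hp).odd]
  congr 1
  ring

namespace JacksonParams

variable {n : ℕ} (A : JacksonParams n) {p : ℂ}

/-- Oddness is used for one factor when `n` is odd and for three when `n` is even, so the sign is
`(-1)^N` in both cases. For even `n` the balancing condition exchanges `aq / beZ` for an expression
in `c` and `d`, and similarly for the others; for odd `n` the factor `e^N` supplies the matching
exponent. -/
theorem parityValueFactor_exp (hp : ‖p‖ < 1) (hA : A.Compatible) (N : ℕ) :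
    parityValueFactor p (Complex.exp A.h) (Complex.exp (A.α - N * A.h)) (Complex.exp A.b)
        (Complex.exp A.c) (Complex.exp A.d) (Complex.exp (A.ε - N * A.h))
        (∏ i, Complex.exp (A.z i)) n N =
      Complex.exp (-(N * (4 * A.α + 4 * A.h - 3 * A.ε - N * A.h - 4 * ∑ i, A.z i - A.b - A.c - A.d)
        + 2 * A.h * (N * (N - 1))) / 2) *
        ((-1) ^ N / ∏ i, ∏ j ∈ range N, thetaSigma p (A.r i - (j + 1) * A.h)) := by
  have hs := hA.sum_eq
  have hone : ((-1 : ℂ) ^ N)⁻¹ = (-1) ^ N := by rw [← inv_pow]; norm_num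
  have hone' : ((-1 : ℂ) ^ N) * (-1) ^ N = 1 := by rw [← mul_pow]; norm_num
  rw [hA.r_eq, parityArgs, parityValueFactor, ← Complex.exp_sum, Fin.prod_univ_four]
  split_ifs
  · have e : ∀ b, Complex.exp (A.α - N * A.h) * Complex.exp A.h /
        (Complex.exp b * Complex.exp (∑ i, A.z i)) =
        Complex.exp (A.α + A.h - b - ∑ i, A.z i - N * A.h) := by
      intro b
      rw [← Complex.exp_add, ← Complex.exp_add, ← Complex.exp_sub]
      ring_nf
    have e' : Complex.exp (A.α - N * A.h) * Complex.exp A.h /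
        (Complex.exp (A.ε - N * A.h) * Complex.exp (∑ i, A.z i)) =
        Complex.exp (A.h - (A.ε + ∑ i, A.z i - A.α)) := by
      rw [← Complex.exp_add, ← Complex.exp_add, ← Complex.exp_sub]
      ring_nf
    rw [e']
    simp only [Matrix.cons_val, e, ellPoch_exp_reverse, ellPoch_exp_neg hp,
      ← Complex.exp_nat_mul]
    have hE : Complex.exp (N * (A.ε - N * A.h)) *
      Complex.exp (-pochExponent A.h (A.α + A.h - A.b - ∑ i, A.z i - N * A.h) N) *
      Complex.exp (-pochExponent A.h (A.α + A.h - A.c - ∑ i, A.z i - N * A.h) N) *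
      Complex.exp (-pochExponent A.h (A.α + A.h - A.d - ∑ i, A.z i - N * A.h) N) *
      Complex.exp (-pochExponent A.h (A.h - (A.ε + ∑ i, A.z i - A.α)) N) =
      Complex.exp (-(N * (4 * A.α + 4 * A.h - 3 * A.ε - N * A.h - 4 * ∑ i, A.z i - A.b - A.c - A.d)
        + 2 * A.h * (N * (N - 1))) / 2) := by
      simp only [← Complex.exp_add, pochExponent]
      congr 1
      ring
    rw [← hE]
    simp only [div_eq_mul_inv, mul_inv, ← Complex.exp_neg, hone]
    ring
  · have e : Complex.exp (A.α - N * A.h) * Complex.exp A.h / Complex.exp (∑ i, A.z i) =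
        Complex.exp (A.α + A.h - ∑ i, A.z i - N * A.h) := by
      rw [← Complex.exp_add, ← Complex.exp_sub]
      ring_nf
    have e' : ∀ b u, u = 2 * A.α + A.h - b - A.ε - 2 * ∑ i, A.z i →
        Complex.exp (A.α - N * A.h) * Complex.exp A.h /
        (Complex.exp b * Complex.exp (A.ε - N * A.h) * Complex.exp (∑ i, A.z i)) =
        Complex.exp (A.h - (A.α + A.h - u - ∑ i, A.z i)) := by
      intro b u hu
      rw [← Complex.exp_add, ← Complex.exp_add, ← Complex.exp_add, ← Complex.exp_sub]
      congr 1
      rw [hu]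
      ring
    rw [e' A.b (A.c + A.d) (by linear_combination -hs), e' A.c (A.b + A.d)
      (by linear_combination -hs), e' A.d (A.b + A.c) (by linear_combination -hs), e]
    simp only [Matrix.cons_val, ellPoch_exp_reverse, ellPoch_exp_neg hp, ← sub_sub]
    have hE : Complex.exp (-pochExponent A.h (A.α + A.h - ∑ i, A.z i - N * A.h) N) *
      Complex.exp (-pochExponent A.h (A.h - (A.α + A.h - A.c - A.d - ∑ i, A.z i)) N) *
      Complex.exp (-pochExponent A.h (A.h - (A.α + A.h - A.b - A.d - ∑ i, A.z i)) N) *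
      Complex.exp (-pochExponent A.h (A.h - (A.α + A.h - A.b - A.c - ∑ i, A.z i)) N) =
      Complex.exp (-(N * (4 * A.α + 4 * A.h - 3 * A.ε - N * A.h - 4 * ∑ i, A.z i - A.b - A.c - A.d)
        + 2 * A.h * (N * (N - 1))) / 2) := by
      simp only [← Complex.exp_add, pochExponent]
      congr 1
      linear_combination (3 * N / 2 : ℂ) * hs
    rw [← hE]
    simp only [div_eq_mul_inv, mul_inv, ← Complex.exp_neg, hone, one_mul]
    generalize (-1 : ℂ) ^ N = s at hone' ⊢
    linear_combination Complex.exp (-pochExponent A.h (A.α + A.h - ∑ i, A.z i - N * A.h) N) *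
      Complex.exp (-pochExponent A.h (A.h - (A.α + A.h - A.c - A.d - ∑ i, A.z i)) N) *
      Complex.exp (-pochExponent A.h (A.h - (A.α + A.h - A.b - A.d - ∑ i, A.z i)) N) *
      Complex.exp (-pochExponent A.h (A.h - (A.α + A.h - A.b - A.c - ∑ i, A.z i)) N) *
      (∏ j ∈ range N, thetaSigma p (A.α + A.h - ∑ i, A.z i - (j + 1) * A.h))⁻¹ *
      (∏ j ∈ range N, thetaSigma p (A.α + A.h - A.c - A.d - ∑ i, A.z i - (j + 1) * A.h))⁻¹ *
      (∏ j ∈ range N, thetaSigma p (A.α + A.h - A.b - A.d - ∑ i, A.z i - (j + 1) * A.h))⁻¹ *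
      (∏ j ∈ range N, thetaSigma p (A.α + A.h - A.b - A.c - ∑ i, A.z i - (j + 1) * A.h))⁻¹ *
      s * hone'

theorem prod_ellPoch_div_exp (hp : ‖p‖ < 1) (N : ℕ) :
    (∏ i, ellPoch p (Complex.exp A.h) (Complex.exp (A.α - N * A.h) * Complex.exp A.h /
        (Complex.exp (A.ε - N * A.h) * Complex.exp (A.z i))) N) /
      ∏ i, ellPoch p (Complex.exp A.h) (Complex.exp (A.α - N * A.h) * Complex.exp A.h *
        Complex.exp (A.z i) / Complex.exp (A.ε - N * A.h)) N =
      Complex.exp (n * 0 + -N * ∑ i, A.z i) * ∏ j ∈ range N, ∏ i,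
        thetaSigma p (A.poleV (j + 1) + A.z i) / thetaSigma p (A.poleV (j + 1) - A.z i) := by
  rw [← prod_div_distrib, prod_comm, ← sum_linear]
  refine prod_exp_mul _ fun i _ => ?_
  have e₁ : Complex.exp (A.α - N * A.h) * Complex.exp A.h /
      (Complex.exp (A.ε - N * A.h) * Complex.exp (A.z i)) =
      Complex.exp (A.h - (A.ε - A.α + A.z i)) := by
    rw [← Complex.exp_add, ← Complex.exp_add, ← Complex.exp_sub]
    ring_nf
  have e₂ : Complex.exp (A.α - N * A.h) * Complex.exp A.h * Complex.exp (A.z i) /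
      Complex.exp (A.ε - N * A.h) = Complex.exp (A.h - (A.ε - A.α - A.z i)) := by
    rw [← Complex.exp_add, ← Complex.exp_add, ← Complex.exp_sub]
    ring_nf
  rw [e₁, e₂, ellPoch_exp_neg hp, ellPoch_exp_neg hp, mul_div_mul_comm, ← Complex.exp_sub,
    mul_div_mul_left _ _ (pow_ne_zero N (neg_ne_zero.2 one_ne_zero)), prod_div_distrib]
  congr 1
  · congr 1
    simp only [pochExponent]
    ring
  · congr 1 <;> refine prod_congr rfl fun j _ => ?_ <;> congr 1 <;> simp only [poleV] <;>
      push_cast <;> ring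

theorem jacksonValue_exp (hp : ‖p‖ < 1) (hA : A.Compatible) (N : ℕ) :
    jacksonValue p (Complex.exp A.h) (Complex.exp (A.α - N * A.h)) (Complex.exp A.b)
      (Complex.exp A.c) (Complex.exp A.d) (Complex.exp (A.ε - N * A.h))
      (fun i => Complex.exp (A.z i)) N = ∏ j ∈ range N, A.valueRatio (thetaSigma p) j := by
  -- Three signs come from the factors with `b`, `c`, `d`, the fourth from the parity factor.
  have hone : ((-1 : ℂ) ^ N) ^ 4 = 1 := by rw [pow_right_comm]; norm_num
  have e₁ : Complex.exp (A.α - N * A.h) * Complex.exp A.h =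
      Complex.exp (A.α + A.h - N * A.h) := by
    rw [← Complex.exp_add]
    ring_nf
  have e₂ : ∀ b, Complex.exp (A.α - N * A.h) * Complex.exp A.h /
      (Complex.exp b * Complex.exp (A.ε - N * A.h)) =
      Complex.exp (A.h - (A.ε - A.α + b)) := by
    intro b
    rw [← Complex.exp_add, ← Complex.exp_add, ← Complex.exp_sub]
    ring_nf
  have e₃ : (∏ i, Complex.exp (A.z i)) ^ N = Complex.exp (N * ∑ i, A.z i) := by
    rw [← Complex.exp_sum, ← Complex.exp_nat_mul]
  have e₄ : ∀ b, ∏ j ∈ range N, thetaSigma p (A.ε - A.α + b - (j + 1) * A.h) =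
      ∏ j ∈ range N, thetaSigma p (A.poleV (j + 1) + b) := by
    intro b
    refine prod_congr rfl fun j _ => ?_
    congr 1
    simp only [poleV]
    push_cast
    ring
  have e₅ : ∏ j ∈ range N, thetaSigma p (A.α + A.h - (j + 1) * A.h) =
      ∏ j ∈ range N, thetaSigma p (A.α - j * A.h) := by
    refine prod_congr rfl fun j _ => ?_
    congr 1
    ring
  simp only [valueRatio]
  rw [prod_div_distrib, prod_mul_distrib, prod_mul_distrib, prod_mul_distrib, prod_mul_distrib,
    prod_comm (t := (univ : Finset (Fin 4))), jacksonValue, mul_div_mul_comm,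
    prod_ellPoch_div_exp A hp, parityValueFactor_exp A hp hA, e₂, e₂, e₂, e₁, e₃,
    ellPoch_exp_reverse, ellPoch_exp_neg hp, ellPoch_exp_neg hp, ellPoch_exp_neg hp, e₄, e₄, e₄, e₅]
  have hE : Complex.exp (pochExponent A.h (A.α + A.h - N * A.h) N) *
      Complex.exp (pochExponent A.h (A.h - (A.ε - A.α + A.b)) N) *
      Complex.exp (pochExponent A.h (A.h - (A.ε - A.α + A.c)) N) *
      Complex.exp (pochExponent A.h (A.h - (A.ε - A.α + A.d)) N) *
      Complex.exp (-(N * ∑ i, A.z i)) * Complex.exp (n * 0 + -N * ∑ i, A.z i) *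
      Complex.exp (-(N * (4 * A.α + 4 * A.h - 3 * A.ε - N * A.h - 4 * ∑ i, A.z i - A.b - A.c - A.d)
        + 2 * A.h * (N * (N - 1))) / 2) = 1 := by
    simp only [← Complex.exp_add, pochExponent]
    rw [← Complex.exp_zero]
    congr 1
    ring
  generalize (-1 : ℂ) ^ N = s at hone ⊢
  rw [div_eq_mul_inv _ (Complex.exp _), ← Complex.exp_neg]
  have key : ∀ R E s : ℂ, E = 1 → s = 1 → R * (E * s) = R := by
    rintro R _ _ rfl rfl
    simp
  refine Eq.trans ?_ (key _ _ _ hE hone)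
  ring

end JacksonParams

/-! ### The theorem for generic parameters, in multiplicative notation. -/

/-- The multiplicative arguments of the parity dependent factors, up to powers of `q`. -/
noncomputable def parityRatios (n : ℕ) (a b c d e Z : ℂ) : Fin 4 → ℂ :=
  if Odd n then ![e * Z / a, a / (b * Z), a / (c * Z), a / (d * Z)]
  else ![a / Z, a / (c * d * Z), a / (b * d * Z), a / (b * c * Z)]

theorem parityRatios_ne_zero {n : ℕ} {a b c d e Z : ℂ} (ha : a ≠ 0) (hb : b ≠ 0) (hc : c ≠ 0)
    (hd : d ≠ 0) (he : e ≠ 0) (hZ : Z ≠ 0) (i : Fin 4) : parityRatios n a b c d e Z i ≠ 0 := by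
  rw [parityRatios]
  split_ifs <;> fin_cases i <;> simp [*]

/-- Conditions on `a` and `e` are imposed for all powers of `q`, since a deformation of `a` and `e`
will secure them. Those on `z i / z j` and `q` are unaffected by it, so they are restricted to the
range that the denominators of the theorem control. -/
theorem sum_jacksonSummand_of_generic {p q : ℂ} (hp : ‖p‖ < 1) (hq : q ≠ 0) {n N : ℕ}
    {a b c d e : ℂ} {z : Fin n → ℂ} (ha : a ≠ 0) (hb : b ≠ 0) (hc : c ≠ 0) (he : e ≠ 0)
    (hz : ∀ i, z i ≠ 0) (hbal : a ^ 2 * q ^ (N + 1) = b * c * d * e * ∏ i, z i ^ 2)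
    (hsub : ∀ i j, i ≠ j → ∀ l : ℤ, |l| ≤ N → ellTheta p (z i / z j * q ^ l) ≠ 0)
    (hnat : ∀ l : ℕ, 1 ≤ l → l ≤ N → ellTheta p (q ^ l) ≠ 0)
    (halpha : ∀ l : ℤ, ellTheta p (a * q ^ l) ≠ 0)
    (heps : ∀ i, ∀ l : ℤ, ellTheta p (e / z i * q ^ l) ≠ 0)
    (hpole_sub : ∀ i, ∀ l : ℤ, ellTheta p (e / (a * z i) * q ^ l) ≠ 0)
    (hpole_add : ∀ i, ∀ l : ℤ, ellTheta p (e * z i / a * q ^ l) ≠ 0)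
    (hparity : ∀ i, ∀ l : ℤ, ellTheta p (parityRatios n a b c d e (∏ i, z i) i * q ^ l) ≠ 0) :
    ∑ x ∈ indexSimplex n N, jacksonSummand p q a b c d e z N x =
      jacksonValue p q a b c d e z N := by
  obtain ⟨h, rfl⟩ : ∃ h, Complex.exp h = q := ⟨_, Complex.exp_log hq⟩
  obtain ⟨α, rfl⟩ : ∃ α, Complex.exp (α - N * h) = a :=
    ⟨Complex.log a + N * h, by rw [add_sub_cancel_right, Complex.exp_log ha]⟩
  obtain ⟨ε, rfl⟩ : ∃ ε, Complex.exp (ε - N * h) = e :=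
    ⟨Complex.log e + N * h, by rw [add_sub_cancel_right, Complex.exp_log he]⟩
  obtain ⟨b, rfl⟩ : ∃ b', Complex.exp b' = b := ⟨_, Complex.exp_log hb⟩
  obtain ⟨c, rfl⟩ : ∃ c', Complex.exp c' = c := ⟨_, Complex.exp_log hc⟩
  obtain ⟨z, rfl⟩ : ∃ z' : Fin n → ℂ, (fun i => Complex.exp (z' i)) = z :=
    ⟨fun i => Complex.log (z i), funext fun i => Complex.exp_log (hz i)⟩
  -- The logarithm of `d` is prescribed by the additive balancing relation. Independently chosen
  -- logarithms would satisfy it only modulo `2πi`.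
  obtain ⟨d', hd'⟩ : ∃ d', d' = 2 * α + h - b - c - ε - 2 * ∑ i, z i := ⟨_, rfl⟩
  obtain rfl : Complex.exp d' = d := by
    have hne : Complex.exp b * Complex.exp c * Complex.exp (ε - N * h) *
        ∏ i, Complex.exp (z i) ^ 2 ≠ 0 := by
      refine mul_ne_zero (mul_ne_zero (mul_ne_zero ?_ ?_) ?_) (prod_ne_zero_iff.2 fun i _ =>
        pow_ne_zero 2 ?_) <;> exact Complex.exp_ne_zero _
    refine mul_left_cancel₀ hne ?_
    rw [show Complex.exp b * Complex.exp c * Complex.exp (ε - N * h) *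
      (∏ i, Complex.exp (z i) ^ 2) * d = Complex.exp b * Complex.exp c * d *
        Complex.exp (ε - N * h) * ∏ i, Complex.exp (z i) ^ 2 by ring, ← hbal, prod_pow,
      ← Complex.exp_sum]
    simp only [← Complex.exp_nat_mul, ← Complex.exp_add]
    congr 1
    rw [hd']
    push_cast
    ring
  let A : JacksonParams n := ⟨h, α, ε, b, c, d', z, JacksonParams.parityArgs n h α ε b c d'
    (∑ i, z i)⟩
  have hA : A.Compatible := ⟨by simp only [A, hd']; ring, rfl⟩
  have key : ∀ {u v : ℂ} (m : ℤ), ellTheta p (v * Complex.exp h ^ m) ≠ 0 →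
      Complex.exp u = v * Complex.exp h ^ m → thetaSigma p u ≠ 0 := by
    intro u v m hv hu
    rwa [ne_eq, thetaSigma_eq_zero_iff, hu]
  have hG : A.Generic (thetaSigma p) N := by
    constructor
    · intro i j hij l hl
      refine key l (hsub i j hij l hl) ?_
      rw [← Complex.exp_int_mul, ← Complex.exp_sub, ← Complex.exp_add]
    · intro l h1 h2
      rw [ne_eq, thetaSigma_eq_zero_iff, Complex.exp_nat_mul]
      exact hnat l h1 h2
    · intro l
      refine key _ (halpha (N + l)) ?_
      rw [← Complex.exp_int_mul, ← Complex.exp_add]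
      congr 1
      push_cast
      ring
    · intro i l
      refine key _ (heps i (N + l)) ?_
      rw [← Complex.exp_int_mul, ← Complex.exp_sub, ← Complex.exp_add]
      congr 1
      push_cast
      ring
    · intro i l
      refine key _ (hpole_sub i l) ?_
      rw [← Complex.exp_int_mul, ← Complex.exp_add, ← Complex.exp_sub, ← Complex.exp_add]
      congr 1
      ring
    · intro i l
      refine key _ (hpole_add i l) ?_
      rw [← Complex.exp_int_mul, ← Complex.exp_add, ← Complex.exp_sub, ← Complex.exp_add]
      congr 1
      ring
    · intro i l
      have hi := fun m => hparity i m
      simp only [A, JacksonParams.parityArgs]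
      rw [parityRatios, ← Complex.exp_sum] at hi
      split_ifs at hi ⊢ <;> fin_cases i
      · refine key _ (hi l) ?_
        simp [← Complex.exp_int_mul, ← Complex.exp_sub, ← Complex.exp_add]
        congr 1
        ring
      all_goals
        refine key _ (hi (N + 1 + l)) ?_
        simp [← Complex.exp_int_mul, ← Complex.exp_sub, ← Complex.exp_add]
        congr 1
        ring
  refine Eq.trans ?_ (A.jacksonValue_exp hp hA N).symm
  rw [← A.sum_summand_eq (isSigma_thetaSigma hp) hG (hA.balanced (isSigma_thetaSigma hp)) le_rfl]
  exact sum_congr rfl fun x _ => A.jacksonSummand_exp p hA N x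

/-! ### Continuity in `a` and `e`, and genericity outside a countable set. -/

theorem ContinuousAt.prod_fun {ι : Type*} (s : Finset ι) {f : ι → ℂ → ℂ} {t : ℂ}
    (hf : ∀ i ∈ s, ContinuousAt (f i) t) : ContinuousAt (fun u => ∏ i ∈ s, f i u) t :=
  tendsto_finsetProd s hf

theorem ContinuousAt.ellTheta {p t : ℂ} (hp : ‖p‖ < 1) {f : ℂ → ℂ} (hf : ContinuousAt f t)
    (h0 : f t ≠ 0) : ContinuousAt (fun u => ellTheta p (f u)) t :=
  ContinuousAt.comp (g := _root_.ellTheta p) (continuousAt_ellTheta hp h0) hf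

theorem ContinuousAt.ellPoch {p q t : ℂ} (hp : ‖p‖ < 1) (hq : q ≠ 0) {f : ℂ → ℂ}
    (hf : ContinuousAt f t) (h0 : f t ≠ 0) (k : ℕ) :
    ContinuousAt (fun u => ellPoch p q (f u) k) t :=
  ContinuousAt.prod_fun _ fun j _ =>
    (continuousAt_const.mul hf).ellTheta hp (mul_ne_zero (pow_ne_zero j hq) h0)

section Continuity

variable {p q b c d t : ℂ} {n N : ℕ} {z : Fin n → ℂ} {a e : ℂ → ℂ}

theorem continuousAt_paritySummandFactor (hp : ‖p‖ < 1) (hq : q ≠ 0) (ha : ContinuousAt a t)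
    (he : ContinuousAt e t) (ha0 : a t ≠ 0) (hb : b ≠ 0) (hc : c ≠ 0) (hd : d ≠ 0)
    (he0 : e t ≠ 0) (hz : ∏ i, z i ≠ 0)
    (hden : JacksonDenominatorsNeZero p q (a t) b c d (e t) z N) {k : ℕ} (hk : k ≤ N) :
    ContinuousAt (fun u => paritySummandFactor p q (a u) b c d (e u) (∏ i, z i) n N k) t := by
  simp only [paritySummandFactor]
  split_ifs with hn
  · obtain ⟨h1, h2, h3, h4⟩ := hden.odd_summand hn k hk
    refine continuousAt_const.div (((ContinuousAt.mul ?_ ?_).mul ?_).mul ?_)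
      (mul_ne_zero (mul_ne_zero (mul_ne_zero h1 h2) h3) h4) <;>
    refine ContinuousAt.ellPoch hp hq ?_ (by simp [*]) k <;>
    refine ContinuousAt.div₀ (by fun_prop) (by fun_prop) (by simp [*])
  · obtain ⟨h1, h2, h3, h4⟩ := hden.even_summand (Nat.not_odd_iff_even.1 hn) k hk
    refine continuousAt_const.div (((ContinuousAt.mul ?_ ?_).mul ?_).mul ?_)
      (mul_ne_zero (mul_ne_zero (mul_ne_zero h1 h2) h3) h4) <;>
    refine ContinuousAt.ellPoch hp hq ?_ (by simp [*]) k <;>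
    refine ContinuousAt.div₀ (by fun_prop) (by fun_prop) (by simp [*])

theorem continuousAt_parityValueFactor (hp : ‖p‖ < 1) (hq : q ≠ 0) (ha : ContinuousAt a t)
    (he : ContinuousAt e t) (ha0 : a t ≠ 0) (hb : b ≠ 0) (hc : c ≠ 0) (hd : d ≠ 0)
    (he0 : e t ≠ 0) (hz : ∏ i, z i ≠ 0)
    (hden : JacksonDenominatorsNeZero p q (a t) b c d (e t) z N) :
    ContinuousAt (fun u => parityValueFactor p q (a u) b c d (e u) (∏ i, z i) n N) t := by
  simp only [parityValueFactor]
  split_ifs with hn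
  · obtain ⟨-, h2, h3, h4⟩ := hden.odd_summand hn N le_rfl
    refine (he.pow N).div (((ContinuousAt.mul ?_ ?_).mul ?_).mul ?_)
      (mul_ne_zero (mul_ne_zero (mul_ne_zero h2 h3) h4) (hden.odd_value hn)) <;>
    refine ContinuousAt.ellPoch hp hq ?_ (by simp [*]) N <;>
    refine ContinuousAt.div₀ (by fun_prop) (by fun_prop) (by simp [*])
  · obtain ⟨h1, -⟩ := hden.even_summand (Nat.not_odd_iff_even.1 hn) N le_rfl
    obtain ⟨h2, h3, h4⟩ := hden.even_value (Nat.not_odd_iff_even.1 hn)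
    refine continuousAt_const.div (((ContinuousAt.mul ?_ ?_).mul ?_).mul ?_)
      (mul_ne_zero (mul_ne_zero (mul_ne_zero h1 h2) h3) h4) <;>
    refine ContinuousAt.ellPoch hp hq ?_ (by simp [*]) N <;>
    refine ContinuousAt.div₀ (by fun_prop) (by fun_prop) (by simp [*])

theorem continuousAt_jacksonValue (hp : ‖p‖ < 1) (hq : q ≠ 0) (ha : ContinuousAt a t)
    (he : ContinuousAt e t) (ha0 : a t ≠ 0) (hb : b ≠ 0) (hc : c ≠ 0) (hd : d ≠ 0)
    (he0 : e t ≠ 0) (hz : ∀ i, z i ≠ 0)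
    (hden : JacksonDenominatorsNeZero p q (a t) b c d (e t) z N) :
    ContinuousAt (fun u => jacksonValue p q (a u) b c d (e u) z N) t := by
  have hZ : ∏ i, z i ≠ 0 := prod_ne_zero_iff.2 fun i _ => hz i
  refine ContinuousAt.mul (ContinuousAt.div₀ ?_ ?_ ?_)
    (continuousAt_parityValueFactor hp hq ha he ha0 hb hc hd he0 hZ hden)
  · refine ((((ContinuousAt.ellPoch hp hq (by fun_prop) (by simp [*]) N).mul ?_).mul ?_).mul
      ?_).mul (ContinuousAt.prod_fun _ fun i _ => ?_) <;>
    refine ContinuousAt.ellPoch hp hq ?_ (by simp [*]) N <;>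
    refine ContinuousAt.div₀ (by fun_prop) (by fun_prop) (by simp [*])
  · refine continuousAt_const.mul (ContinuousAt.prod_fun _ fun i _ => ?_)
    refine ContinuousAt.ellPoch hp hq ?_ (by simp [*]) N
    exact ContinuousAt.div₀ (by fun_prop) (by fun_prop) he0
  · exact mul_ne_zero (pow_ne_zero N hZ) (prod_ne_zero_iff.2 fun i _ => hden.aq_div_e i N le_rfl)

theorem continuousAt_jacksonSummand (hp : ‖p‖ < 1) (hq : q ≠ 0) (ha : ContinuousAt a t)
    (he : ContinuousAt e t) (ha0 : a t ≠ 0) (hb : b ≠ 0) (hc : c ≠ 0) (hd : d ≠ 0)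
    (he0 : e t ≠ 0) (hz : ∀ i, z i ≠ 0)
    (hden : JacksonDenominatorsNeZero p q (a t) b c d (e t) z N) {x : Fin n → ℕ}
    (hx : x ∈ indexSimplex n N) :
    ContinuousAt (fun u => jacksonSummand p q (a u) b c d (e u) z N x) t := by
  have hZ : ∏ i, z i ≠ 0 := prod_ne_zero_iff.2 fun i _ => hz i
  have hk := mem_indexSimplex.1 hx
  have hi : ∀ i, x i ≤ N := fun i => (JacksonParams.le_sum x i).trans hk
  refine (((((continuousAt_const.mul ?_).mul ?_).mul ?_).mul continuousAt_const).mul ?_).mul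
    (continuousAt_paritySummandFactor hp hq ha he ha0 hb hc hd he0 hZ hden hk)
  · refine ContinuousAt.div₀ ?_ (ha.ellTheta hp ha0) hden.theta_a
    exact ContinuousAt.ellTheta hp (by fun_prop) (by simp [*])
  · refine continuousAt_const.div (ContinuousAt.prod_fun _ fun i _ => ?_)
      (prod_ne_zero_iff.2 fun i _ => hden.e_div x hx i)
    exact ContinuousAt.ellPoch hp hq (he.div_const _) (by simp [*]) _
  · refine ContinuousAt.div₀ (((ha.ellPoch hp hq ha0 _).mul continuousAt_const).mul
      (ContinuousAt.prod_fun _ fun i _ => ?_)) ?_ (hden.aq_pow _ hk)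
    · exact ContinuousAt.ellPoch hp hq (he.div_const _) (by simp [*]) _
    · exact ContinuousAt.ellPoch hp hq (by fun_prop) (by simp [*]) _
  · refine ContinuousAt.prod_fun _ fun i _ => ContinuousAt.div₀ (continuousAt_const.mul ?_)
      (ContinuousAt.mul ?_ continuousAt_const) (mul_ne_zero (hden.aq_div_e i _ (hi i))
      (prod_ne_zero_iff.2 fun j _ => hden.q_div i j _ (hi i))) <;>
    refine ContinuousAt.ellPoch hp hq ?_ (by simp [*]) _ <;>
    refine ContinuousAt.div₀ (by fun_prop) (by fun_prop) (by simp [*])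

end Continuity

theorem countable_ellTheta_const_mul_zeros {p C : ℂ} (hp : ‖p‖ < 1) (hC : C ≠ 0) :
    {t : ℂ | t ≠ 0 ∧ ellTheta p (C * t) = 0}.Countable := by
  refine ((countable_ellTheta_zeros hp).preimage_of_injOn
    (mul_right_injective₀ hC).injOn).mono ?_
  rintro t ⟨h1, h2⟩
  exact ⟨mul_ne_zero hC h1, h2⟩

theorem countable_ellTheta_const_mul_sq_zeros {p C : ℂ} (hp : ‖p‖ < 1) (hC : C ≠ 0) :
    {t : ℂ | t ≠ 0 ∧ ellTheta p (C * t ^ 2) = 0}.Countable := by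
  have h := (countable_ellTheta_const_mul_zeros hp hC).biUnion fun s _ =>
    ((Polynomial.nthRoots 2 s).toFinset.countable_toSet)
  refine h.mono ?_
  rintro t ⟨h1, h2⟩
  simp only [Set.mem_iUnion]
  refine ⟨t ^ 2, ⟨pow_ne_zero 2 h1, h2⟩, ?_⟩
  simp [Polynomial.mem_nthRoots]

/-- Positive `l` comes from the factors of `(q z_i / z_j)_N`, negative `l` from the same factors
with `i` and `j` exchanged and inverted, and `l = 0` from the denominator of `Δ`. -/
theorem JacksonDenominatorsNeZero.ellTheta_div_mul_zpow_ne_zero {p q a b c d e : ℂ} {n N : ℕ}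
    {z : Fin n → ℂ} (hden : JacksonDenominatorsNeZero p q a b c d e z N) (hp : ‖p‖ < 1)
    (hq : q ≠ 0) (hz : ∀ i, z i ≠ 0) {i j : Fin n} (hij : i ≠ j) {l : ℤ} (hl : |l| ≤ N) :
    ellTheta p (z i / z j * q ^ l) ≠ 0 := by
  have hinv : ∀ u : ℂ, u ≠ 0 → ellTheta p u⁻¹ ≠ 0 → ellTheta p u ≠ 0 := by
    intro u hu h h'
    have := ellTheta_inv hp hu
    rw [h', neg_zero] at this
    exact mul_ne_zero h hu this
  have hpos : ∀ i j (m : ℕ), m + 1 ≤ N → ellTheta p (z i / z j * q ^ (m + 1)) ≠ 0 := by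
    intro i j m hm
    have := prod_ne_zero_iff.1 (hden.q_div i j N le_rfl) m (mem_range.2 hm)
    rwa [show z i / z j * q ^ (m + 1) = q ^ m * (q * z i / z j) by ring]
  obtain ⟨m, rfl | rfl⟩ := l.eq_nat_or_neg
  · rcases m with _ | m
    · simp only [Nat.cast_zero, zpow_zero, mul_one]
      rcases lt_or_gt_of_ne hij with h | h
      · refine hinv _ (div_ne_zero (hz i) (hz j)) ?_
        rw [inv_div]
        exact hden.delta i j h
      · exact hden.delta j i h
    · rw [zpow_natCast]
      exact hpos i j m (by rw [abs_le] at hl; omega)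
  · rcases m with _ | m
    · simp only [Nat.cast_zero, neg_zero, zpow_zero, mul_one]
      rcases lt_or_gt_of_ne hij with h | h
      · refine hinv _ (div_ne_zero (hz i) (hz j)) ?_
        rw [inv_div]
        exact hden.delta i j h
      · exact hden.delta j i h
    · refine hinv _ (mul_ne_zero (div_ne_zero (hz i) (hz j)) (zpow_ne_zero _ hq)) ?_
      rw [mul_inv, inv_div, zpow_neg, inv_inv, zpow_natCast]
      exact hpos j i m (by rw [abs_le] at hl; omega)

theorem JacksonDenominatorsNeZero.ellTheta_pow_ne_zero {p q a b c d e : ℂ} {n N : ℕ}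
    {z : Fin n → ℂ} (hden : JacksonDenominatorsNeZero p q a b c d e z N) (i : Fin n)
    (hz : z i ≠ 0) {l : ℕ} (hl : 1 ≤ l) (hlN : l ≤ N) : ellTheta p (q ^ l) ≠ 0 := by
  obtain ⟨m, rfl⟩ := Nat.exists_eq_add_of_le' hl
  have := prod_ne_zero_iff.1 (hden.q_div i i N le_rfl) m (mem_range.2 hlN)
  rwa [mul_div_cancel_right₀ _ hz, ← pow_succ] at this

/-- The exceptional values of `t` for the deformation `a ↦ a t`, `e ↦ e t ^ 2`. -/
theorem exists_countable_generic {p q : ℂ} (hp : ‖p‖ < 1) (hq : q ≠ 0) {n : ℕ} {a b c d e : ℂ}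
    {z : Fin n → ℂ} (ha : a ≠ 0) (hb : b ≠ 0) (hc : c ≠ 0) (hd : d ≠ 0) (he : e ≠ 0)
    (hz : ∀ i, z i ≠ 0) : ∃ B : Set ℂ, B.Countable ∧ ∀ t ∉ B, t ≠ 0 ∧
      (∀ l : ℤ, ellTheta p (a * t * q ^ l) ≠ 0) ∧
      (∀ i, ∀ l : ℤ, ellTheta p (e * t ^ 2 / z i * q ^ l) ≠ 0) ∧
      (∀ i, ∀ l : ℤ, ellTheta p (e * t ^ 2 / (a * t * z i) * q ^ l) ≠ 0) ∧
      (∀ i, ∀ l : ℤ, ellTheta p (e * t ^ 2 * z i / (a * t) * q ^ l) ≠ 0) ∧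
      ∀ i, ∀ l : ℤ,
        ellTheta p (parityRatios n (a * t) b c d (e * t ^ 2) (∏ i, z i) i * q ^ l) ≠ 0 := by
  have hZ : ∏ i, z i ≠ 0 := prod_ne_zero_iff.2 fun i _ => hz i
  -- With `e` scaled by `t^2`, all four ratios scale by exactly `t` in both parities, so each
  -- condition excludes countably many `t`.
  have hR : ∀ t ≠ 0, ∀ i, parityRatios n (a * t) b c d (e * t ^ 2) (∏ i, z i) i =
      parityRatios n a b c d e (∏ i, z i) i * t := by
    intro t ht i
    simp only [parityRatios]
    split_ifs <;> fin_cases i <;> simp <;> field_simp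
  refine ⟨{0} ∪ (⋃ l : ℤ, {t : ℂ | t ≠ 0 ∧ ellTheta p (a * q ^ l * t) = 0}) ∪
    (⋃ i, ⋃ l : ℤ, {t : ℂ | t ≠ 0 ∧ ellTheta p (e / z i * q ^ l * t ^ 2) = 0}) ∪
    (⋃ i, ⋃ l : ℤ, {t : ℂ | t ≠ 0 ∧ ellTheta p (e / (a * z i) * q ^ l * t) = 0}) ∪
    (⋃ i, ⋃ l : ℤ, {t : ℂ | t ≠ 0 ∧ ellTheta p (e * z i / a * q ^ l * t) = 0}) ∪
    ⋃ i, ⋃ l : ℤ, {t : ℂ | t ≠ 0 ∧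
      ellTheta p (parityRatios n a b c d e (∏ i, z i) i * q ^ l * t) = 0}, ?_, ?_⟩
  · have hql : ∀ l : ℤ, q ^ l ≠ 0 := fun l => zpow_ne_zero l hq
    refine (((((Set.countable_singleton 0).union ?_).union ?_).union ?_).union ?_).union ?_
    · exact Set.countable_iUnion fun l =>
        countable_ellTheta_const_mul_zeros hp (mul_ne_zero ha (hql l))
    · exact Set.countable_iUnion fun i => Set.countable_iUnion fun l =>
        countable_ellTheta_const_mul_sq_zeros hp (mul_ne_zero (div_ne_zero he (hz i)) (hql l))
    · exact Set.countable_iUnion fun i => Set.countable_iUnion fun l =>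
        countable_ellTheta_const_mul_zeros hp
          (mul_ne_zero (div_ne_zero he (mul_ne_zero ha (hz i))) (hql l))
    · exact Set.countable_iUnion fun i => Set.countable_iUnion fun l =>
        countable_ellTheta_const_mul_zeros hp
          (mul_ne_zero (div_ne_zero (mul_ne_zero he (hz i)) ha) (hql l))
    · exact Set.countable_iUnion fun i => Set.countable_iUnion fun l =>
        countable_ellTheta_const_mul_zeros hp
          (mul_ne_zero (parityRatios_ne_zero ha hb hc hd he hZ i) (hql l))
  · intro t ht
    simp only [Set.mem_union, Set.mem_iUnion, Set.mem_ofPred_eq, Set.mem_singleton_iff, not_or,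
      not_exists, not_and] at ht
    obtain ⟨⟨⟨⟨⟨h0, h1⟩, h2⟩, h3⟩, h4⟩, h5⟩ := ht
    refine ⟨h0, fun l => ?_, fun i l => ?_, fun i l => ?_, fun i l => ?_, fun i l => ?_⟩
    · rw [mul_right_comm]
      exact h1 l h0
    · rw [show e * t ^ 2 / z i * q ^ l = e / z i * q ^ l * t ^ 2 by ring]
      exact h2 i l h0
    · rw [show e * t ^ 2 / (a * t * z i) * q ^ l = e / (a * z i) * q ^ l * t by
        have := hz i; field_simp]
      exact h3 i l h0
    · rw [show e * t ^ 2 * z i / (a * t) * q ^ l = e * z i / a * q ^ l * t by field_simp]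
      exact h4 i l h0
    · rw [hR t h0, mul_right_comm]
      exact h5 i l h0

/-- Without variables the denominators say nothing about `θ(q^l)`, so the generic argument is
unavailable. Here the sum is the single term 1, and in the closed form numerator and denominator
coincide since `Z = 1`. -/
theorem sum_jacksonSummand_zero {p q a b c d e : ℂ} {z : Fin 0 → ℂ} {N : ℕ}
    (hden : JacksonDenominatorsNeZero p q a b c d e z N) :
    ∑ x ∈ indexSimplex 0 N, jacksonSummand p q a b c d e z N x =
      jacksonValue p q a b c d e z N := by
  have hset : indexSimplex 0 N = {0} := by
    ext x
    simp [mem_indexSimplex, Subsingleton.elim x 0]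
  obtain ⟨h1, -⟩ := hden.even_summand ⟨0, rfl⟩ N le_rfl
  obtain ⟨h2, h3, h4⟩ := hden.even_value ⟨0, rfl⟩
  simp only [univ_eq_empty, prod_empty, mul_one, div_one] at h1 h2 h3 h4
  rw [hset, sum_singleton]
  simp [jacksonSummand, jacksonValue, paritySummandFactor, parityValueFactor, ellDelta, ellPoch,
    hden.theta_a, -mul_inv_rev]
  simp only [ellPoch] at h1 h2 h3 h4
  rw [mul_inv_cancel₀ (mul_ne_zero (mul_ne_zero (mul_ne_zero h1 h2) h3) h4)]

theorem corollary4p3 (p q : ℂ) (hp : ‖p‖ < 1) (hq : q ≠ 0) (n N : ℕ)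
    (a b c d e : ℂ) (z : Fin n → ℂ)
    (ha : a ≠ 0) (hb : b ≠ 0) (hc : c ≠ 0) (hd : d ≠ 0) (he : e ≠ 0) (hz : ∀ i, z i ≠ 0)
    (hbal : a ^ 2 * q ^ (N + 1) = b * c * d * e * ∏ i, z i ^ 2)
    (hden : JacksonDenominatorsNeZero p q a b c d e z N) :
    ∑ x ∈ indexSimplex n N, jacksonSummand p q a b c d e z N x =
      jacksonValue p q a b c d e z N := by
  rcases n with _ | n
  · exact sum_jacksonSummand_zero hden
  obtain ⟨B, hB, hgen⟩ := exists_countable_generic hp hq ha hb hc hd he hz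
  have hL : ContinuousAt (fun t => ∑ x ∈ indexSimplex (n + 1) N,
      jacksonSummand p q (a * t) b c d (e * t ^ 2) z N x) 1 :=
    tendsto_finsetSum _ fun x hx => continuousAt_jacksonSummand hp hq (a := fun t => a * t)
      (e := fun t => e * t ^ 2) (by fun_prop) (by fun_prop) (by simpa) hb hc hd (by simpa) hz
      (by simpa) hx
  have hR : ContinuousAt (fun t => jacksonValue p q (a * t) b c d (e * t ^ 2) z N) 1 :=
    continuousAt_jacksonValue hp hq (a := fun t => a * t)
      (e := fun t => e * t ^ 2) (by fun_prop) (by fun_prop) (by simpa) hb hc hd (by simpa) hz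
      (by simpa)
  -- The value `t = 1` may itself be exceptional, but the complement of a countable set is dense, so
  -- both sides at 1 are limits along generic `t`.
  have hne : (nhdsWithin (1 : ℂ) Bᶜ).NeBot :=
    mem_closure_iff_nhdsWithin_neBot.1 (hB.dense_compl ℂ 1)
  have heq := tendsto_nhds_unique_of_eventuallyEq (hL.mono_left (nhdsWithin_le_nhds (s := Bᶜ)))
    (hR.mono_left nhdsWithin_le_nhds) ?_
  · simpa using heq
  · filter_upwards [self_mem_nhdsWithin] with t ht
    obtain ⟨h0, h1, h2, h3, h4, h5⟩ := hgen t ht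
    refine sum_jacksonSummand_of_generic hp hq (mul_ne_zero ha h0) hb hc
      (mul_ne_zero he (pow_ne_zero 2 h0)) hz (by linear_combination t ^ 2 * hbal) ?_ ?_ h1 h2 h3
      h4 h5
    · exact fun i j hij l hl => hden.ellTheta_div_mul_zpow_ne_zero hp hq hz hij hl
    · exact fun l h1 h2 => hden.ellTheta_pow_ne_zero 0 (hz 0) h1 h2
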